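/- Fix real numbers $L, R \ge 0$ and a stochastic process $\varphi = (\varphi(1), \varphi(2), \ldots)$ with $\varphi(i) = (\varphi^{(x)}_i, \varphi^{(y)}_i) \in \{0,1\}\times\{0,1\}$ (with an arbitrary joint law). **ASEP.** Consider the asymmetric simple exclusion process on $\mathbb{Z}$ with left jump rate $L$, right jump rate $R$ and initial data $\varphi$: site $x > 0$ is initially occupied iff $\varphi^{(x)}_x = 1$, and site $x \le 0$ is initially occupied iff $\varphi^{(y)}_{1-x} = 1$. It is defined graphically: independently of $\varphi$, each site $x \in \mathbb{Z}$ carries a right exponential clock of rate $R$ and a left exponential clock of rate $L$, all independent; when the right (left) clock of $x$ rings and $x$ is occupied just before, the particle at $x$ jumps to $x+1$ (to $x-1$) if that site is vacant just before, and otherwise stays. Let $\cdots < X_{-1}(t) < X_0(t) < X_1(t) < \cdots$ be the tagged particles, labelled so that $X_{-1}(0) \le 0 < X_0(0)$ (only those labels that occur, if one side has finitely many particles). **Stochastic six-vertex model.** For $\varepsilon > 0$ let $\delta_1 = \varepsilon L$, $\delta_2 = \varepsilon R$, with $\varepsilon$ so small that $\delta_1, \delta_2 \in [0,1)$. Consider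 the stochastic six-vertex model $\mathcal{P}(\delta_1,\delta_2)$ on $\mathbb{Z}_{>0}^2$ with initial data $\varphi$: a random ensemble of up-right paths, in which a path enters $(x,1)$ from below iff $\varphi^{(x)}_x = 1$ and enters $(1,y)$ from the left iff $\varphi^{(y)}_y = 1$, and where, independently at each vertex and independently of $\varphi$, a path entering alone from below exits upwards with probability $\delta_1$ and to the right with probability $1-\delta_1$, a path entering alone from the left exits to the right with probability $\delta_2$ and upwards with probability $1-\delta_2$, and if two paths enter then one exits upwards and one to the right. Place a particle at site $p \ge 1$ at time $t \in \mathbb{Z}_{\ge 0}$ iff a path enters the vertex $(p, t+1)$ from below, let $N(t) = \sum_{s=1}^t \varphi^{(y)}_s$, denote the particle positions at time $t$ from left to right by $p_{-N(t)}(t) < p_{1-N(t)}(t) < \cdots$, and let $q_i(t) = p_i(t) - t$. Fix a positive integer $k$, integers $i_1, \ldots, i_k$, real numbers $t_1, \ldots, t_k > 0$ and a finite set $S \subset \mathbb{Z}^k$. Then $$\lim_{\varepsilon \to 0^+} \mathbb{P}\Big[\big(q_{i_1}(\lfloor \varepsilon^{-1} t_1\rfloor), \ldots, q_{i_k}(\lfloor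 \varepsilon^{-1} t_k\rfloor)\big) \in S\Big] = \mathbb{P}\Big[\big(X_{i_1}(t_1), \ldots, X_{i_k}(t_k)\big) \in S\Big],$$ where each event includes the requirement that all the particles in question exist (at the time in question). -/

import Mathlib

open MeasureTheory ProbabilityTheory Filter Topology

namespace SixVertex

noncomputable section

/-! ### The stochastic six-vertex model

Initial data is a sequence `φ 1, φ 2, …` with `φ i = (φ^(x)_i, φ^(y)_i)`, where `true` stands for `1`
and `false` for `0`. The value `φ 0` is never used. -/

/-- Random completion of a half-configuration at a vertex, driven by a uniform variable `u` on
`[0, 1]`. The Booleans `v`, `h` say whether a path enters vertically, resp. horizontally; the result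
says whether a path exits (upwards, to the right). Thus a path entering alone from below goes
straight up with probability `δ₁` and turns right with probability `1 - δ₁`; a path entering alone
from the left goes straight to the right with probability `δ₂` and turns up with probability
`1 - δ₂`; in the two other cases there is only one completion. -/
def completeVertex (δ₁ δ₂ : ℝ) (u : unitInterval) (v h : Bool) : Bool × Bool :=
  match v, h with
  | false, false => (false, false)
  | true, true => (true, true)
  | true, false => if (u : ℝ) < δ₁ then (true, false) else (false, true)
  | false, true => if (u : ℝ) < δ₂ then (false, true) else (true, false)

/-- The directed path ensemble on the quadrant obtained from the initial data `φ` by completing the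
vertex `(x, y)`, `x, y ≥ 1`, with the variable `u (x, y)`. The value at `(x, y)` says whether the
edges `(x, y) → (x, y + 1)` and `(x, y) → (x + 1, y)` belong to a path. Edges that leave the
coordinate axes are prescribed by the initial data. -/
def ensemble (δ₁ δ₂ : ℝ) (φ : ℕ → Bool × Bool) (u : ℕ × ℕ → unitInterval) :
    ℕ → ℕ → Bool × Bool
  | 0, 0 => (false, false)
  | x + 1, 0 => ((φ (x + 1)).1, false)
  | 0, y + 1 => (false, (φ (y + 1)).2)
  | x + 1, y + 1 =>
      completeVertex δ₁ δ₂ (u (x + 1, y + 1))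
        (ensemble δ₁ δ₂ φ u (x + 1) y).1 (ensemble δ₁ δ₂ φ u x (y + 1)).2

/-- There is a particle at site `x` at time `t`: a path vertically enters the vertex
`(x, t + 1)`. (Never true for `x = 0`.) -/
def occupied (δ₁ δ₂ : ℝ) (φ : ℕ → Bool × Bool) (u : ℕ × ℕ → unitInterval) (t x : ℕ) : Bool :=
  (ensemble δ₁ δ₂ φ u x t).1

/-- The number `N(t)` of paths that entered through the `y`-axis in the rows `1, …, t`. -/
def numBlue (φ : ℕ → Bool × Bool) (t : ℕ) : ℕ :=
  ((Finset.Icc 1 t).filter (fun s => (φ s).2 = true)).card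

open scoped Classical in
/-- The position `p_i(t)` of particle `i` at time `t`: the occupied site with exactly `i + N(t)`
occupied sites to its left. It is `none` if there is no such particle. The particles are thus
numbered `-N(t), 1 - N(t), …` from left to right. -/
def position (δ₁ δ₂ : ℝ) (φ : ℕ → Bool × Bool) (u : ℕ × ℕ → unitInterval) (t : ℕ) (i : ℤ) :
    Option ℤ :=
  if h : ∃ x : ℕ, occupied δ₁ δ₂ φ u t x = true ∧
      (((Finset.range x).filter (fun y => occupied δ₁ δ₂ φ u t y = true)).card : ℤ)
        = i + numBlue φ t
  then some (Nat.find h : ℤ) else none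

/-- The offset position `q_i(t) = p_i(t) - t`. -/
def offsetPosition (δ₁ δ₂ : ℝ) (φ : ℕ → Bool × Bool) (u : ℕ × ℕ → unitInterval) (t : ℕ) (i : ℤ) :
    Option ℤ :=
  (position δ₁ δ₂ φ u t i).map (fun p => p - (t : ℤ))

/-- Independent uniform variables on `[0, 1]`, one for each vertex. -/
def vertexMeasure : Measure (ℕ × ℕ → unitInterval) :=
  Measure.infinitePi (fun _ : ℕ × ℕ => (volume : Measure unitInterval))

end

end SixVertex

namespace ASEP

noncomputable section

/-! ### The asymmetric simple exclusion process (graphical definition) -/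

/-- The times at which a clock rings that has the given rate, where `ξ 0, ξ 1, …` are the waiting
times of a clock of rate one. A clock of rate `0` does not ring (if the `ξ n` are positive). -/
def ringTimes (rate : ℝ) (ξ : ℕ → ℝ) : Set ℝ :=
  {t | 0 < t ∧ ∃ n : ℕ, rate * t = ∑ m ∈ Finset.range (n + 1), ξ m}

/-- The time graph: `(t, i, j)` is an instruction for a particle at site `i` to attempt a jump to
site `j` at time `t`. Each site `i` has a right clock, of rate `R`, with waiting times
`ξ (i, true, ·)`, and a left clock, of rate `L`, with waiting times `ξ (i, false, ·)`. -/
def timeGraph (L R : ℝ) (ξ : ℤ × Bool × ℕ → ℝ) : Set (ℝ × ℤ × ℤ) :=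
  {g | g.1 ∈ ringTimes R (fun n => ξ (g.2.1, true, n)) ∧ g.2.2 = g.2.1 + 1} ∪
  {g | g.1 ∈ ringTimes L (fun n => ξ (g.2.1, false, n)) ∧ g.2.2 = g.2.1 - 1}

/-- The initial configuration: a site `x > 0` is occupied iff `φ^(x)_x = 1`, and a site `x ≤ 0` is
occupied iff `φ^(y)_{1-x} = 1`. -/
def initialConfig (φ : ℕ → Bool × Bool) (x : ℤ) : Bool :=
  if 0 < x then (φ x.toNat).1 else (φ (1 - x).toNat).2

/-- The label of the particle that starts at the occupied site `x`. Labels increase from left to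
right, and particle `0` is the first one to the right of the origin: `X_{-1}(0) ≤ 0 < X_0(0)`. -/
def label (η : ℤ → Bool) (x : ℤ) : ℤ :=
  if 0 < x then (((Finset.Ico 1 x).filter (fun y => η y = true)).card : ℤ)
  else -(((Finset.Icc x 0).filter (fun y => η y = true)).card : ℤ)

/-- At time `t`, just before which the labelled particles have the positions `Y`, a particle at
site `x` is told to jump to site `j`, and site `j` is vacant. -/
def JumpPerformed (G : Set (ℝ × ℤ × ℤ)) (t : ℝ) (Y : ℤ → Option ℤ) (x j : ℤ) : Prop :=
  (t, x, j) ∈ G ∧ ∀ l : ℤ, Y l ≠ some j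

/-- `X t k` (`t ≥ 0`) are the positions of the tagged particles of the exclusion process with time
graph `G` and initial configuration `η`; `none` means that there is no particle with label `k`. -/
structure IsTrajectory (G : Set (ℝ × ℤ × ℤ)) (η : ℤ → Bool) (X : ℝ → ℤ → Option ℤ) : Prop where
  /-- The initial positions. -/
  initial : ∀ k x : ℤ, X 0 k = some x ↔ (η x = true ∧ label η x = k)
  /-- Trajectories are right-continuous. -/
  right_continuous : ∀ t : ℝ, 0 ≤ t → ∀ k : ℤ, ∀ᶠ s in 𝓝[>] t, X s k = X t k
  /-- Trajectories have left limits `Y` at each time `t > 0`, and the state at time `t` results from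
  `Y` by performing those jumps of the time graph whose target is vacant just before `t`. -/
  update : ∀ t : ℝ, 0 < t → ∃ Y : ℤ → Option ℤ,
    (∀ k : ℤ, ∀ᶠ s in 𝓝[<] t, X s k = Y k) ∧
    (∀ k x j : ℤ, Y k = some x → JumpPerformed G t Y x j → X t k = some j) ∧
    (∀ k : ℤ, (∀ x j : ℤ, Y k = some x → ¬ JumpPerformed G t Y x j) → X t k = Y k)

open scoped Classical in
/-- The position `X_k(t)` of particle `k` at time `t` in the process with time graph `G` and initial
configuration `η`. For almost every time graph the trajectory exists and is unique. -/
def position (G : Set (ℝ × ℤ × ℤ)) (η : ℤ → Bool) (t : ℝ) (k : ℤ) : Option ℤ :=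
  if h : ∃ X : ℝ → ℤ → Option ℤ, IsTrajectory G η X then h.choose t k else none

instance : IsProbabilityMeasure (expMeasure 1) := isProbabilityMeasure_expMeasure one_pos

/-- Independent exponential waiting times of rate one for all clocks. -/
def clockMeasure : Measure (ℤ × Bool × ℕ → ℝ) :=
  Measure.infinitePi (fun _ : ℤ × Bool × ℕ => expMeasure 1)

end

end ASEP

/-!
Both models are built from the same exponential clocks, and then the particle positions agree for all
small `ε`, almost surely.

*Driving the six-vertex model by clocks.* Let `ξ₀, ξ₁, …` be the waiting times (of rate one) of a
clock of rate `r`, so that it rings at the times `(ξ₀ + ⋯ + ξₘ) / r`. With `lam = -log (1 - ε r)`, let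
the discretized clock ring at the steps `⌈ξ₀ / lam⌉ + ⋯ + ⌈ξₘ / lam⌉`. As the exponential distribution
is memoryless, the indicators of a ring at step `1, 2, …` are independent Bernoulli variables of
parameter `ε r` (`ASEP.waitingMeasure_stepBit`). At the vertex `(x, y)`, on the diagonal
`d = x - y`, a path entering alone from below goes straight iff the left clock of the site `d + 1`
rings at step `y`, and a path entering alone from the left goes straight iff the right clock of `d`
does. The two bits at a vertex are independent, whereas in the usual sampling both come from a single
uniform variable; but each vertex uses only one of them, so the law of the ensemble is the same
(`SixVertex.measure_drivenEnsemble_mem_eq`).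

*The moving frame.* With `q = x - n`, a row of vertices whose bits all vanish leaves the
configuration unchanged, for every lone path then turns at every vertex. A single bit at the diagonal
`d`, with no other bit at `d - 1`, `d` or `d + 1`, performs exactly the jump of the exclusion process
across the bond `{d, d + 1}` that is prescribed by that clock (`SixVertex.update_eq_self`,
`SixVertex.update_pair`).

*Localization.* Almost surely there are, arbitrarily far on both sides of the origin, bonds whose two
clocks do not ring up to any given time. Between two of them only finitely many rings happen, at
distinct times which also differ from the observation times (`ASEP.GoodClocks`,
`ASEP.ae_goodClocks`). Such sealed boxes give the existence and the uniqueness of the trajectory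
(`ASEP.exists_isTrajectory`, `ASEP.IsTrajectory.eq_of_agree`). As `ε → 0`, `ε` times the step of each
ring tends to the time of that ring, so for small `ε` the finitely many rings in the box happen one at
a time, in the same order in both models, and on the same side of the observation times
(`ASEP.GoodClocks.eventually_coupled`). Hence the configurations in the box agree
(`ASEP.Coupled.config_eq`).

*Labels.* Nearest-neighbour exclusion preserves the order of the particles and no particle crosses a
sealed bond, so the label of a particle is found by counting the particles of the box on its left
(`ASEP.IsTrajectory.eq_some_iff`, `SixVertex.hasParticle_iff_of_silent_bond`). Therefore the
indicators of the events converge almost surely, and so do the probabilities.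
-/


/-! ### The six-vertex model driven by random bits -/

namespace SixVertex

/-- The completion of a vertex with entering paths `v` (from below) and `h` (from the left) when two
bits are prescribed: `a` says whether a path entering alone from below goes straight, and `b` whether
a path entering alone from the left does. -/
def completion (a b v h : Bool) : Bool × Bool :=
  match v, h with
  | false, false => (false, false)
  | true, true => (true, true)
  | true, false => if a then (true, false) else (false, true)
  | false, true => if b then (false, true) else (true, false)

/-- The path ensemble with initial data `φ` in which the vertex `v` is completed with the bits `a v`
and `b v`. The conventions are those of `ensemble`. -/
def drivenEnsemble (a b : ℕ × ℕ → Bool) (φ : ℕ → Bool × Bool) : ℕ → ℕ → Bool × Bool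
  | 0, 0 => (false, false)
  | x + 1, 0 => ((φ (x + 1)).1, false)
  | 0, y + 1 => (false, (φ (y + 1)).2)
  | x + 1, y + 1 =>
      completion (a (x + 1, y + 1)) (b (x + 1, y + 1))
        (drivenEnsemble a b φ (x + 1) y).1 (drivenEnsemble a b φ x (y + 1)).2

lemma completeVertex_eq_completion (δ₁ δ₂ : ℝ) (u : unitInterval) (v h : Bool) :
    completeVertex δ₁ δ₂ u v h = completion (decide ((u : ℝ) < δ₁)) (decide ((u : ℝ) < δ₂)) v h := by
  cases v <;> cases h <;> simp [completeVertex, completion]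

lemma ensemble_eq_drivenEnsemble (δ₁ δ₂ : ℝ) (φ : ℕ → Bool × Bool) (u : ℕ × ℕ → unitInterval)
    (x y : ℕ) :
    ensemble δ₁ δ₂ φ u x y = drivenEnsemble (fun v => decide ((u v : ℝ) < δ₁))
      (fun v => decide ((u v : ℝ) < δ₂)) φ x y := by
  induction y generalizing x with
  | zero => cases x <;> simp [ensemble, drivenEnsemble]
  | succ y ihy =>
    induction x with
    | zero => simp [ensemble, drivenEnsemble]
    | succ x ihx => rw [ensemble, drivenEnsemble, ihy, ihx, completeVertex_eq_completion]

/-- In the ensemble `e` the particle with label `i` has the offset position `s` at time `n`. -/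
def HasParticle (e : ℕ → ℕ → Bool × Bool) (φ : ℕ → Bool × Bool) (n : ℕ) (i s : ℤ) : Prop :=
  ∃ x : ℕ, (x : ℤ) = s + n ∧ (e x n).1 = true ∧
    (((Finset.range x).filter (fun y => (e y n).1 = true)).card : ℤ) = i + numBlue φ n

lemma card_filter_range_lt (f : ℕ → Bool) {x x' : ℕ} (h : x < x') (hx : f x = true) :
    ((Finset.range x).filter (fun y => f y = true)).card <
      ((Finset.range x').filter (fun y => f y = true)).card := by
  apply Finset.card_lt_card
  rw [Finset.ssubset_iff_of_subset]
  · exact ⟨x, by simp [h, hx], by simp⟩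
  · intro y; simp only [Finset.mem_filter, Finset.mem_range]; rintro ⟨h1, h2⟩; exact ⟨by omega, h2⟩

lemma offsetPosition_eq_some_iff (δ₁ δ₂ : ℝ) (φ : ℕ → Bool × Bool) (u : ℕ × ℕ → unitInterval)
    (n : ℕ) (i s : ℤ) :
    offsetPosition δ₁ δ₂ φ u n i = some s ↔ HasParticle (ensemble δ₁ δ₂ φ u) φ n i s := by
  classical
  unfold offsetPosition position HasParticle occupied
  split_ifs with h
  · have hs := Nat.find_spec h
    simp only [Option.map_some, Option.some.injEq]
    constructor
    · intro e
      exact ⟨Nat.find h, by omega, hs.1, by convert hs.2⟩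
    · rintro ⟨x, h1, h2, h3⟩
      have : Nat.find h = x := by
        rcases lt_trichotomy (Nat.find h) x with hlt | heq | hlt
        · have := card_filter_range_lt (fun y => (ensemble δ₁ δ₂ φ u y n).1) hlt hs.1
          have h4 := hs.2
          beta_reduce at this
          omega
        · exact heq
        · have := card_filter_range_lt (fun y => (ensemble δ₁ δ₂ φ u y n).1) hlt h2
          have h4 := hs.2
          beta_reduce at this
          omega
      omega
  · simp only [Option.map_none, reduceCtorEq, false_iff]
    rintro ⟨x, h1, h2, h3⟩
    exact h ⟨x, h2, h3⟩

/-! ### The law of the ensemble -/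

/-- The mass of a set under the Bernoulli distribution with parameter `p`. -/
noncomputable def bernoulliMass (p : ℝ) (s : Set Bool) : ENNReal := by
  classical
  exact (if true ∈ s then ENNReal.ofReal p else 0) + (if false ∈ s then ENNReal.ofReal (1 - p) else 0)

/-- The bits `a v`, `b v` at the vertices `v` of the quadrant are such that, whichever one of the two
is inspected at each vertex, the inspected bits are independent Bernoulli variables, with parameter
`δ₁` where `a` is inspected and `δ₂` where `b` is. The two bits at one vertex may depend on each
other: a vertex of an ensemble never inspects both. -/
def BernoulliQueries {Ω : Type*} [MeasurableSpace Ω] (μ : Measure Ω) (a b : Ω → ℕ × ℕ → Bool)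
    (δ₁ δ₂ : ℝ) : Prop :=
  ∀ (sel : ℕ × ℕ → Bool) (val : ℕ × ℕ → Set Bool) (V : Finset (ℕ × ℕ)),
    (∀ v ∈ V, 1 ≤ v.1 ∧ 1 ≤ v.2) →
    μ {ω | ∀ v ∈ V, (if sel v then a ω v else b ω v) ∈ val v} =
      ∏ v ∈ V, bernoulliMass (if sel v then δ₁ else δ₂) (val v)

lemma completion_eq_completion_query (a b v h : Bool) :
    completion a b v h = completion (if v then a else b) (if v then a else b) v h := by
  cases v <;> cases h <;> simp [completion]

/-- An ensemble with initial data `φ` is recognised on a box by its values on the axes and by the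
completion rule at the inner vertices. -/
lemma drivenEnsemble_eq_on_box_iff (a b : ℕ × ℕ → Bool) (φ : ℕ → Bool × Bool)
    (e : ℕ → ℕ → Bool × Bool) (X Y : ℕ) :
    (∀ x ≤ X, ∀ y ≤ Y, drivenEnsemble a b φ x y = e x y) ↔
      ((∀ x ≤ X, e x 0 = drivenEnsemble (fun _ => false) (fun _ => false) φ x 0) ∧
       (∀ y ≤ Y, e 0 y = drivenEnsemble (fun _ => false) (fun _ => false) φ 0 y)) ∧
      ∀ v ∈ Finset.Icc 1 X ×ˢ Finset.Icc 1 Y,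
        (if (e v.1 (v.2 - 1)).1 then a v else b v) ∈
          {β | completion β β (e v.1 (v.2 - 1)).1 (e (v.1 - 1) v.2).2 = e v.1 v.2} := by
  have ax : ∀ a b x, drivenEnsemble a b φ x 0 = drivenEnsemble (fun _ => false) (fun _ => false) φ x 0 := by
    intro a b x; cases x <;> simp [drivenEnsemble]
  have ay : ∀ a b y, drivenEnsemble a b φ 0 y = drivenEnsemble (fun _ => false) (fun _ => false) φ 0 y := by
    intro a b y; cases y <;> simp [drivenEnsemble]
  constructor
  · intro h
    refine ⟨⟨fun x hx => ?_, fun y hy => ?_⟩, ?_⟩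
    · rw [← h x hx 0 (Nat.zero_le _), ax]
    · rw [← h 0 (Nat.zero_le _) y hy, ay]
    · rintro ⟨x, y⟩ hv
      simp only [Finset.mem_product, Finset.mem_Icc] at hv
      obtain ⟨⟨hx1, hx2⟩, hy1, hy2⟩ := hv
      obtain ⟨x, rfl⟩ : ∃ x', x = x' + 1 := ⟨x - 1, by omega⟩
      obtain ⟨y, rfl⟩ : ∃ y', y = y' + 1 := ⟨y - 1, by omega⟩
      simp only [Set.mem_ofPred_eq, Nat.add_sub_cancel]
      rw [← h (x + 1) hx2 (y + 1) hy2, ← h (x + 1) hx2 y (by omega), ← h x (by omega) (y + 1) hy2,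
        ← completion_eq_completion_query, ← drivenEnsemble]
  · rintro ⟨⟨h1, h2⟩, h3⟩ x
    induction x with
    | zero => intro _ y hy; rw [h2 y hy, ay]
    | succ x ihx =>
      intro hx y
      induction y with
      | zero => intro hy; rw [h1 _ hx, ax]
      | succ y ihy =>
        intro hy
        have := h3 (x + 1, y + 1) (by simp; omega)
        simp only [Set.mem_ofPred_eq, Nat.add_sub_cancel] at this
        rw [drivenEnsemble, ihx (by omega) _ hy, ihy (by omega), completion_eq_completion_query, this]

lemma measurable_drivenEnsemble {Ω : Type*} [MeasurableSpace Ω] {a b : Ω → ℕ × ℕ → Bool}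
    {φ : Ω → ℕ → Bool × Bool} (ha : ∀ v, Measurable fun ω => a ω v)
    (hb : ∀ v, Measurable fun ω => b ω v) (hφ : ∀ n, Measurable fun ω => φ ω n) (x y : ℕ) :
    Measurable fun ω => drivenEnsemble (a ω) (b ω) (φ ω) x y := by
  induction y generalizing x with
  | zero =>
    cases x with
    | zero => simp only [drivenEnsemble]; exact measurable_const
    | succ x => simp only [drivenEnsemble]; exact (hφ _).fst.prodMk measurable_const
  | succ y ihy =>
    induction x with
    | zero => simp only [drivenEnsemble]; exact measurable_const.prodMk (hφ _).snd
    | succ x ihx =>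
      simp only [drivenEnsemble]
      exact (Measurable.of_discrete (f := fun p : Bool × Bool × Bool × Bool =>
        completion p.1 p.2.1 p.2.2.1 p.2.2.2)).comp
        ((ha _).prodMk ((hb _).prodMk ((ihy _).fst.prodMk ihx.snd)))

/-- The law of the ensemble on a box depends on the driving bits only through the parameters. -/
lemma measure_drivenEnsemble_mem_eq {Ω₁ Ω₂ : Type*} [MeasurableSpace Ω₁] [MeasurableSpace Ω₂]
    {μ₁ : Measure Ω₁} {μ₂ : Measure Ω₂} {a₁ b₁ : Ω₁ → ℕ × ℕ → Bool} {a₂ b₂ : Ω₂ → ℕ × ℕ → Bool}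
    {δ₁ δ₂ : ℝ} (h₁ : BernoulliQueries μ₁ a₁ b₁ δ₁ δ₂) (h₂ : BernoulliQueries μ₂ a₂ b₂ δ₁ δ₂)
    (ha₁ : ∀ v, Measurable fun ω => a₁ ω v) (hb₁ : ∀ v, Measurable fun ω => b₁ ω v)
    (ha₂ : ∀ v, Measurable fun ω => a₂ ω v) (hb₂ : ∀ v, Measurable fun ω => b₂ ω v)
    (φ : ℕ → Bool × Bool) (X Y : ℕ) (E : Set (ℕ → ℕ → Bool × Bool))
    (hE : ∀ e e' : ℕ → ℕ → Bool × Bool, (∀ x ≤ X, ∀ y ≤ Y, e x y = e' x y) → (e ∈ E ↔ e' ∈ E)) :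
    μ₁ {ω | drivenEnsemble (a₁ ω) (b₁ ω) φ ∈ E} = μ₂ {ω | drivenEnsemble (a₂ ω) (b₂ ω) φ ∈ E} := by
  let r : (ℕ → ℕ → Bool × Bool) → (Fin (X + 1) → Fin (Y + 1) → Bool × Bool) :=
    fun e x y => e x y
  let ext : (Fin (X + 1) → Fin (Y + 1) → Bool × Bool) → ℕ → ℕ → Bool × Bool :=
    fun f x y => f (Fin.ofNat _ x) (Fin.ofNat _ y)
  have hext : ∀ f (x : ℕ) (hx : x ≤ X) (y : ℕ) (hy : y ≤ Y),
      ext f x y = f ⟨x, by omega⟩ ⟨y, by omega⟩ := by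
    intro f x hx y hy
    simp only [ext]
    congr 1
    · ext; simp [Fin.ofNat]; omega
    · ext; simp [Fin.ofNat]; omega
  have hm₁ : Measurable fun ω => r (drivenEnsemble (a₁ ω) (b₁ ω) φ) :=
    measurable_pi_lambda _ fun x => measurable_pi_lambda _ fun y =>
      measurable_drivenEnsemble (φ := fun _ => φ) ha₁ hb₁ (fun _ => measurable_const) x y
  have hm₂ : Measurable fun ω => r (drivenEnsemble (a₂ ω) (b₂ ω) φ) :=
    measurable_pi_lambda _ fun x => measurable_pi_lambda _ fun y =>
      measurable_drivenEnsemble (φ := fun _ => φ) ha₂ hb₂ (fun _ => measurable_const) x y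
  have hbox : ∀ (a b : ℕ × ℕ → Bool) f, r (drivenEnsemble a b φ) = f ↔
      ∀ x ≤ X, ∀ y ≤ Y, drivenEnsemble a b φ x y = ext f x y := by
    intro a b f
    constructor
    · rintro rfl x hx y hy
      exact (hext (r (drivenEnsemble a b φ)) x hx y hy).symm
    · intro h
      funext x y
      have := h x (by omega) y (by omega)
      rw [hext _ _ (by omega) _ (by omega)] at this
      exact this
  have hV : ∀ v ∈ Finset.Icc 1 X ×ˢ Finset.Icc 1 Y, 1 ≤ v.1 ∧ 1 ≤ v.2 := by
    rintro ⟨x, y⟩ hv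
    simp only [Finset.mem_product, Finset.mem_Icc] at hv
    exact ⟨hv.1.1, hv.2.1⟩
  have hmap : μ₁.map (fun ω => r (drivenEnsemble (a₁ ω) (b₁ ω) φ)) =
      μ₂.map (fun ω => r (drivenEnsemble (a₂ ω) (b₂ ω) φ)) := by
    refine Measure.ext_of_singleton fun f => ?_
    rw [Measure.map_apply hm₁ (measurableSet_singleton _),
      Measure.map_apply hm₂ (measurableSet_singleton _)]
    simp only [Set.preimage, Set.mem_singleton_iff, hbox, drivenEnsemble_eq_on_box_iff]
    by_cases hc : (∀ x ≤ X, ext f x 0 = drivenEnsemble (fun _ => false) (fun _ => false) φ x 0) ∧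
       (∀ y ≤ Y, ext f 0 y = drivenEnsemble (fun _ => false) (fun _ => false) φ 0 y)
    · simp only [and_iff_right hc]
      exact (h₁ (fun v => (ext f v.1 (v.2 - 1)).1) (fun v => {β | completion β β
        (ext f v.1 (v.2 - 1)).1 (ext f (v.1 - 1) v.2).2 = ext f v.1 v.2}) _ hV).trans
        (h₂ (fun v => (ext f v.1 (v.2 - 1)).1) (fun v => {β | completion β β
        (ext f v.1 (v.2 - 1)).1 (ext f (v.1 - 1) v.2).2 = ext f v.1 v.2}) _ hV).symm
    · simp only [hc, false_and, Set.ofPred_false, measure_empty]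
  have hpre : ∀ (e : ℕ → ℕ → Bool × Bool), e ∈ E ↔ r e ∈ {f | ext f ∈ E} := by
    intro e
    exact hE _ _ fun x hx y hy => (hext (r e) x hx y hy).symm
  have key : μ₁.map (fun ω => r (drivenEnsemble (a₁ ω) (b₁ ω) φ)) {f | ext f ∈ E} =
      μ₂.map (fun ω => r (drivenEnsemble (a₂ ω) (b₂ ω) φ)) {f | ext f ∈ E} := by rw [hmap]
  rw [Measure.map_apply hm₁ (Set.toFinite _).measurableSet,
    Measure.map_apply hm₂ (Set.toFinite _).measurableSet] at key
  simp only [Set.preimage, ← hpre] at key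
  exact key

lemma hasParticle_congr {e e' : ℕ → ℕ → Bool × Bool} (φ : ℕ → Bool × Bool) {X n : ℕ} {i s : ℤ}
    (hs : (s + n).toNat ≤ X) (h : ∀ x ≤ X, e x n = e' x n) :
    HasParticle e φ n i s ↔ HasParticle e' φ n i s := by
  unfold HasParticle
  refine exists_congr fun x => and_congr_right fun hx => ?_
  have hxX : x ≤ X := by omega
  rw [h x hxX]
  have : (Finset.range x).filter (fun y => (e y n).1 = true) =
      (Finset.range x).filter (fun y => (e' y n).1 = true) := by
    refine Finset.filter_congr fun y hy => ?_
    rw [h y (by rw [Finset.mem_range] at hy; omega)]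
  rw [this]

lemma measurableSet_hasParticle {Ω : Type*} [MeasurableSpace Ω] {e : Ω → ℕ → ℕ → Bool × Bool}
    {φ : Ω → ℕ → Bool × Bool} (he : ∀ x y, Measurable fun ω => e ω x y)
    (hφ : ∀ n, Measurable fun ω => φ ω n) (n : ℕ) (i s : ℤ) :
    MeasurableSet {ω | HasParticle (e ω) (φ ω) n i s} := by
  have h1 : ∀ x, MeasurableSet {ω | (e ω x n).1 = true} := fun x =>
    (he x n).fst (measurableSet_singleton true)
  have h2 : ∀ x, Measurable fun ω =>
      (((Finset.range x).filter (fun y => (e ω y n).1 = true)).card : ℤ) := by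
    intro x
    simp only [Finset.card_filter, Nat.cast_sum]
    exact Finset.measurable_sum _ fun y _ => Measurable.of_discrete.comp
      (Measurable.ite (h1 y) measurable_const measurable_const)
  have h3 : Measurable fun ω => i + (numBlue (φ ω) n : ℤ) := by
    unfold numBlue
    simp only [Finset.card_filter, Nat.cast_sum]
    exact measurable_const.add (Finset.measurable_sum _ fun y _ => Measurable.of_discrete.comp
      (Measurable.ite ((hφ y).snd (measurableSet_singleton true)) measurable_const measurable_const))
  unfold HasParticle
  rw [Set.ofPred_exists]
  refine MeasurableSet.iUnion fun x => ?_
  exact (MeasurableSet.const _).inter ((h1 x).inter (measurableSet_eq_fun (h2 x) h3))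

end SixVertex


/-! ### The six-vertex model in the moving frame -/

namespace SixVertex

/-- The particle configuration of the ensemble `e` at time `n` in the moving frame `q = x - n`. The
paths that start from the site `q ≤ -n`, that is from the `y`-axis above row `n`, have not been
entered yet: those sites keep their initial values `η q`. -/
def movingConfig (e : ℕ → ℕ → Bool × Bool) (η : ℤ → Bool) (n : ℕ) (q : ℤ) : Bool :=
  if q ≤ -n then η q else (e (q + n).toNat n).1

/-- The horizontal edge of row `n + 1` that enters the vertex on the diagonal `x - y = d`. -/
def movingCarry (e : ℕ → ℕ → Bool × Bool) (η : ℤ → Bool) (n : ℕ) (d : ℤ) : Bool :=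
  if d ≤ -n then η d else (e (d + n).toNat (n + 1)).2

/-- The driving bits in row `n + 1`, indexed by the diagonal `d = x - y`; they are `false` where there
is no vertex. -/
def movingBit (a : ℕ × ℕ → Bool) (n : ℕ) (d : ℤ) : Bool :=
  decide (0 ≤ d + n) && a ((d + n + 1).toNat, n + 1)

lemma movingConfig_zero (a b : ℕ × ℕ → Bool) (φ : ℕ → Bool × Bool) (q : ℤ) :
    movingConfig (drivenEnsemble a b φ) (ASEP.initialConfig φ) 0 q = ASEP.initialConfig φ q := by
  unfold movingConfig
  split_ifs with h
  · rfl
  · obtain ⟨m, rfl⟩ : ∃ m : ℕ, q = m + 1 := ⟨(q - 1).toNat, by push_cast at h; omega⟩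
    have : ((m : ℤ) + 1 + (0 : ℕ)).toNat = m + 1 := by omega
    have h2 : ((m : ℤ) + 1).toNat = m + 1 := by omega
    have h3 : (0 : ℤ) < (m : ℤ) + 1 := by omega
    rw [this, drivenEnsemble, ASEP.initialConfig, if_pos h3, h2]

/-- One row of the six-vertex model is a sequential update, from left to right, of the
configuration in the moving frame. -/
lemma moving_rule (a b : ℕ × ℕ → Bool) (φ : ℕ → Bool × Bool) (n : ℕ) (d : ℤ) :
    (movingConfig (drivenEnsemble a b φ) (ASEP.initialConfig φ) (n + 1) d,
      movingCarry (drivenEnsemble a b φ) (ASEP.initialConfig φ) n (d + 1)) =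
    completion (movingBit a n d) (movingBit b n d)
      (movingConfig (drivenEnsemble a b φ) (ASEP.initialConfig φ) n (d + 1))
      (movingCarry (drivenEnsemble a b φ) (ASEP.initialConfig φ) n d) := by
  unfold movingConfig movingCarry movingBit
  rcases lt_or_ge (d + n) 0 with h | h
  · rw [if_pos (by push_cast; omega), if_pos (by omega), if_pos (by omega), if_pos (by omega)]
    rw [decide_eq_false (by omega)]
    cases ASEP.initialConfig φ d <;> cases ASEP.initialConfig φ (d + 1) <;> rfl
  · obtain ⟨x, hx⟩ := Int.eq_ofNat_of_zero_le h
    have hd : d = x - n := by omega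
    subst hd
    rw [if_neg (by push_cast; omega), if_neg (by omega), if_neg (by omega)]
    rw [decide_eq_true (by omega)]
    have e1 : ((x : ℤ) - n + n + 1).toNat = x + 1 := by omega
    have e2 : ((x : ℤ) - n + 1 + n).toNat = x + 1 := by omega
    have e3 : ((x : ℤ) - n + (n + 1 : ℕ)).toNat = x + 1 := by omega
    have e4 : ((x : ℤ) - n + n).toNat = x := by omega
    rw [e1, e2, e3, e4, Prod.mk.eta, Bool.true_and, Bool.true_and]
    rw [drivenEnsemble]
    congr 1
    split_ifs with h0
    · have : x = 0 := by omega
      subst this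
      have h1 : (1 - (((0 : ℕ) : ℤ) - n)).toNat = n + 1 := by omega
      rw [drivenEnsemble, ASEP.initialConfig, if_neg (by omega), h1]
    · rfl

section SequentialUpdate

variable {c c' H A B : ℤ → Bool}

lemma completion_false_false (v h : Bool) : completion false false v h = (h, v) := by
  cases v <;> cases h <;> rfl

/-- At a silent diagonal the horizontal path leaves upwards and the vertical path to the right. -/
lemma update_of_silent (hr : ∀ d, (c' d, H (d + 1)) = completion (A d) (B d) (c (d + 1)) (H d))
    {d : ℤ} (hA : A d = false) (hB : B d = false) : c' d = H d ∧ H (d + 1) = c (d + 1) := by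
  have := hr d
  rw [hA, hB, completion_false_false] at this
  exact ⟨congrArg Prod.fst this, congrArg Prod.snd this⟩

lemma update_eq_self (hr : ∀ d, (c' d, H (d + 1)) = completion (A d) (B d) (c (d + 1)) (H d))
    {d : ℤ} (hA : A d = false) (hB : B d = false) (hA' : A (d - 1) = false)
    (hB' : B (d - 1) = false) : c' d = c d := by
  have h1 := (update_of_silent hr hA hB).1
  have h2 := (update_of_silent hr hA' hB').2
  rw [sub_add_cancel] at h2
  rw [h1, h2]

/-- If only the bond `d` is active locally, its two sites are updated by the vertex rule. -/
lemma update_pair (hr : ∀ d, (c' d, H (d + 1)) = completion (A d) (B d) (c (d + 1)) (H d))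
    {d : ℤ} (hA : A (d + 1) = false) (hB : B (d + 1) = false) (hA' : A (d - 1) = false)
    (hB' : B (d - 1) = false) :
    (c' d, c' (d + 1)) = completion (A d) (B d) (c (d + 1)) (c d) := by
  have h1 := (update_of_silent hr hA hB).1
  have h2 := (update_of_silent hr hA' hB').2
  rw [sub_add_cancel] at h2
  rw [h1, ← h2]
  exact hr d

end SequentialUpdate

/-! ### Counting particles to the left of a silent bond -/

lemma count_range_succ (f : ℕ → Bool) (X : ℕ) :
    ((Finset.range (X + 1)).filter (fun y => f y = true)).card =
      ((Finset.range X).filter (fun y => f y = true)).card + (f X).toNat := by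
  rw [Finset.range_add_one, Finset.filter_insert]
  split_ifs with h
  · rw [Finset.card_insert_of_notMem (by simp), h]; rfl
  · rw [Bool.not_eq_true] at h; rw [h]; rfl

lemma completion_toNat (a b v h : Bool) :
    (completion a b v h).1.toNat + (completion a b v h).2.toNat = v.toNat + h.toNat := by
  revert a b v h; decide

/-- Paths are conserved in each row. -/
lemma row_conservation (a b : ℕ × ℕ → Bool) (φ : ℕ → Bool × Bool) (n X : ℕ) :
    ((Finset.range (X + 1)).filter (fun y => (drivenEnsemble a b φ y n).1 = true)).card
        + (φ (n + 1)).2.toNat =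
      ((Finset.range (X + 1)).filter (fun y => (drivenEnsemble a b φ y (n + 1)).1 = true)).card
        + (drivenEnsemble a b φ X (n + 1)).2.toNat := by
  induction X with
  | zero =>
    rw [count_range_succ, count_range_succ]
    cases n <;> simp [drivenEnsemble]
  | succ X ih =>
    rw [count_range_succ (fun y => (drivenEnsemble a b φ y n).1) (X + 1),
      count_range_succ (fun y => (drivenEnsemble a b φ y (n + 1)).1) (X + 1)]
    have h := completion_toNat (a (X + 1, n + 1)) (b (X + 1, n + 1))
      (drivenEnsemble a b φ (X + 1) n).1 (drivenEnsemble a b φ X (n + 1)).2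
    rw [← drivenEnsemble, Nat.succ_eq_add_one, Nat.succ_eq_add_one] at h
    omega

lemma numBlue_succ (φ : ℕ → Bool × Bool) (n : ℕ) :
    numBlue φ (n + 1) = numBlue φ n + (φ (n + 1)).2.toNat := by
  unfold numBlue
  rw [← Finset.insert_Icc_right_eq_Icc_add_one (by omega), Finset.filter_insert]
  split_ifs with h
  · rw [Finset.card_insert_of_notMem (by simp), h]; rfl
  · rw [Bool.not_eq_true] at h; rw [h]; rfl

lemma numBlue_eq_card_initialConfig (φ : ℕ → Bool × Bool) (m : ℕ) :
    numBlue φ m =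
      ((Finset.Ioc (-m : ℤ) 0).filter (fun q => ASEP.initialConfig φ q = true)).card := by
  unfold numBlue
  refine Finset.card_bij' (fun s _ => 1 - (s : ℤ)) (fun q _ => (1 - q).toNat) ?_ ?_ ?_ ?_
  · intro s hs
    simp only [Finset.mem_filter, Finset.mem_Icc, Finset.mem_Ioc] at hs ⊢
    refine ⟨by omega, ?_⟩
    rw [ASEP.initialConfig, if_neg (by omega)]
    convert hs.2 using 3
    omega
  · intro q hq
    simp only [Finset.mem_filter, Finset.mem_Icc, Finset.mem_Ioc] at hq ⊢
    refine ⟨by omega, ?_⟩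
    have := hq.2
    rwa [ASEP.initialConfig, if_neg (by omega)] at this
  · intro s hs; simp
  · intro q hq
    simp only [Finset.mem_filter, Finset.mem_Ioc] at hq
    omega

/-- The number of particles to the left of a bond `-m` that never rings changes only when a path
enters through the `y`-axis. -/
lemma card_left_of_silent_bond (a b : ℕ × ℕ → Bool) (φ : ℕ → Bool × Bool) (m N : ℕ)
    (hA : ∀ n < N, movingBit a n (-m) = false) (hB : ∀ n < N, movingBit b n (-m) = false)
    (j : ℕ) (hj : m + j ≤ N) :
    ((Finset.range (j + 1)).filter (fun y => (drivenEnsemble a b φ y (m + j)).1 = true)).card +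
      ((Finset.Ioc (-m : ℤ) 0).filter (fun q => ASEP.initialConfig φ q = true)).card =
      numBlue φ (m + j) := by
  induction j with
  | zero =>
    rw [count_range_succ, ← numBlue_eq_card_initialConfig]
    cases m <;> simp [drivenEnsemble]
  | succ j ih =>
    have hc := row_conservation a b φ (m + j) (j + 1)
    rw [count_range_succ (fun y => (drivenEnsemble a b φ y (m + j)).1)] at hc
    rw [← add_assoc, numBlue_succ, ← ih (by omega)]
    have hA' := hA (m + j) (by omega)
    have hB' := hB (m + j) (by omega)
    unfold movingBit at hA' hB'
    have e1 : (-(m : ℤ) + (m + j : ℕ) + 1).toNat = j + 1 := by omega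
    have e2 : (0 : ℤ) ≤ -(m : ℤ) + (m + j : ℕ) := by omega
    rw [decide_eq_true e2, Bool.true_and, e1] at hA' hB'
    have hv : (drivenEnsemble a b φ (j + 1) (m + j + 1)).2 =
        (drivenEnsemble a b φ (j + 1) (m + j)).1 := by
      rw [drivenEnsemble, hA', hB', completion_false_false]
    rw [hv] at hc
    omega

/-- The labels of the particles to the right of a silent bond can be read off from the configuration
in the moving frame to the right of that bond. -/
lemma hasParticle_iff_of_silent_bond (a b : ℕ × ℕ → Bool) (φ : ℕ → Bool × Bool) (m N : ℕ)
    (hA : ∀ n < N, movingBit a n (-m) = false) (hB : ∀ n < N, movingBit b n (-m) = false)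
    (hN : m ≤ N) (i s : ℤ) (hs : -m < s) :
    HasParticle (drivenEnsemble a b φ) φ N i s ↔
      movingConfig (drivenEnsemble a b φ) (ASEP.initialConfig φ) N s = true ∧
      (((Finset.Ioo (-m : ℤ) s).filter (fun q =>
        movingConfig (drivenEnsemble a b φ) (ASEP.initialConfig φ) N q = true)).card : ℤ) =
      i + ((Finset.Ioc (-m : ℤ) 0).filter (fun q => ASEP.initialConfig φ q = true)).card := by
  obtain ⟨j, rfl⟩ := Nat.exists_eq_add_of_le hN
  have hleft := card_left_of_silent_bond a b φ m _ hA hB j le_rfl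
  obtain ⟨x, hx⟩ : ∃ x : ℕ, (x : ℤ) = s + (m + j : ℕ) := ⟨(s + (m + j : ℕ)).toNat, by omega⟩
  have hxj : j + 1 ≤ x := by omega
  have hmc : ∀ q : ℤ, -m < q → movingConfig (drivenEnsemble a b φ) (ASEP.initialConfig φ) (m + j) q =
      (drivenEnsemble a b φ (q + (m + j : ℕ)).toNat (m + j)).1 := by
    intro q hq
    rw [movingConfig, if_neg (by omega)]
  have hsplit : ((Finset.range x).filter
        (fun y => (drivenEnsemble a b φ y (m + j)).1 = true)).card =
      ((Finset.range (j + 1)).filter (fun y => (drivenEnsemble a b φ y (m + j)).1 = true)).card +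
      ((Finset.Ioo (-m : ℤ) s).filter (fun q =>
        movingConfig (drivenEnsemble a b φ) (ASEP.initialConfig φ) (m + j) q = true)).card := by
    have : ((Finset.Ioo (-m : ℤ) s).filter (fun q =>
        movingConfig (drivenEnsemble a b φ) (ASEP.initialConfig φ) (m + j) q = true)).card =
        ((Finset.Ico (j + 1) x).filter
          (fun y => (drivenEnsemble a b φ y (m + j)).1 = true)).card := by
      refine Finset.card_bij' (fun q _ => (q + (m + j : ℕ)).toNat)
        (fun y _ => (y : ℤ) - (m + j : ℕ)) ?_ ?_ ?_ ?_
      · intro q hq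
        simp only [Finset.mem_filter, Finset.mem_Ioo, Finset.mem_Ico] at hq ⊢
        rw [hmc q hq.1.1] at hq
        exact ⟨by omega, hq.2⟩
      · intro y hy
        simp only [Finset.mem_filter, Finset.mem_Ioo, Finset.mem_Ico] at hy ⊢
        rw [hmc _ (by omega)]
        refine ⟨by omega, ?_⟩
        rw [sub_add_cancel, Int.toNat_natCast]
        exact hy.2
      · intro q hq
        simp only [Finset.mem_filter, Finset.mem_Ioo] at hq
        omega
      · intro y _
        simp
    rw [this, Finset.range_eq_Ico, Finset.range_eq_Ico,
      ← Finset.Ico_union_Ico_eq_Ico (Nat.zero_le _) hxj, Finset.filter_union,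
      Finset.card_union_of_disjoint]
    exact Finset.disjoint_filter_filter (Finset.Ico_disjoint_Ico_consecutive 0 (j + 1) x)
  have hxs : (s + (m + j : ℕ)).toNat = x := by omega
  rw [hmc s hs, hxs]
  unfold HasParticle
  constructor
  · rintro ⟨x', h1, h2, h3⟩
    obtain rfl : x' = x := by omega
    exact ⟨h2, by omega⟩
  · rintro ⟨h2, h3⟩
    exact ⟨x, hx, h2, by omega⟩

end SixVertex


/-! ### Trajectories of the exclusion process -/

namespace ASEP

/-- Induction on the time interval `[0, T]`. -/
lemma real_interval_induction {p : ℝ → Prop} {T : ℝ} (h0 : p 0)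
    (hright : ∀ t, 0 ≤ t → t < T → p t → ∀ᶠ s in 𝓝[>] t, p s)
    (hleft : ∀ t, 0 < t → t ≤ T → (∀ s, 0 ≤ s → s < t → p s) → p t) :
    ∀ t, 0 ≤ t → t ≤ T → p t := by
  by_contra hcon
  push Not at hcon
  obtain ⟨t₀, ht₀, ht₀T, hpt₀⟩ := hcon
  set B : Set ℝ := {t | 0 ≤ t ∧ t ≤ T ∧ ¬ p t} with hB
  have hne : B.Nonempty := ⟨t₀, ht₀, ht₀T, hpt₀⟩
  have hbd : BddBelow B := ⟨0, fun t ht => ht.1⟩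
  have hb0 : 0 ≤ sInf B := le_csInf hne fun t ht => ht.1
  have hbt : sInf B ≤ t₀ := csInf_le hbd ⟨ht₀, ht₀T, hpt₀⟩
  have hbefore : ∀ s, 0 ≤ s → s < sInf B → p s := by
    intro s hs hsb
    by_contra hps
    exact absurd (csInf_le hbd ⟨hs, by linarith, hps⟩) (not_le.2 hsb)
  have hpb : p (sInf B) := by
    rcases hb0.eq_or_lt with h | h
    · rw [← h]; exact h0
    · exact hleft _ h (by linarith) hbefore
  have hlt : sInf B < t₀ := lt_of_le_of_ne hbt fun h => hpt₀ (h ▸ hpb)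
  have hev := hright _ hb0 (by linarith) hpb
  obtain ⟨u, hu, hsub⟩ := mem_nhdsGT_iff_exists_Ioo_subset.1 hev
  obtain ⟨t, htB, htu⟩ := exists_lt_of_csInf_lt hne (show sInf B < u from hu)
  have htb : sInf B ≤ t := csInf_le hbd htB
  rcases htb.eq_or_lt with h | h
  · exact htB.2.2 (h ▸ hpb)
  · exact htB.2.2 (hsub ⟨h, htu⟩)

/-- No instruction of the time graph `G` up to time `T` leads into or out of the box `(lo, hi]`. -/
def Sealed (G : Set (ℝ × ℤ × ℤ)) (T : ℝ) (lo hi : ℤ) : Prop :=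
  ∀ s x j, 0 < s → s ≤ T → (s, x, j) ∈ G → (x ∈ Set.Ioc lo hi ↔ j ∈ Set.Ioc lo hi)

/-- The position `o` is a site of the box `(lo, hi]`. -/
def InBox (lo hi : ℤ) (o : Option ℤ) : Prop := ∃ x ∈ Set.Ioc lo hi, o = some x

/-- At positive times there is at most one instruction at a time. -/
def NoSimultaneous (G : Set (ℝ × ℤ × ℤ)) : Prop :=
  ∀ t g g', 0 < t → (t, g) ∈ G → (t, g') ∈ G → g = g'

variable {G G' : Set (ℝ × ℤ × ℤ)} {η : ℤ → Bool} {X X' : ℝ → ℤ → Option ℤ} {T : ℝ} {lo hi : ℤ}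

lemma inBox_some {x : ℤ} : InBox lo hi (some x) ↔ x ∈ Set.Ioc lo hi := by
  simp [InBox]

lemma of_eventually_left {p : Option ℤ → Prop} {f : ℝ → Option ℤ} {y : Option ℤ} {t : ℝ}
    (ht : 0 < t) (h : ∀ᶠ s in 𝓝[<] t, f s = y) (hp : ∀ s, 0 ≤ s → s < t → p (f s)) : p y := by
  obtain ⟨s, hs, hs0, hst⟩ := (h.and (Ioo_mem_nhdsLT ht)).exists
  rw [← hs]
  exact hp s hs0.le hst

/-- A property of positions that is preserved by the instructions of the time graph is preserved along
the trajectory of each particle. -/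
lemma IsTrajectory.invariant (hX : IsTrajectory G η X) (k : ℤ) (p : Option ℤ → Prop)
    (h0 : p (X 0 k))
    (hstep : ∀ s x j, 0 < s → s ≤ T → (s, x, j) ∈ G → p (some x) → p (some j)) :
    ∀ t, 0 ≤ t → t ≤ T → p (X t k) := by
  refine real_interval_induction h0 ?_ ?_
  · intro t ht _ hp
    filter_upwards [hX.right_continuous t ht k] with s hs
    rwa [hs]
  · intro t ht htT hp
    obtain ⟨Y, hY, hjump, hstay⟩ := hX.update t ht
    have hpY : p (Y k) := of_eventually_left ht (hY k) hp
    by_cases hc : ∃ x j, Y k = some x ∧ JumpPerformed G t Y x j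
    · obtain ⟨x, j, hx, hj⟩ := hc
      rw [hjump k x j hx hj]
      exact hstep t x j ht htT hj.1 (hx ▸ hpY)
    · push Not at hc
      rw [hstay k hc]
      exact hpY

lemma IsTrajectory.eq_none (hX : IsTrajectory G η X) {k : ℤ} (h : X 0 k = none) {t : ℝ}
    (ht : 0 ≤ t) : X t k = none :=
  hX.invariant k (· = none) h (fun _ _ _ _ _ _ h => by simp at h) t ht le_rfl

lemma IsTrajectory.inBox_iff (hX : IsTrajectory G η X) (hG : Sealed G T lo hi) (k : ℤ) {t : ℝ}
    (ht : 0 ≤ t) (htT : t ≤ T) : InBox lo hi (X t k) ↔ InBox lo hi (X 0 k) := by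
  refine hX.invariant k (fun o => InBox lo hi o ↔ InBox lo hi (X 0 k)) Iff.rfl ?_ t ht htT
  intro s x j hs hsT hg h
  rw [← h, inBox_some, inBox_some, hG s x j hs hsT hg]

lemma IsTrajectory.initial_eq (hX : IsTrajectory G η X) (hX' : IsTrajectory G' η X') (k : ℤ) :
    X 0 k = X' 0 k :=
  Option.ext fun x => (hX.initial k x).trans (hX'.initial k x).symm

lemma IsTrajectory.finite_inBox (hX : IsTrajectory G η X) (lo hi : ℤ) :
    {k | InBox lo hi (X 0 k)}.Finite := by
  refine ((Set.finite_Ioc lo hi).image (label η)).subset ?_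
  rintro k ⟨x, hx, hk⟩
  exact ⟨x, hx, ((hX.initial k x).1 hk).2⟩

/-- Whether a jump inside a sealed box is performed is determined by the particles in the box. -/
lemma jumpPerformed_iff {t : ℝ} {Y Y' : ℤ → Option ℤ} {K : Set ℤ}
    (hG : ∀ x j, (t, x, j) ∈ G → (x ∈ Set.Ioc lo hi ↔ j ∈ Set.Ioc lo hi))
    (hG' : ∀ x j, (t, x, j) ∈ G' → (x ∈ Set.Ioc lo hi ↔ j ∈ Set.Ioc lo hi))
    (hGG' : ∀ x ∈ Set.Ioc lo hi, ∀ j ∈ Set.Ioc lo hi, ((t, x, j) ∈ G ↔ (t, x, j) ∈ G'))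
    (hK : ∀ l ∈ K, Y l = Y' l) (hn : ∀ l ∉ K, ¬ InBox lo hi (Y l))
    (hn' : ∀ l ∉ K, ¬ InBox lo hi (Y' l)) {x : ℤ} (hx : x ∈ Set.Ioc lo hi) (j : ℤ) :
    JumpPerformed G t Y x j ↔ JumpPerformed G' t Y' x j := by
  unfold JumpPerformed
  by_cases hj : j ∈ Set.Ioc lo hi
  · rw [hGG' x hx j hj]
    refine and_congr_right fun _ => forall_congr' fun l => ?_
    by_cases hl : l ∈ K
    · rw [hK l hl]
    · have h1 : Y l ≠ some j := fun h => hn l hl ⟨j, hj, h⟩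
      have h2 : Y' l ≠ some j := fun h => hn' l hl ⟨j, hj, h⟩
      simp [h1, h2]
  · exact ⟨fun h => absurd ((hG x j h.1).1 hx) hj, fun h => absurd ((hG' x j h.1).1 hx) hj⟩

/-- Two trajectories with the same initial configuration whose time graphs agree in a sealed box move
the particles in that box in the same way. -/
lemma IsTrajectory.eq_of_agree (hX : IsTrajectory G η X) (hX' : IsTrajectory G' η X')
    (hG : Sealed G T lo hi) (hG' : Sealed G' T lo hi)
    (hGG' : ∀ s, 0 < s → s ≤ T → ∀ x ∈ Set.Ioc lo hi, ∀ j ∈ Set.Ioc lo hi,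
      ((s, x, j) ∈ G ↔ (s, x, j) ∈ G')) :
    ∀ t, 0 ≤ t → t ≤ T → ∀ k, InBox lo hi (X 0 k) → X t k = X' t k := by
  refine real_interval_induction (fun k _ => hX.initial_eq hX' k) ?_ ?_
  · intro t ht _ hp
    have h1 := (Filter.eventually_all_finite (hX.finite_inBox lo hi)).2
      fun k _ => hX.right_continuous t ht k
    have h2 := (Filter.eventually_all_finite (hX.finite_inBox lo hi)).2
      fun k _ => hX'.right_continuous t ht k
    filter_upwards [h1, h2] with s hs1 hs2 k hk
    rw [hs1 k hk, hs2 k hk, hp k hk]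
  · intro t ht htT hp k hk
    obtain ⟨Y, hY, hjump, hstay⟩ := hX.update t ht
    obtain ⟨Y', hY', hjump', hstay'⟩ := hX'.update t ht
    have hYY' : ∀ l, InBox lo hi (X 0 l) → Y l = Y' l := by
      intro l hl
      obtain ⟨s, ⟨hs1, hs2⟩, hs0, hst⟩ :=
        (((hY l).and (hY' l)).and (Ioo_mem_nhdsLT ht)).exists
      rw [← hs1, ← hs2, hp s hs0.le hst l hl]
    have hin : ∀ l, InBox lo hi (Y l) ↔ InBox lo hi (X 0 l) := fun l =>
      of_eventually_left (p := fun o => InBox lo hi o ↔ InBox lo hi (X 0 l)) ht (hY l)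
        fun s hs hst => hX.inBox_iff hG l hs (hst.le.trans htT)
    have hin' : ∀ l, InBox lo hi (Y' l) ↔ InBox lo hi (X 0 l) := fun l =>
      of_eventually_left (p := fun o => InBox lo hi o ↔ InBox lo hi (X 0 l)) ht (hY' l)
        fun s hs hst => by rw [hX.initial_eq hX' l]; exact hX'.inBox_iff hG' l hs (hst.le.trans htT)
    have hJ : ∀ x ∈ Set.Ioc lo hi, ∀ j, JumpPerformed G t Y x j ↔ JumpPerformed G' t Y' x j :=
      fun x hx j => jumpPerformed_iff (K := {l | InBox lo hi (X 0 l)}) (fun x j => hG t x j ht htT)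
        (fun x j => hG' t x j ht htT) (hGG' t ht htT) hYY' (fun l hl => (hin l).not.2 hl)
        (fun l hl => (hin' l).not.2 hl) hx j
    obtain ⟨x, hx, hkx⟩ := (hin k).2 hk
    have hkx' : Y' k = some x := by rw [← hYY' k hk, hkx]
    by_cases hc : ∃ j, JumpPerformed G t Y x j
    · obtain ⟨j, hj⟩ := hc
      rw [hjump k x j hkx hj, hjump' k x j hkx' ((hJ x hx j).1 hj)]
    · push Not at hc
      rw [hstay k, hstay' k, hYY' k hk]
      · intro x' j hx'
        obtain rfl : x = x' := by simpa [hkx'] using hx'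
        exact (hJ x hx j).not.1 (hc j)
      · intro x' j hx'
        obtain rfl : x = x' := by simpa [hkx] using hx'
        exact hc j

/-! ### Existence of the trajectory -/

lemma label_lt_label {x y : ℤ} (hxy : x < y) (hx : η x = true) : label η x < label η y := by
  unfold label
  split_ifs with h1 h2
  · norm_cast
    apply Finset.card_lt_card
    rw [Finset.ssubset_iff_of_subset]
    · exact ⟨x, by simp [hx]; omega, by simp⟩
    · intro z; simp only [Finset.mem_filter, Finset.mem_Ico]
      rintro ⟨h3, h4⟩; exact ⟨by omega, h4⟩
  · omega
  · have : 0 < ((Finset.Icc x 0).filter (fun y => η y = true)).card :=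
      Finset.card_pos.2 ⟨x, by simp [hx]; omega⟩
    omega
  · rw [neg_lt_neg_iff]
    norm_cast
    apply Finset.card_lt_card
    rw [Finset.ssubset_iff_of_subset]
    · exact ⟨x, by simp [hx]; omega, by simp; omega⟩
    · intro z; simp only [Finset.mem_filter, Finset.mem_Icc]
      rintro ⟨h3, h4⟩; exact ⟨by omega, h4⟩

lemma label_injOn {x y : ℤ} (hx : η x = true) (hy : η y = true) (hxy : label η x = label η y) :
    x = y := by
  rcases lt_trichotomy x y with h | h | h
  · exact absurd hxy (label_lt_label h hx).ne
  · exact h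
  · exact absurd hxy (label_lt_label h hy).ne'

/-- A trajectory exists if there are instructions at finitely many times only. -/
lemma exists_isTrajectory_of_finite (η : ℤ → Bool) (F : Finset ℝ) :
    ∀ G : Set (ℝ × ℤ × ℤ), (∀ g ∈ G, g.1 ∈ F) → (∀ g ∈ G, 0 < g.1) → NoSimultaneous G →
      ∃ X, IsTrajectory G η X := by
  classical
  have hlab : ∃ X₀ : ℤ → Option ℤ, ∀ k x, X₀ k = some x ↔ (η x = true ∧ label η x = k) := by
    refine ⟨fun k => if h : ∃ x, η x = true ∧ label η x = k then some h.choose else none, ?_⟩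
    intro k x
    beta_reduce
    split_ifs with h
    · have hs := h.choose_spec
      rw [Option.some.injEq]
      constructor
      · rintro rfl; exact hs
      · rintro ⟨h1, h2⟩; exact label_injOn hs.1 h1 (hs.2.trans h2.symm)
    · simp only [false_iff]
      exact fun h' => h ⟨x, h'⟩
  induction F using Finset.induction_on_max with
  | empty =>
    intro G hG _ _
    obtain ⟨X₀, hX₀⟩ := hlab
    refine ⟨fun _ => X₀, hX₀, fun t _ k => Eventually.of_forall fun _ => rfl, fun t _ => ?_⟩
    refine ⟨X₀, fun k => Eventually.of_forall fun _ => rfl, fun k x j _ hj => ?_, fun _ _ => rfl⟩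
    exact absurd (hG _ hj.1) (Finset.notMem_empty _)
  | insert τ F hF ih =>
    intro G hG hpos hns
    by_cases hτ : 0 < τ
    swap
    · refine ih G (fun g hg => ?_) hpos hns
      rcases Finset.mem_insert.1 (hG g hg) with h | h
      · exact absurd (h ▸ hpos g hg) hτ
      · exact h
    obtain ⟨X', hX'⟩ := ih {g ∈ G | g.1 < τ} (fun g hg => by
        rcases Finset.mem_insert.1 (hG g hg.1) with h | h
        · exact absurd h hg.2.ne
        · exact h) (fun g hg => hpos g hg.1)
      (fun t g g' ht h h' => hns t g g' ht h.1 h'.1)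
    obtain ⟨Y, hY, -, -⟩ := hX'.update τ hτ
    -- The trajectory agrees with `X'` before the last time `τ` and is constant from `τ` on.
    let Z : ℤ → Option ℤ := fun k =>
      if h : ∃ x j, Y k = some x ∧ JumpPerformed G τ Y x j then some h.choose_spec.choose else Y k
    have hlt : ∀ t, t < τ → ∀ k, ∀ᶠ s in 𝓝[<] t, (if s < τ then X' s else Z) k = X' s k := by
      intro t ht k
      filter_upwards [self_mem_nhdsWithin] with s hs
      rw [if_pos (lt_trans hs ht)]
    refine ⟨fun t => if t < τ then X' t else Z, ?_, ?_, ?_⟩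
    · intro k x
      rw [if_pos hτ]
      exact hX'.initial k x
    · intro t ht k
      rcases lt_or_ge t τ with h | h
      · filter_upwards [hX'.right_continuous t ht k,
          nhdsWithin_le_nhds (Iio_mem_nhds h)] with s hs hs'
        rw [if_pos h, if_pos (Set.mem_Iio.1 hs'), hs]
      · filter_upwards [self_mem_nhdsWithin] with s hs
        rw [if_neg (not_lt.2 h), if_neg (not_lt.2 (h.trans (le_of_lt hs)))]
    · intro t ht
      rcases lt_trichotomy t τ with h | h | h
      · obtain ⟨Y', hY', hj', hs'⟩ := hX'.update t ht
        have hJ : ∀ x j, JumpPerformed {g ∈ G | g.1 < τ} t Y' x j ↔ JumpPerformed G t Y' x j := by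
          intro x j
          unfold JumpPerformed
          simp [h]
        refine ⟨Y', fun k => ?_, fun k x j hk hj => ?_, fun k hk => ?_⟩
        · filter_upwards [hY' k, hlt t h k] with s h1 h2
          rw [h2, h1]
        · rw [if_pos h]
          exact hj' k x j hk ((hJ x j).2 hj)
        · rw [if_pos h]
          exact hs' k fun x j hx => (hJ x j).not.2 (hk x j hx)
      · subst h
        refine ⟨Y, fun k => ?_, fun k x j hk hj => ?_, fun k hk => ?_⟩
        · filter_upwards [hY k, self_mem_nhdsWithin] with s h1 h2
          rw [if_pos (Set.mem_Iio.1 h2), h1]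
        · rw [if_neg (lt_irrefl t)]
          have hex : ∃ x j, Y k = some x ∧ JumpPerformed G t Y x j := ⟨x, j, hk, hj⟩
          have hspec := hex.choose_spec.choose_spec
          have := hns t _ _ ht hspec.2.1 hj.1
          simp only [Z, dif_pos hex]
          exact congrArg some (Prod.ext_iff.1 this).2
        · rw [if_neg (lt_irrefl t)]
          have hex : ¬ ∃ x j, Y k = some x ∧ JumpPerformed G t Y x j := by
            rintro ⟨x, j, hx, hj⟩; exact hk x j hx hj
          simp only [Z, dif_neg hex]
      · refine ⟨Z, fun k => ?_, fun k x j hk hj => ?_, fun k hk => ?_⟩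
        · filter_upwards [Ioo_mem_nhdsLT h] with s hs
          rw [if_neg (not_lt.2 hs.1.le)]
        · rcases Finset.mem_insert.1 (hG _ hj.1) with h' | h'
          · exact absurd h' h.ne'
          · exact absurd (hF _ h') (not_lt.2 h.le)
        · rw [if_neg (not_lt.2 h.le)]

/-- A trajectory exists if, up to each time, the lattice is covered by sealed boxes in each of which
there are finitely many instructions, no two of them at the same time. -/
lemma exists_isTrajectory (η : ℤ → Bool) (hns : NoSimultaneous G)
    (hfin : ∀ N : ℕ, {s : ℝ | 0 < s ∧ s ≤ N ∧ ∃ x j : ℤ, |x| ≤ N ∧ |j| ≤ N ∧ (s, x, j) ∈ G}.Finite)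
    (hseal : ∀ (T : ℝ) (M : ℤ), ∃ lo hi, lo < -M ∧ M < hi ∧ Sealed G T lo hi) :
    ∃ X, IsTrajectory G η X := by
  classical
  set GN : ℕ → Set (ℝ × ℤ × ℤ) := fun N =>
    {g | g ∈ G ∧ 0 < g.1 ∧ g.1 ≤ N ∧ |g.2.1| ≤ N ∧ |g.2.2| ≤ N} with hGN
  have hZex : ∀ N, ∃ X, IsTrajectory (GN N) η X := by
    intro N
    refine exists_isTrajectory_of_finite η (hfin N).toFinset (GN N) ?_ (fun g hg => hg.2.1)
      fun t g g' ht h h' => hns t g g' ht h.1 h'.1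
    rintro ⟨s, x, j⟩ ⟨h1, h2, h3, h4, h5⟩
    rw [Set.Finite.mem_toFinset]
    exact ⟨h2, h3, x, j, h4, h5, h1⟩
  choose Z hZ using hZex
  have hZ0 : ∀ N k, Z N 0 k = Z 0 0 k := fun N k => (hZ N).initial_eq (hZ 0) k
  have hsealN : ∀ {T lo hi}, Sealed G T lo hi → ∀ N, Sealed (GN N) T lo hi :=
    fun h N s x j hs hsT hg => h s x j hs hsT hg.1
  have hmemN : ∀ (T : ℝ) (lo hi : ℤ), ∃ N₀ : ℕ, ∀ N ≥ N₀, ∀ s, 0 < s → s ≤ T →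
      ∀ x ∈ Set.Ioc lo hi, ∀ j ∈ Set.Ioc lo hi, ((s, x, j) ∈ GN N ↔ (s, x, j) ∈ G) := by
    intro T lo hi
    refine ⟨max ⌈T⌉₊ (max lo.natAbs hi.natAbs), fun N hN s hs hsT x hx j hj => ?_⟩
    have h1 : T ≤ N := (Nat.le_ceil T).trans (by exact_mod_cast (le_max_left _ _).trans hN)
    have h2 : lo.natAbs ≤ N := ((le_max_left _ _).trans (le_max_right _ _)).trans hN
    have h3 : hi.natAbs ≤ N := ((le_max_right _ _).trans (le_max_right _ _)).trans hN
    refine ⟨fun h => h.1, fun h => ⟨h, hs, hsT.trans h1, ?_, ?_⟩⟩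
    · rw [abs_le]; dsimp only; simp only [Set.mem_Ioc] at hx; constructor <;> omega
    · rw [abs_le]; dsimp only; simp only [Set.mem_Ioc] at hj; constructor <;> omega
  have hstab : ∀ T lo hi, Sealed G T lo hi → ∃ N₀, ∀ N ≥ N₀, ∀ t, 0 ≤ t → t ≤ T →
      ∀ k, InBox lo hi (Z 0 0 k) → Z N t k = Z N₀ t k := by
    intro T lo hi hs
    obtain ⟨N₀, hN₀⟩ := hmemN T lo hi
    refine ⟨N₀, fun N hN t ht htT k hk => ?_⟩
    refine (hZ N).eq_of_agree (hZ N₀) (hsealN hs N) (hsealN hs N₀) ?_ t ht htT k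
      (by rwa [hZ0])
    intro s hs hsT x hx j hj
    rw [hN₀ N hN s hs hsT x hx j hj, hN₀ N₀ le_rfl s hs hsT x hx j hj]
  let X : ℝ → ℤ → Option ℤ := fun t k =>
    if h : ∃ o, ∀ᶠ N in atTop, Z N t k = o then h.choose else none
  have hXZ : ∀ t k o, (∀ᶠ N in atTop, Z N t k = o) → X t k = o := by
    intro t k o h
    have hex : ∃ o, ∀ᶠ N in atTop, Z N t k = o := ⟨o, h⟩
    simp only [X, dif_pos hex]
    obtain ⟨N, h1, h2⟩ := (hex.choose_spec.and h).exists
    rw [← h1, h2]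
  have hXbox : ∀ T lo hi, Sealed G T lo hi → ∃ N₀, ∀ N ≥ N₀, ∀ t, 0 ≤ t → t ≤ T →
      ∀ k, InBox lo hi (Z 0 0 k) → X t k = Z N t k := by
    intro T lo hi hs
    obtain ⟨N₀, hN₀⟩ := hstab T lo hi hs
    refine ⟨N₀, fun N hN t ht htT k hk => hXZ t k _ ?_⟩
    filter_upwards [eventually_ge_atTop N₀] with N' hN'
    rw [hN₀ N' hN' t ht htT k hk, hN₀ N hN t ht htT k hk]
  have hXlab : ∀ (T : ℝ) (k : ℤ), ∃ N, ∀ t, 0 ≤ t → t ≤ T → X t k = Z N t k := by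
    intro T k
    cases hk : Z 0 0 k with
    | none =>
      refine ⟨0, fun t ht _ => hXZ t k _ (Eventually.of_forall fun N => ?_)⟩
      rw [(hZ N).eq_none (by rw [hZ0, hk]) ht, (hZ 0).eq_none hk ht]
    | some x =>
      obtain ⟨lo, hi, hlo, hhi, hs⟩ := hseal T |x|
      obtain ⟨N₀, hN₀⟩ := hXbox T lo hi hs
      refine ⟨N₀, fun t ht htT => hN₀ N₀ le_rfl t ht htT k ⟨x, ?_, hk⟩⟩
      exact ⟨hlo.trans_le (neg_abs_le x), (le_abs_self x).trans hhi.le⟩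
  refine ⟨X, ?_, ?_, ?_⟩
  · intro k x
    obtain ⟨N, hN⟩ := hXlab 0 k
    rw [hN 0 le_rfl le_rfl]
    exact (hZ N).initial k x
  · intro t ht k
    obtain ⟨N, hN⟩ := hXlab (t + 1) k
    filter_upwards [(hZ N).right_continuous t ht k,
      Ioo_mem_nhdsGT (show t < t + 1 by linarith)] with s hs hs'
    rw [hN t ht (by linarith), hN s (ht.trans hs'.1.le) hs'.2.le, hs]
  · intro t ht
    have hYex : ∀ k, ∃ y, ∀ᶠ s in 𝓝[<] t, X s k = y := by
      intro k
      obtain ⟨N, hN⟩ := hXlab t k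
      obtain ⟨Y, hY, -, -⟩ := (hZ N).update t ht
      refine ⟨Y k, ?_⟩
      filter_upwards [hY k, Ioo_mem_nhdsLT ht] with s h1 h2
      rw [hN s h2.1.le h2.2.le, h1]
    choose Y hY using hYex
    -- Around each particle, the performed jumps are those of some `Z N`.
    have hloc : ∀ k x, Y k = some x → ∃ N, ∃ Y' : ℤ → Option ℤ, X t k = Z N t k ∧ Y' k = some x ∧
        (∀ j, JumpPerformed G t Y x j ↔ JumpPerformed (GN N) t Y' x j) ∧
        (∀ k x j : ℤ, Y' k = some x → JumpPerformed (GN N) t Y' x j → Z N t k = some j) ∧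
        (∀ k : ℤ, (∀ x j : ℤ, Y' k = some x → ¬ JumpPerformed (GN N) t Y' x j) →
          Z N t k = Y' k) := by
      intro k x hkx
      obtain ⟨lo, hi, hlo, hhi, hs⟩ := hseal t |x|
      have hx : x ∈ Set.Ioc lo hi := ⟨hlo.trans_le (neg_abs_le x), (le_abs_self x).trans hhi.le⟩
      obtain ⟨N₁, hN₁⟩ := hXbox t lo hi hs
      obtain ⟨N₂, hN₂⟩ := hmemN t lo hi
      set N := max N₁ N₂
      obtain ⟨Y', hY', hjump, hstay⟩ := (hZ N).update t ht
      have hin' : ∀ l, InBox lo hi (Y' l) ↔ InBox lo hi (Z 0 0 l) := fun l =>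
        of_eventually_left (p := fun o => InBox lo hi o ↔ InBox lo hi (Z 0 0 l)) ht (hY' l)
          fun s hs0 hst => by
            rw [← hZ0 N]; exact (hZ N).inBox_iff (hsealN hs N) l hs0 hst.le
      have hin : ∀ l, InBox lo hi (Y l) ↔ InBox lo hi (Z 0 0 l) := fun l => by
        obtain ⟨M, hM⟩ := hXlab t l
        refine of_eventually_left (p := fun o => InBox lo hi o ↔ InBox lo hi (Z 0 0 l)) ht (hY l) ?_
        intro s hs0 hst
        rw [hM s hs0 hst.le, ← hZ0 M]
        exact (hZ M).inBox_iff (hsealN hs M) l hs0 hst.le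
      have hYY' : ∀ l, InBox lo hi (Z 0 0 l) → Y l = Y' l := by
        intro l hl
        obtain ⟨s, ⟨hs1, hs2⟩, hs0, hst⟩ :=
          (((hY l).and (hY' l)).and (Ioo_mem_nhdsLT ht)).exists
        rw [← hs1, ← hs2, hN₁ N (le_max_left _ _) s hs0.le hst.le l hl]
      have hk : InBox lo hi (Z 0 0 k) := (hin k).1 ⟨x, hx, hkx⟩
      refine ⟨N, Y', hN₁ N (le_max_left _ _) t ht.le le_rfl k hk, by rw [← hYY' k hk, hkx],
        fun j => ?_, hjump, hstay⟩
      exact jumpPerformed_iff (K := {l | InBox lo hi (Z 0 0 l)}) (fun x j => hs t x j ht le_rfl)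
        (fun x j => hsealN hs N t x j ht le_rfl)
        (fun x hx j hj => (hN₂ N (le_max_right _ _) t ht le_rfl x hx j hj).symm) hYY'
        (fun l hl => (hin l).not.2 hl) (fun l hl => (hin' l).not.2 hl) hx j
    refine ⟨Y, hY, ?_, ?_⟩
    · intro k x j hkx hj
      obtain ⟨N, Y', h1, h2, h3, h4, h5⟩ := hloc k x hkx
      rw [h1, h4 k x j h2 ((h3 j).1 hj)]
    · intro k hk
      cases hkx : Y k with
      | none =>
        obtain ⟨N, hN⟩ := hXlab t k
        have h0 : Z 0 0 k = none := by
          cases h : Z 0 0 k with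
          | none => rfl
          | some x =>
            exfalso
            refine of_eventually_left (p := fun o => o ≠ none) ht (hY k) ?_ hkx
            intro s hs0 hst
            rw [hN s hs0 hst.le]
            refine (hZ N).invariant k (fun o => o ≠ none) ?_ ?_ s hs0 le_rfl
            · rw [hZ0, h]; simp
            · intros; simp
        rw [hN t ht.le le_rfl]
        exact (hZ N).eq_none (by rw [hZ0, h0]) ht.le
      | some x =>
        obtain ⟨N, Y', h1, h2, h3, h4, h5⟩ := hloc k x hkx
        rw [h1, h5 k, h2]
        intro x' j hx'
        obtain rfl : x = x' := by simpa [h2] using hx'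
        exact (h3 j).not.1 (hk x j hkx)

end ASEP


/-! ### Order and labels of the particles -/

namespace ASEP

/-- All instructions of the time graph `G` are jumps to a neighbouring site. -/
def NearestNeighbour (G : Set (ℝ × ℤ × ℤ)) : Prop :=
  ∀ t x j, (t, x, j) ∈ G → j = x + 1 ∨ j = x - 1

variable {G : Set (ℝ × ℤ × ℤ)} {η : ℤ → Bool} {X : ℝ → ℤ → Option ℤ} {T : ℝ} {lo hi : ℤ}

lemma IsTrajectory.initial_lt (hX : IsTrajectory G η X) {k l x y : ℤ} (hkl : k < l)
    (hx : X 0 k = some x) (hy : X 0 l = some y) : x < y := by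
  obtain ⟨hx1, hx2⟩ := (hX.initial k x).1 hx
  obtain ⟨hy1, hy2⟩ := (hX.initial l y).1 hy
  by_contra h
  rcases (not_lt.1 h).eq_or_lt with h' | h'
  · subst h'; omega
  · have := label_lt_label h' hy1
    omega

/-- The exclusion rule preserves the order of the particles. -/
lemma IsTrajectory.lt (hX : IsTrajectory G η X) (hnn : NearestNeighbour G)
    (hns : NoSimultaneous G) {k l : ℤ} (hkl : k < l) {t : ℝ} (ht : 0 ≤ t) :
    ∀ x y, X t k = some x → X t l = some y → x < y := by
  refine real_interval_induction (T := t)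
    (p := fun t => ∀ x y, X t k = some x → X t l = some y → x < y)
    (fun x y hx hy => hX.initial_lt hkl hx hy) ?_ ?_ t ht le_rfl
  · intro t ht _ hp
    filter_upwards [hX.right_continuous t ht k, hX.right_continuous t ht l] with s h1 h2
    rw [h1, h2]; exact hp
  · intro t ht _ hp
    obtain ⟨Y, hY, hjump, hstay⟩ := hX.update t ht
    have hYlt : ∀ x y, Y k = some x → Y l = some y → x < y := by
      obtain ⟨s, ⟨hs1, hs2⟩, hs0, hst⟩ :=
        (((hY k).and (hY l)).and (Ioo_mem_nhdsLT ht)).exists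
      rw [← hs1, ← hs2]
      exact hp s hs0.le hst
    -- A particle either performs a jump or keeps its position.
    have hcase : ∀ m z, X t m = some z →
        (∃ x, Y m = some x ∧ JumpPerformed G t Y x z) ∨ Y m = some z := by
      intro m z hz
      by_cases hc : ∃ x j, Y m = some x ∧ JumpPerformed G t Y x j
      · obtain ⟨x, j, hx, hj⟩ := hc
        have := hjump m x j hx hj
        obtain rfl : j = z := by simpa [this] using hz
        exact Or.inl ⟨x, hx, hj⟩
      · push Not at hc
        right
        rw [← hstay m hc, hz]
    intro x y hx hy
    rcases hcase k x hx with ⟨x', hx', hjx⟩ | hx' <;> rcases hcase l y hy with ⟨y', hy', hjy⟩ | hy'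
    · have h1 := hns t _ _ ht hjx.1 hjy.1
      have h2 := hYlt x' y' hx' hy'
      simp only [Prod.mk.injEq] at h1
      omega
    · have h2 := hYlt x' y hx' hy'
      have h3 : x ≠ y := fun h => hjx.2 l (by rw [hy', h])
      rcases hnn t x' x hjx.1 with h | h <;> omega
    · have h2 := hYlt x y' hx' hy'
      have h3 : y ≠ x := fun h => hjy.2 k (by rw [hx', h])
      rcases hnn t y' y hjy.1 with h | h <;> omega
    · exact hYlt x y hx' hy'

lemma label_eq_card_sub (hlo : lo ≤ 0) {x : ℤ} (hx : lo < x) :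
    label η x = (((Finset.Ioo lo x).filter (fun q => η q = true)).card : ℤ) -
      ((Finset.Ioc lo 0).filter (fun q => η q = true)).card := by
  unfold label
  split_ifs with h
  · have : Finset.Ioo lo x = Finset.Ioc lo 0 ∪ Finset.Ico 1 x := by
      ext z; simp only [Finset.mem_Ioo, Finset.mem_union, Finset.mem_Ioc, Finset.mem_Ico]; omega
    rw [this, Finset.filter_union, Finset.card_union_of_disjoint]
    · push_cast; ring
    · apply Finset.disjoint_filter_filter
      rw [Finset.disjoint_left]
      intro z; simp only [Finset.mem_Ioc, Finset.mem_Ico]; omega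
  · have : Finset.Ioc lo 0 = Finset.Ioo lo x ∪ Finset.Icc x 0 := by
      ext z; simp only [Finset.mem_Ioo, Finset.mem_union, Finset.mem_Ioc, Finset.mem_Icc]; omega
    rw [this, Finset.filter_union, Finset.card_union_of_disjoint]
    · push_cast; ring
    · apply Finset.disjoint_filter_filter
      rw [Finset.disjoint_left]
      intro z; simp only [Finset.mem_Ioo, Finset.mem_Icc]; omega

open scoped Classical in
/-- The set of occupied sites, as a configuration. -/
noncomputable def config (Y : ℤ → Option ℤ) (q : ℤ) : Bool := decide (∃ l, Y l = some q)

lemma config_eq_true_iff {Y : ℤ → Option ℤ} {q : ℤ} : config Y q = true ↔ ∃ l, Y l = some q := by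
  simp [config]

lemma IsTrajectory.config_zero (hX : IsTrajectory G η X) (q : ℤ) : config (X 0) q = η q := by
  rw [Bool.eq_iff_iff, config_eq_true_iff]
  constructor
  · rintro ⟨l, hl⟩; exact ((hX.initial l q).1 hl).1
  · intro h; exact ⟨_, (hX.initial _ q).2 ⟨h, rfl⟩⟩

/-- The number of particles in a sealed box to the left of the particle `i`. -/
lemma IsTrajectory.card_left (hX : IsTrajectory G η X) (hnn : NearestNeighbour G)
    (hns : NoSimultaneous G) (hs : Sealed G T lo hi) (hlo : lo ≤ 0) {t : ℝ} (ht : 0 ≤ t)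
    (htT : t ≤ T) {i s : ℤ} (hsb : s ∈ Set.Ioc lo hi) (hXi : X t i = some s) :
    (((Finset.Ioo lo s).filter (fun q => config (X t) q = true)).card : ℤ) =
      i + ((Finset.Ioc lo 0).filter (fun q => η q = true)).card := by
  obtain ⟨x₀, hx₀, hix₀⟩ := (hX.inBox_iff hs i ht htT).1 ⟨s, hsb, hXi⟩
  obtain ⟨hη₀, hl₀⟩ := (hX.initial i x₀).1 hix₀
  have key : ((Finset.Ioo lo x₀).filter (fun q => η q = true)).card =
      ((Finset.Ioo lo s).filter (fun q => config (X t) q = true)).card := by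
    -- Each particle is sent from its initial position to its position at time `t`.
    refine Finset.card_bij (fun q _ => (X t (label η q)).getD 0) ?_ ?_ ?_
    · intro q hq
      simp only [Finset.mem_filter, Finset.mem_Ioo] at hq ⊢
      have hq0 := (hX.initial _ q).2 ⟨hq.2, rfl⟩
      obtain ⟨q', hq', hqq'⟩ := (hX.inBox_iff hs (label η q) ht htT).2
        ⟨q, ⟨hq.1.1, (hq.1.2.trans_le hx₀.2).le⟩, hq0⟩
      rw [hqq', Option.getD_some]
      have hlt : label η q < i := by rw [← hl₀]; exact label_lt_label hq.1.2 hq.2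
      exact ⟨⟨hq'.1, hX.lt hnn hns hlt ht _ _ hqq' hXi⟩, config_eq_true_iff.2 ⟨_, hqq'⟩⟩
    · intro q hq p hp h
      simp only [Finset.mem_filter, Finset.mem_Ioo] at hq hp
      have hq0 := (hX.initial _ q).2 ⟨hq.2, rfl⟩
      have hp0 := (hX.initial _ p).2 ⟨hp.2, rfl⟩
      obtain ⟨q', hq', hqq'⟩ := (hX.inBox_iff hs (label η q) ht htT).2
        ⟨q, ⟨hq.1.1, (hq.1.2.trans_le hx₀.2).le⟩, hq0⟩
      obtain ⟨p', hp', hpp'⟩ := (hX.inBox_iff hs (label η p) ht htT).2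
        ⟨p, ⟨hp.1.1, (hp.1.2.trans_le hx₀.2).le⟩, hp0⟩
      rw [hqq', hpp', Option.getD_some, Option.getD_some] at h
      subst h
      apply label_injOn hq.2 hp.2
      rcases lt_trichotomy (label η q) (label η p) with h | h | h
      · exact absurd (hX.lt hnn hns h ht _ _ hqq' hpp') (lt_irrefl _)
      · exact h
      · exact absurd (hX.lt hnn hns h ht _ _ hpp' hqq') (lt_irrefl _)
    · intro q' hq'
      simp only [Finset.mem_filter, Finset.mem_Ioo] at hq'
      obtain ⟨l, hl⟩ := config_eq_true_iff.1 hq'.2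
      obtain ⟨q, hq, hlq⟩ := (hX.inBox_iff hs l ht htT).1
        ⟨q', ⟨hq'.1.1, (hq'.1.2.trans_le hsb.2).le⟩, hl⟩
      obtain ⟨hηq, hlabq⟩ := (hX.initial l q).1 hlq
      have hli : l < i := by
        rcases lt_trichotomy l i with h | h | h
        · exact h
        · subst h; rw [hl] at hXi; simp at hXi; omega
        · exact absurd (hX.lt hnn hns h ht _ _ hXi hl) (not_lt.2 hq'.1.2.le)
      refine ⟨q, ?_, ?_⟩
      · simp only [Finset.mem_filter, Finset.mem_Ioo]
        exact ⟨⟨hq.1, hX.initial_lt hli hlq hix₀⟩, hηq⟩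
      · rw [hlabq, hl, Option.getD_some]
  rw [← key]
  have := label_eq_card_sub (η := η) hlo hx₀.1
  omega

/-- In a sealed box the labels can be read off from the configuration. -/
lemma IsTrajectory.eq_some_iff (hX : IsTrajectory G η X) (hnn : NearestNeighbour G)
    (hns : NoSimultaneous G) (hs : Sealed G T lo hi) (hlo : lo ≤ 0) {t : ℝ} (ht : 0 ≤ t)
    (htT : t ≤ T) {i s : ℤ} (hsb : s ∈ Set.Ioc lo hi) :
    X t i = some s ↔ config (X t) s = true ∧
      (((Finset.Ioo lo s).filter (fun q => config (X t) q = true)).card : ℤ) =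
      i + ((Finset.Ioc lo 0).filter (fun q => η q = true)).card := by
  constructor
  · intro h
    exact ⟨config_eq_true_iff.2 ⟨i, h⟩, hX.card_left hnn hns hs hlo ht htT hsb h⟩
  · rintro ⟨h1, h2⟩
    obtain ⟨l, hl⟩ := config_eq_true_iff.1 h1
    have := hX.card_left hnn hns hs hlo ht htT hsb hl
    obtain rfl : l = i := by omega
    exact hl

end ASEP


/-! ### Comparison of the six-vertex dynamics with the exclusion process -/

namespace ASEP

variable {G : Set (ℝ × ℤ × ℤ)} {η : ℤ → Bool} {X : ℝ → ℤ → Option ℤ} {T : ℝ} {lo hi : ℤ}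

/-- The bond `{d, d + 1}`, represented by `d`, across which the clock `κ` tells particles to jump.
The right clock of the site `x` is `(x, true)` and its left clock is `(x, false)`. -/
def bond (κ : ℤ × Bool) : ℤ := if κ.2 then κ.1 else κ.1 - 1

/-- The site to which the clock `κ` tells particles to jump. -/
def target (κ : ℤ × Bool) : ℤ := if κ.2 then κ.1 + 1 else κ.1 - 1

/-- In a sealed box nothing changes while no clock rings. -/
lemma IsTrajectory.config_eq_of_no_ring (hX : IsTrajectory G η X) (hs : Sealed G T lo hi)
    {s t : ℝ} (hs0 : 0 ≤ s) (hst : s ≤ t) (htT : t ≤ T)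
    (hno : ∀ u x j, s < u → u ≤ t → x ∈ Set.Ioc lo hi → (u, x, j) ∉ G) {q : ℤ}
    (hq : q ∈ Set.Ioc lo hi) : config (X t) q = config (X s) q := by
  have hconst : ∀ l, InBox lo hi (X 0 l) → X t l = X s l := by
    intro l hl
    refine real_interval_induction (T := t) (p := fun u => s ≤ u → X u l = X s l) ?_ ?_ ?_ t
      (hs0.trans hst) le_rfl hst
    · intro h; rw [le_antisymm hs0 h]
    · intro u hu _ hp
      rcases lt_or_ge u s with h | h
      · filter_upwards [Ioo_mem_nhdsGT h] with v hv hv'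
        exact absurd hv.2 (not_lt.2 hv')
      · filter_upwards [hX.right_continuous u hu l] with v hv _
        rw [hv, hp h]
    · intro u hu hut hp hsu
      rcases hsu.eq_or_lt with h | h
      · rw [h]
      · obtain ⟨Y, hY, hjump, hstay⟩ := hX.update u hu
        obtain ⟨v, hv1, hv2⟩ := ((hY l).and (Ioo_mem_nhdsLT h)).exists
        have hYl : Y l = X s l := by rw [← hv1, hp v (hs0.trans hv2.1.le) hv2.2 hv2.1.le]
        rw [← hYl]
        refine hstay l fun x j hx hj => ?_
        have hin := (hX.inBox_iff hs l hs0 (hst.trans htT)).2 hl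
        rw [← hYl, hx, inBox_some] at hin
        exact hno u x j h hut hin hj.1
  rw [Bool.eq_iff_iff, config_eq_true_iff, config_eq_true_iff]
  refine exists_congr fun l => ?_
  by_cases hl : InBox lo hi (X 0 l)
  · rw [hconst l hl]
  · have h1 := (hX.inBox_iff hs l (hs0.trans hst) htT).not.2 hl
    have h2 := (hX.inBox_iff hs l hs0 (hst.trans htT)).not.2 hl
    exact ⟨fun h => absurd ⟨q, hq, h⟩ h1, fun h => absurd ⟨q, hq, h⟩ h2⟩

/-- The effect of a ring on the configuration. -/
lemma config_of_ring (hns : NoSimultaneous G) {t : ℝ} (ht : 0 < t) {Y Z : ℤ → Option ℤ}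
    (hjump : ∀ k x j : ℤ, Y k = some x → JumpPerformed G t Y x j → Z k = some j)
    (hstay : ∀ k : ℤ, (∀ x j : ℤ, Y k = some x → ¬ JumpPerformed G t Y x j) → Z k = Y k)
    {x j : ℤ} (hxj : x ≠ j) (hG : (t, x, j) ∈ G) :
    config Z x = (config Y x && config Y j) ∧ config Z j = (config Y x || config Y j) ∧
      ∀ q, q ≠ x → q ≠ j → config Z q = config Y q := by
  have hu : ∀ x' j', JumpPerformed G t Y x' j' → x' = x ∧ j' = j := fun x' j' h => by
    simpa using hns t _ _ ht h.1 hG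
  have hstay' : ∀ l q, Y l = some q → q ≠ x → Z l = some q := by
    intro l q hl hq
    rw [hstay l, hl]
    intro x' j' hx' hJ
    rw [hl, Option.some.injEq] at hx'
    exact hq (hx'.trans (hu x' j' hJ).1)
  have hback : ∀ l q, Z l = some q → Y l = some q ∨ (q = j ∧ Y l = some x) := by
    intro l q hl
    by_cases hc : ∃ x' j', Y l = some x' ∧ JumpPerformed G t Y x' j'
    · obtain ⟨x', j', hx', hJ⟩ := hc
      obtain ⟨rfl, rfl⟩ := hu x' j' hJ
      have := hjump l _ _ hx' hJ
      rw [hl, Option.some.injEq] at this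
      exact Or.inr ⟨this, hx'⟩
    · push Not at hc
      left; rw [← hstay l hc, hl]
  refine ⟨?_, ?_, ?_⟩
  · rw [Bool.eq_iff_iff, Bool.and_eq_true, config_eq_true_iff, config_eq_true_iff,
      config_eq_true_iff]
    constructor
    · rintro ⟨l, hl⟩
      have hYl : Y l = some x := by
        rcases hback l x hl with h | h
        · exact h
        · exact absurd h.1 hxj
      refine ⟨⟨l, hYl⟩, ?_⟩
      by_contra hv
      push Not at hv
      have := hjump l x j hYl ⟨hG, hv⟩
      rw [hl, Option.some.injEq] at this
      exact hxj this
    · rintro ⟨⟨l, hl⟩, m, hm⟩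
      refine ⟨l, ?_⟩
      rw [hstay l, hl]
      intro x' j' _ hJ
      obtain ⟨rfl, rfl⟩ := hu x' j' hJ
      exact hJ.2 m hm
  · rw [Bool.eq_iff_iff, Bool.or_eq_true, config_eq_true_iff, config_eq_true_iff,
      config_eq_true_iff]
    constructor
    · rintro ⟨l, hl⟩
      rcases hback l j hl with h | h
      · exact Or.inr ⟨l, h⟩
      · exact Or.inl ⟨l, h.2⟩
    · intro h
      by_cases hj : ∃ l, Y l = some j
      · obtain ⟨l, hl⟩ := hj
        exact ⟨l, hstay' l j hl hxj.symm⟩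
      · obtain ⟨l, hl⟩ := h.resolve_right hj
        push Not at hj
        exact ⟨l, hjump l x j hl ⟨hG, hj⟩⟩
  · intro q hqx hqj
    rw [Bool.eq_iff_iff, config_eq_true_iff, config_eq_true_iff]
    refine exists_congr fun l => ⟨fun h => ?_, fun h => hstay' l q h hqx⟩
    rcases hback l q h with h' | h'
    · exact h'
    · exact absurd h'.1 hqj

/-- The rings of the time graph `G` in the box `(lo, hi]` up to time `t`, including those at the two
bonds `lo` and `hi` at its ends, correspond to the active bits of the discrete dynamics with bits
`A`, `B`. The rings form a type `ι`; the ring `e` belongs to the clock `key e`, and it happens at time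
`τ e` in continuous time and at step `σ e` in discrete time. Up to time `t` the order of the rings is
the same. -/
structure Coupled (G : Set (ℝ × ℤ × ℤ)) (A B : ℕ → ℤ → Bool) (t : ℝ) (lo hi : ℤ) {ι : Type*}
    (key : ι → ℤ × Bool) (τ : ι → ℝ) (σ : ι → ℕ) : Prop where
  bond_mem : ∀ e, bond (key e) ∈ Set.Icc lo hi
  time_pos : ∀ e, 0 < τ e
  step_pos : ∀ e, 0 < σ e
  mem_graph : ∀ e, (τ e, (key e).1, target (key e)) ∈ G
  exists_of_mem_graph : ∀ s κ, 0 < s → bond κ ∈ Set.Icc lo hi → (s, κ.1, target κ) ∈ G →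
    ∃ e, key e = κ ∧ τ e = s
  left_bit : ∀ n, ∀ d ∈ Set.Icc lo hi, (A n d = true ↔ ∃ e, key e = (d + 1, false) ∧ σ e = n + 1)
  right_bit : ∀ n, ∀ d ∈ Set.Icc lo hi, (B n d = true ↔ ∃ e, key e = (d, true) ∧ σ e = n + 1)
  time_injective : ∀ e e', τ e = τ e' → e = e'
  finite_le : {e | τ e ≤ t}.Finite
  order : ∀ e e', τ e < τ e' → τ e' ≤ t → σ e < σ e'

/-- The discrete dynamics and the exclusion process agree in a sealed box as soon as the same rings
have happened in both. -/
theorem Coupled.config_eq {ι : Type*} {key : ι → ℤ × Bool} {τ : ι → ℝ} {σ : ι → ℕ}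
    {A B c H : ℕ → ℤ → Bool} {t : ℝ} (hC : Coupled G A B t lo hi key τ σ)
    (hr : ∀ n d, (c (n + 1) d, H n (d + 1)) =
      SixVertex.completion (A n d) (B n d) (c n (d + 1)) (H n d))
    (hc0 : ∀ q, c 0 q = η q) (hX : IsTrajectory G η X) (hnn : NearestNeighbour G)
    (hns : NoSimultaneous G) (hs : Sealed G T lo hi) (hlohi : lo < hi) (htT : t ≤ T) (n : ℕ) :
    ∀ t', 0 ≤ t' → t' ≤ t → (∀ e, τ e ≤ t' ↔ σ e ≤ n) →
      ∀ q ∈ Set.Ioc lo hi, c n q = config (X t') q := by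
  -- Every instruction in the box comes from one of the rings.
  have hring : ∀ u x j, 0 < u → x ∈ Set.Ioc lo hi → (u, x, j) ∈ G →
      ∃ e, τ e = u := by
    intro u x j hu hx hg
    rcases hnn u x j hg with h | h
    · obtain ⟨e, -, he⟩ := hC.exists_of_mem_graph u (x, true) hu
        (by simp only [bond, if_true]; exact ⟨hx.1.le, hx.2⟩) (by simpa [target, ← h] using hg)
      exact ⟨e, he⟩
    · obtain ⟨e, -, he⟩ := hC.exists_of_mem_graph u (x, false) hu
        (by
          have h1 := hx.1
          have h2 := hx.2
          simp only [bond, Bool.false_eq_true, if_false, Set.mem_Icc]; omega)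
        (by simpa [target, ← h] using hg)
      exact ⟨e, he⟩
  induction n with
  | zero =>
    intro t' ht' ht't hcomp q hq
    rw [hc0, ← hX.config_zero]
    refine (hX.config_eq_of_no_ring hs le_rfl ht' (ht't.trans htT) ?_ hq).symm
    intro u x j hu hut' hx hg
    obtain ⟨e, he⟩ := hring u x j hu hx hg
    have h1 := (hcomp e).1 (he ▸ hut')
    have h2 := hC.step_pos e
    omega
  | succ n ih =>
    intro t' ht' ht't hcomp q hq
    by_cases hex : ∃ e, σ e = n + 1
    swap
    · -- No ring at this step.
      push Not at hex
      have hAf : ∀ d ∈ Set.Icc lo hi, A n d = false := by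
        intro d hd
        rw [← Bool.not_eq_true, hC.left_bit n d hd]
        rintro ⟨e, -, he⟩; exact hex e he
      have hBf : ∀ d ∈ Set.Icc lo hi, B n d = false := by
        intro d hd
        rw [← Bool.not_eq_true, hC.right_bit n d hd]
        rintro ⟨e, -, he⟩; exact hex e he
      have h1 : q ∈ Set.Icc lo hi := ⟨hq.1.le, hq.2⟩
      have h2 : q - 1 ∈ Set.Icc lo hi := by
        have h1 := hq.1
        have h2 := hq.2
        rw [Set.mem_Icc]; omega
      rw [SixVertex.update_eq_self (hr n) (hAf q h1) (hBf q h1) (hAf _ h2) (hBf _ h2)]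
      refine ih t' ht' ht't (fun e => ?_) q hq
      rw [hcomp e]
      have := hex e
      omega
    · obtain ⟨e₀, he₀⟩ := hex
      have hτt' : τ e₀ ≤ t' := (hcomp e₀).2 he₀.le
      have hτt : τ e₀ ≤ t := hτt'.trans ht't
      have hτ0 := hC.time_pos e₀
      have huniq : ∀ e, σ e = n + 1 → e = e₀ := by
        intro e he
        have het : τ e ≤ t := ((hcomp e).2 he.le).trans ht't
        apply hC.time_injective
        rcases lt_trichotomy (τ e) (τ e₀) with h | h | h
        · have := hC.order e e₀ h hτt; omega
        · exact h
        · have := hC.order e₀ e h het; omega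
      obtain ⟨Y, hY, hjump, hstay⟩ := hX.update (τ e₀) hτ0
      -- A time `s` before the ring `e₀` and after all earlier rings.
      obtain ⟨s, ⟨hsY, hsτ⟩, hs0, hse₀⟩ : ∃ s, ((∀ l ∈ {l | InBox lo hi (X 0 l)}, X s l = Y l) ∧
          ∀ e ∈ {e | τ e ≤ t}, τ e < τ e₀ → τ e < s) ∧ s ∈ Set.Ioo 0 (τ e₀) := by
        refine ((((Filter.eventually_all_finite (hX.finite_inBox lo hi)).2
          fun l _ => hY l).and ((Filter.eventually_all_finite hC.finite_le).2
          fun e _ => ?_)).and (Ioo_mem_nhdsLT hτ0)).exists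
        by_cases h : τ e < τ e₀
        · filter_upwards [Ioo_mem_nhdsLT h] with s hs _ using hs.1
        · exact Eventually.of_forall fun s h' => absurd h' h
      have hsT : s ≤ T := hse₀.le.trans (hτt.trans htT)
      have hcompn : ∀ e, τ e ≤ s ↔ σ e ≤ n := by
        intro e
        constructor
        · intro h
          have := hC.order e e₀ (h.trans_lt hse₀) hτt
          omega
        · intro h
          have het : τ e ≤ t := ((hcomp e).2 (by omega)).trans ht't
          refine (hsτ e het ?_).le
          rcases lt_trichotomy (τ e) (τ e₀) with h' | h' | h'
          · exact h'
          · have := hC.time_injective _ _ h'; subst this; omega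
          · have := hC.order e₀ e h' het; omega
      have hih : ∀ q ∈ Set.Ioc lo hi, c n q = config Y q := by
        intro q hq
        rw [ih s hs0.le (hse₀.le.trans hτt) hcompn q hq, Bool.eq_iff_iff, config_eq_true_iff,
          config_eq_true_iff]
        refine exists_congr fun l => ?_
        by_cases hl : InBox lo hi (X 0 l)
        · rw [hsY l hl]
        · have h1 := (hX.inBox_iff hs l hs0.le hsT).not.2 hl
          have h2 : ¬ InBox lo hi (Y l) := by
            refine of_eventually_left (p := fun o => ¬ InBox lo hi o) hτ0 (hY l) ?_
            intro v hv0 hv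
            exact (hX.inBox_iff hs l hv0 (hv.le.trans (hτt.trans htT))).not.2 hl
          exact ⟨fun h => absurd ⟨q, hq, h⟩ h1, fun h => absurd ⟨q, hq, h⟩ h2⟩
      have hafter : config (X t') q = config (X (τ e₀)) q := by
        refine hX.config_eq_of_no_ring hs hτ0.le hτt' (ht't.trans htT) ?_ hq
        intro u x j hu hut' hx hg
        obtain ⟨e, he⟩ := hring u x j (hτ0.trans hu) hx hg
        have h1 := (hcomp e).1 (he ▸ hut')
        have h2 := hC.order e₀ e (he ▸ hu) (he ▸ hut'.trans ht't)
        omega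
      rw [hafter]
      obtain ⟨x, β, hkey⟩ : ∃ x β, key e₀ = (x, β) := ⟨_, _, rfl⟩
      have hbond := hC.bond_mem e₀
      have hg := hC.mem_graph e₀
      rw [hkey] at hbond hg
      set d := bond (x, β) with hd
      have hseal := hs _ _ _ hτ0 (hτt.trans htT) hg
      have hdlohi : lo < d ∧ d < hi := by
        rw [hd] at hbond ⊢
        cases β <;> simp only [bond, target, Bool.false_eq_true, if_true, if_false, Set.mem_Icc,
          Set.mem_Ioc] at hbond hseal ⊢ <;> omega
      have hAd : ∀ d' ∈ Set.Icc lo hi, A n d' = (decide (d' = d) && !β) := by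
        intro d' hd'
        rw [Bool.eq_iff_iff, hC.left_bit n d' hd', Bool.and_eq_true, decide_eq_true_eq,
          Bool.not_eq_true']
        constructor
        · rintro ⟨e, he, heσ⟩
          rw [huniq e heσ, hkey] at he
          obtain ⟨rfl, rfl⟩ := Prod.mk.inj he
          rw [hd]; simp [bond]
        · rintro ⟨h1, h2⟩
          refine ⟨e₀, ?_, he₀⟩
          rw [hkey, h1, h2, hd, h2]; simp [bond]
      have hBd : ∀ d' ∈ Set.Icc lo hi, B n d' = (decide (d' = d) && β) := by
        intro d' hd'
        rw [Bool.eq_iff_iff, hC.right_bit n d' hd', Bool.and_eq_true, decide_eq_true_eq]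
        constructor
        · rintro ⟨e, he, heσ⟩
          rw [huniq e heσ, hkey] at he
          obtain ⟨rfl, rfl⟩ := Prod.mk.inj he
          rw [hd]; simp [bond]
        · rintro ⟨h1, h2⟩
          refine ⟨e₀, ?_, he₀⟩
          rw [hkey, h1, h2, hd, h2]; simp [bond]
      have hne : ∀ d' ∈ Set.Icc lo hi, d' ≠ d → A n d' = false ∧ B n d' = false := by
        intro d' hd' hdd
        rw [hAd d' hd', hBd d' hd', decide_eq_false hdd]
        exact ⟨rfl, rfl⟩
      have hdm : d - 1 ∈ Set.Icc lo hi := by rw [Set.mem_Icc]; omega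
      have hdp : d + 1 ∈ Set.Icc lo hi := by rw [Set.mem_Icc]; omega
      have hdd : d ∈ Set.Icc lo hi := by rw [Set.mem_Icc]; omega
      have hpair := SixVertex.update_pair (hr n) (hne _ hdp (by omega)).1 (hne _ hdp (by omega)).2
        (hne _ hdm (by omega)).1 (hne _ hdm (by omega)).2
      rw [hAd d hdd, hBd d hdd, decide_eq_true rfl, Bool.true_and, Bool.true_and,
        hih d ⟨hdlohi.1, hdlohi.2.le⟩, hih (d + 1) (by rw [Set.mem_Ioc]; omega)] at hpair
      have hxt : x ≠ target (x, β) := by unfold target; split_ifs <;> simp only <;> omega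
      obtain ⟨hx1, hx2, hx3⟩ := config_of_ring hns hτ0 hjump hstay hxt hg
      have hpair' : c (n + 1) d = config (X (τ e₀)) d ∧
          c (n + 1) (d + 1) = config (X (τ e₀)) (d + 1) := by
        cases β with
        | true =>
          have e1 : d = x := by rw [hd]; simp [bond]
          have e2 : target (x, true) = d + 1 := by simp [target, e1]
          rw [e2, ← e1] at hx1 hx2
          rw [hx1, hx2]
          revert hpair
          generalize config Y d = u, config Y (d + 1) = v, c (n + 1) d = u', c (n + 1) (d + 1) = v'
          revert u v u' v'
          decide
        | false =>
          have e1 : x = d + 1 := by rw [hd]; simp [bond]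
          have e2 : target (x, false) = d := by simp [target, e1]
          rw [e2, e1] at hx1 hx2
          rw [hx1, hx2]
          revert hpair
          generalize config Y d = u, config Y (d + 1) = v, c (n + 1) d = u', c (n + 1) (d + 1) = v'
          revert u v u' v'
          decide
      by_cases hq1 : q = d
      · rw [hq1]; exact hpair'.1
      by_cases hq2 : q = d + 1
      · rw [hq2]; exact hpair'.2
      have hq3 : q - 1 ∈ Set.Icc lo hi := by
        have h1 := hq.1
        have h2 := hq.2
        rw [Set.mem_Icc]; omega
      have hq4 := hne q ⟨hq.1.le, hq.2⟩ hq1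
      have hq5 := hne (q - 1) hq3 (by omega)
      rw [SixVertex.update_eq_self (hr n) hq4.1 hq4.2 hq5.1 hq5.2, hih q hq, hx3]
      · cases β <;> simp only [hd, bond, Bool.false_eq_true, if_true, if_false] at hq1 hq2 <;> omega
      · cases β <;> simp only [hd, bond, target, Bool.false_eq_true, if_true, if_false] at hq1 hq2 ⊢
          <;> omega

end ASEP


/-! ### Bernoulli bits from exponential waiting times -/

namespace ASEP

open SixVertex (bernoulliMass BernoulliQueries)

lemma expMeasure_Ioc {a b : ℝ} (ha : 0 ≤ a) (hab : a ≤ b) :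
    expMeasure 1 (Set.Ioc a b) = ENNReal.ofReal (Real.exp (-a) - Real.exp (-b)) := by
  conv_lhs => rw [← measure_cdf (expMeasure 1)]
  rw [StieltjesFunction.measure_Ioc, cdf_expMeasure_eq one_pos, cdf_expMeasure_eq one_pos,
    if_pos ha, if_pos (ha.trans hab)]
  congr 1
  simp only [one_mul]
  ring

lemma expMeasure_Iic {a : ℝ} (ha : 0 ≤ a) :
    expMeasure 1 (Set.Iic a) = ENNReal.ofReal (1 - Real.exp (-a)) := by
  rw [← ofReal_cdf, cdf_expMeasure_eq one_pos, if_pos ha, one_mul]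

lemma expMeasure_Iic_zero : expMeasure 1 (Set.Iic 0) = 0 := by
  rw [expMeasure_Iic le_rfl]; simp

lemma expMeasure_Ioi {a : ℝ} (ha : 0 ≤ a) :
    expMeasure 1 (Set.Ioi a) = ENNReal.ofReal (Real.exp (-a)) := by
  rw [← Set.compl_Iic, prob_compl_eq_one_sub measurableSet_Iic, expMeasure_Iic ha,
    ← ENNReal.ofReal_one, ← ENNReal.ofReal_sub _ (by simpa using ha)]
  congr 1; ring

/-- The exponential distribution is memoryless. -/
lemma map_restrict_expMeasure {a : ℝ} (ha : 0 ≤ a) :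
    ((expMeasure 1).restrict (Set.Ioi a)).map (fun x => x - a) =
      ENNReal.ofReal (Real.exp (-a)) • expMeasure 1 := by
  have hm : Measurable fun x : ℝ => x - a := by fun_prop
  refine Measure.ext_of_Iic _ _ fun x => ?_
  rw [Measure.map_apply hm measurableSet_Iic, Measure.restrict_apply (hm measurableSet_Iic),
    Measure.smul_apply, smul_eq_mul]
  have : (fun x : ℝ => x - a) ⁻¹' Set.Iic x ∩ Set.Ioi a = Set.Ioc a (a + x) := by
    ext y; simp only [Set.mem_inter_iff, Set.mem_preimage, Set.mem_Iic, Set.mem_Ioi, Set.mem_Ioc]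
    constructor
    · rintro ⟨h1, h2⟩; exact ⟨h2, by linarith⟩
    · rintro ⟨h1, h2⟩; exact ⟨by linarith, h1⟩
  rw [this]
  rcases le_or_gt 0 x with hx | hx
  · rw [expMeasure_Ioc ha (by linarith), expMeasure_Iic hx,
      ← ENNReal.ofReal_mul (Real.exp_pos _).le, mul_sub, mul_one, ← Real.exp_add]
    congr 3; ring
  · rw [Set.Ioc_eq_empty (by linarith), measure_empty,
      measure_mono_null (Set.Iic_subset_Iic.2 hx.le) expMeasure_Iic_zero, mul_zero]

/-- The law of independent waiting times of rate one for a single clock. -/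
noncomputable def waitingMeasure : Measure (ℕ → ℝ) :=
  Measure.infinitePi (fun _ : ℕ => expMeasure 1)

instance : IsProbabilityMeasure waitingMeasure := by unfold waitingMeasure; infer_instance

/-- The sequence with first term `p.1` and then the terms of `p.2`. -/
def cons (p : ℝ × (ℕ → ℝ)) : ℕ → ℝ
  | 0 => p.1
  | n + 1 => p.2 n

lemma measurable_cons : Measurable cons := by
  refine measurable_pi_lambda _ fun n => ?_
  cases n with
  | zero => exact measurable_fst
  | succ n => exact (measurable_pi_apply n).comp measurable_snd

lemma map_cons_waitingMeasure : ((expMeasure 1).prod waitingMeasure).map cons = waitingMeasure := by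
  classical
  unfold waitingMeasure
  refine Measure.eq_infinitePi _ fun s t ht => ?_
  set s' : Finset ℕ := s.preimage Nat.succ Nat.succ_injective.injOn with hs'
  have hpre : cons ⁻¹' (Set.pi s t) =
      (if 0 ∈ s then t 0 else Set.univ) ×ˢ Set.pi s' (fun n => t (n + 1)) := by
    ext ⟨x, r⟩
    simp only [Set.mem_preimage, Set.mem_pi, Finset.mem_coe, Set.mem_prod, hs', Finset.mem_preimage]
    constructor
    · intro h
      refine ⟨?_, fun n hn => h (n + 1) hn⟩
      split_ifs with h0
      · exact h 0 h0
      · trivial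
    · rintro ⟨h1, h2⟩ n hn
      cases n with
      | zero => rwa [if_pos hn] at h1
      | succ n => exact h2 n hn
  rw [Measure.map_apply measurable_cons (.pi s.countable_toSet fun _ _ => ht _), hpre,
    Measure.prod_prod, Measure.infinitePi_pi _ fun i _ => ht _]
  have hs : s = if 0 ∈ s then insert 0 (s'.image Nat.succ) else s'.image Nat.succ := by
    ext n
    cases n with
    | zero => split_ifs with h <;> simp [h]
    | succ n => split_ifs with h <;> simp [hs']
  have hprod : ∏ i ∈ s'.image Nat.succ, expMeasure 1 (t i) =
      ∏ i ∈ s', expMeasure 1 (t (i + 1)) :=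
    Finset.prod_image fun _ _ _ _ h => Nat.succ_injective h
  by_cases h : 0 ∈ s
  · rw [if_pos h] at hs ⊢
    conv_rhs => rw [hs]
    rw [Finset.prod_insert (by simp), hprod]
  · rw [if_neg h] at hs ⊢
    conv_rhs => rw [hs]
    rw [hprod, measure_univ, one_mul]

open scoped Classical in
/-- The clock with waiting times `ξ` rings at the discrete time `n`, where each waiting time `x` is
turned into `⌈x / lam⌉` steps. -/
noncomputable def stepBit (lam : ℝ) (ξ : ℕ → ℝ) (n : ℕ) : Bool :=
  decide (∃ m, n = ∑ j ∈ Finset.range (m + 1), ⌈ξ j / lam⌉₊)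

lemma stepBit_eq_true_iff {lam : ℝ} {ξ : ℕ → ℝ} {n : ℕ} :
    stepBit lam ξ n = true ↔ ∃ m, n = ∑ j ∈ Finset.range (m + 1), ⌈ξ j / lam⌉₊ := by
  simp [stepBit]

lemma measurable_stepBit (lam : ℝ) (n : ℕ) : Measurable fun ξ => stepBit lam ξ n := by
  refine measurable_to_bool ?_
  have : (fun ξ => stepBit lam ξ n) ⁻¹' {true} =
      ⋃ m, {ξ : ℕ → ℝ | n = ∑ j ∈ Finset.range (m + 1), ⌈ξ j / lam⌉₊} := by
    ext ξ; simp [stepBit]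
  rw [this]
  refine MeasurableSet.iUnion fun m => measurableSet_eq_fun measurable_const ?_
  exact Finset.measurable_sum _ fun j _ =>
    Nat.measurable_ceil.comp (by fun_prop : Measurable fun ξ : ℕ → ℝ => ξ j / lam)

lemma sum_ceil_cons (lam x : ℝ) (r : ℕ → ℝ) (m : ℕ) :
    ∑ j ∈ Finset.range (m + 1), ⌈cons (x, r) j / lam⌉₊ =
      ⌈x / lam⌉₊ + ∑ j ∈ Finset.range m, ⌈r j / lam⌉₊ := by
  rw [Finset.sum_range_succ', add_comm]; rfl

lemma stepBit_cons_of_le {lam x : ℝ} (hx : 0 < x) (hxl : x ≤ lam) (r : ℕ → ℝ) :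
    stepBit lam (cons (x, r)) 1 = true ∧
      ∀ n, stepBit lam (cons (x, r)) (n + 2) = stepBit lam r (n + 1) := by
  have hlam : 0 < lam := hx.trans_le hxl
  have hc : ⌈x / lam⌉₊ = 1 := by
    rw [Nat.ceil_eq_iff one_ne_zero]
    simp only [Nat.sub_self, Nat.cast_zero, Nat.cast_one]
    exact ⟨div_pos hx hlam, (div_le_one hlam).2 hxl⟩
  refine ⟨stepBit_eq_true_iff.2 ⟨0, by rw [sum_ceil_cons]; simp [hc]⟩, fun n => ?_⟩
  rw [Bool.eq_iff_iff, stepBit_eq_true_iff, stepBit_eq_true_iff]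
  constructor
  · rintro ⟨m, hm⟩
    rw [sum_ceil_cons, hc] at hm
    cases m with
    | zero => simp at hm
    | succ m => exact ⟨m, by omega⟩
  · rintro ⟨m, hm⟩
    exact ⟨m + 1, by rw [sum_ceil_cons, hc]; omega⟩

lemma stepBit_cons_of_lt {lam x : ℝ} (hlam : 0 < lam) (hx : lam < x) (r : ℕ → ℝ) :
    stepBit lam (cons (x, r)) 1 = false ∧
      ∀ n, stepBit lam (cons (x, r)) (n + 2) = stepBit lam (cons (x - lam, r)) (n + 1) := by
  have hc : ⌈x / lam⌉₊ = ⌈(x - lam) / lam⌉₊ + 1 := by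
    rw [sub_div, div_self hlam.ne', Nat.ceil_sub_one]
    have : 0 < ⌈x / lam⌉₊ := Nat.ceil_pos.2 (div_pos (hlam.trans hx) hlam)
    omega
  have hc' : 0 < ⌈(x - lam) / lam⌉₊ := Nat.ceil_pos.2 (div_pos (by linarith) hlam)
  constructor
  · rw [← Bool.not_eq_true, stepBit_eq_true_iff]
    rintro ⟨m, hm⟩
    rw [sum_ceil_cons] at hm
    omega
  · intro n
    rw [Bool.eq_iff_iff, stepBit_eq_true_iff, stepBit_eq_true_iff]
    refine exists_congr fun m => ?_
    rw [sum_ceil_cons, sum_ceil_cons, hc]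
    omega

/-- The bits of a clock are independent Bernoulli variables. The proof is by induction on the number
of steps: given the first bit, the remaining waiting times have the same law as at the start. -/
lemma waitingMeasure_stepBit {lam : ℝ} (hlam : 0 ≤ lam) (N : ℕ) (t : ℕ → Set Bool) :
    waitingMeasure {ξ | ∀ n < N, stepBit lam ξ (n + 1) ∈ t n} =
      ∏ n ∈ Finset.range N, bernoulliMass (1 - Real.exp (-lam)) (t n) := by
  classical
  have hmeas : ∀ (N : ℕ) (t : ℕ → Set Bool),
      MeasurableSet {ξ | ∀ n < N, stepBit lam ξ (n + 1) ∈ t n} := by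
    intro N t
    simp only [Set.ofPred_forall]
    exact MeasurableSet.iInter fun n => MeasurableSet.iInter fun _ =>
      measurable_stepBit lam (n + 1) (Set.toFinite (t n)).measurableSet
  rcases hlam.eq_or_lt with rfl | hlam
  · -- A clock of rate zero never rings.
    have hfalse : ∀ ξ n, stepBit 0 ξ (n + 1) = false := by
      intro ξ n
      rw [← Bool.not_eq_true, stepBit_eq_true_iff]
      simp
    simp only [hfalse, neg_zero, Real.exp_zero, sub_self, bernoulliMass, ENNReal.ofReal_zero,
      ite_self, zero_add, sub_zero, ENNReal.ofReal_one]
    by_cases h : ∀ n < N, false ∈ t n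
    · rw [Finset.prod_congr rfl fun n hn => if_pos (h n (Finset.mem_range.1 hn))]
      have hu : {ξ : ℕ → ℝ | ∀ n < N, false ∈ t n} = Set.univ := Set.eq_univ_of_forall fun _ => h
      rw [hu, measure_univ, Finset.prod_const_one]
    · have h' := h
      push Not at h'
      obtain ⟨n, hn, hnt⟩ := h'
      rw [Finset.prod_eq_zero (Finset.mem_range.2 hn) (if_neg hnt)]
      simp only [h, Set.ofPred_false, measure_empty]
  induction N generalizing t with
  | zero => simp
  | succ N ih =>
    set E' : Set (ℕ → ℝ) := {ξ | ∀ n < N, stepBit lam ξ (n + 1) ∈ t (n + 1)} with hE'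
    have hE'm : MeasurableSet E' := hmeas N fun n => t (n + 1)
    have hE'v : waitingMeasure E' = _ := ih (fun n => t (n + 1))
    rw [Finset.prod_range_succ', ← hE'v]
    set E : Set (ℕ → ℝ) := {ξ | ∀ n < N + 1, stepBit lam ξ (n + 1) ∈ t n} with hE
    have hEm : MeasurableSet E := hmeas (N + 1) t
    have hmem : ∀ p : ℝ × (ℕ → ℝ), cons p ∈ E ↔ stepBit lam (cons p) 1 ∈ t 0 ∧
        ∀ n < N, stepBit lam (cons p) (n + 2) ∈ t (n + 1) := by
      intro p
      simp only [hE, Set.mem_ofPred_eq]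
      constructor
      · intro h
        exact ⟨h 0 (by omega), fun n hn => h (n + 1) (by omega)⟩
      · rintro ⟨h1, h2⟩ n hn
        cases n with
        | zero => exact h1
        | succ n => exact h2 n (by omega)
    rw [← map_cons_waitingMeasure, Measure.map_apply measurable_cons hEm,
      map_cons_waitingMeasure]
    set A : Set (ℝ × (ℕ → ℝ)) := Set.Iic lam ×ˢ Set.univ with hA
    have hAm : MeasurableSet A := measurableSet_Iic.prod MeasurableSet.univ
    rw [← measure_inter_add_sdiff (cons ⁻¹' E) hAm]
    have h1 : (expMeasure 1).prod waitingMeasure (cons ⁻¹' E ∩ A) =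
        (if true ∈ t 0 then ENNReal.ofReal (1 - Real.exp (-lam)) else 0) * waitingMeasure E' := by
      have hpos : ∀ᵐ p ∂(expMeasure 1).prod waitingMeasure, 0 < p.1 := by
        have : ∀ᵐ x ∂(expMeasure 1), 0 < x := by
          rw [ae_iff]; simpa [Set.Iic] using expMeasure_Iic_zero
        exact Measure.quasiMeasurePreserving_fst.ae this
      have : (cons ⁻¹' E ∩ A : Set _) =ᵐ[(expMeasure 1).prod waitingMeasure]
          ((if true ∈ t 0 then Set.Iic lam else ∅) ×ˢ E' : Set _) := by
        filter_upwards [hpos] with p hp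
        apply propext
        change (cons p ∈ E ∧ p.1 ∈ Set.Iic lam ∧ p.2 ∈ Set.univ) ↔
          (p.1 ∈ (if true ∈ t 0 then Set.Iic lam else ∅) ∧ p.2 ∈ E')
        rw [hmem]
        by_cases hl : p.1 ≤ lam
        · obtain ⟨hb1, hb2⟩ := stepBit_cons_of_le hp hl p.2
          simp only [Prod.mk.eta] at hb1 hb2
          simp only [hb1, hb2, hE', Set.mem_ofPred_eq]
          split_ifs with h0 <;> simp [h0, hl]
        · split_ifs with h0 <;> simp [hl]
      rw [measure_congr this, Measure.prod_prod]
      split_ifs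
      · rw [expMeasure_Iic hlam.le]
      · simp
    have h2 : (expMeasure 1).prod waitingMeasure (cons ⁻¹' E \ A) =
        (if false ∈ t 0 then ENNReal.ofReal (Real.exp (-lam)) else 0) * waitingMeasure E' := by
      have hset : cons ⁻¹' E \ A = if false ∈ t 0 then
          (Prod.map (fun x => x - lam) id ⁻¹' (cons ⁻¹' E')) ∩ (Set.Ioi lam ×ˢ Set.univ) else ∅ := by
        ext p
        simp only [Set.mem_sdiff, Set.mem_preimage, hmem, hA, Set.mem_prod, Set.mem_Iic,
          Set.mem_univ, and_true, not_le]
        by_cases hl : lam < p.1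
        · obtain ⟨hb1, hb2⟩ := stepBit_cons_of_lt hlam hl p.2
          simp only [Prod.mk.eta] at hb1 hb2
          simp only [hb1, hb2, hE']
          split_ifs with h0 <;> simp [h0, hl, Prod.map]
        · split_ifs with h0 <;> simp [hl]
      rw [hset]
      split_ifs with h0
      · have hsub : Measurable fun x : ℝ => x - lam := measurable_id.sub_const lam
        have hm : Measurable (Prod.map (fun x : ℝ => x - lam) (id : (ℕ → ℝ) → (ℕ → ℝ))) :=
          hsub.prodMap measurable_id
        rw [← Measure.restrict_apply (hm (measurable_cons hE'm)), ← Measure.prod_restrict,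
          Measure.restrict_univ, ← Measure.map_apply hm (measurable_cons hE'm),
          ← Measure.map_prod_map _ _ hsub measurable_id, map_restrict_expMeasure hlam.le,
          Measure.map_id, Measure.prod_smul_left,
          Measure.smul_apply, ← Measure.map_apply measurable_cons hE'm, map_cons_waitingMeasure,
          smul_eq_mul]
      · simp
    rw [h1, h2, ← add_mul, mul_comm]
    congr 1
    unfold bernoulliMass
    congr 3
    rw [sub_sub_cancel]

end ASEP


namespace ASEP

open SixVertex (bernoulliMass BernoulliQueries)

/-! ### Independence of the clocks -/

/-- The waiting times of the clock `κ`. -/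
def waiting (ξ : ℤ × Bool × ℕ → ℝ) (κ : ℤ × Bool) (n : ℕ) : ℝ := ξ (κ.1, κ.2, n)

lemma measurable_waiting (κ : ℤ × Bool) : Measurable fun ξ => waiting ξ κ :=
  measurable_pi_lambda _ fun _ => measurable_pi_apply _

instance : IsProbabilityMeasure clockMeasure := by unfold clockMeasure; infer_instance

lemma map_clockMeasure_of_injective {α : Type*} {f : α → ℤ × Bool × ℕ} (hf : Function.Injective f) :
    clockMeasure.map (fun ξ a => ξ (f a)) = Measure.infinitePi (fun _ => expMeasure 1) := by
  unfold clockMeasure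
  exact Measure.map_infinitePi_infinitePi_of_inj hf

lemma map_clockMeasure_curry {α β : Type*} {f : α × β → ℤ × Bool × ℕ} (hf : Function.Injective f) :
    clockMeasure.map (fun ξ a b => ξ (f (a, b))) =
      Measure.infinitePi (fun _ => Measure.infinitePi (fun _ => expMeasure 1)) := by
  rw [← Measure.infinitePi_map_curry (fun (_ : α) (_ : β) => expMeasure 1),
    ← map_clockMeasure_of_injective hf, Measure.map_map]
  · rfl
  · exact MeasurableEquiv.measurable _
  · exact measurable_pi_lambda _ fun _ => measurable_pi_apply _

lemma map_waiting : clockMeasure.map (fun ξ κ => waiting ξ κ) =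
    Measure.infinitePi (fun _ => waitingMeasure) :=
  map_clockMeasure_curry (f := fun p : (ℤ × Bool) × ℕ => (p.1.1, p.1.2, p.2)) (by
    rintro ⟨⟨a, b⟩, c⟩ ⟨⟨a', b'⟩, c'⟩ h
    simp only [Prod.mk.injEq] at h ⊢
    tauto)

lemma map_waiting_apply (κ : ℤ × Bool) :
    clockMeasure.map (fun ξ => waiting ξ κ) = waitingMeasure := by
  rw [← Measure.infinitePi_map_eval (fun _ : ℤ × Bool => waitingMeasure) κ, ← map_waiting,
    Measure.map_map (measurable_pi_apply κ) (measurable_pi_lambda _ measurable_waiting)]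
  rfl

lemma iIndepFun_waiting : iIndepFun (fun κ ξ => waiting ξ κ) clockMeasure := by
  rw [iIndepFun_iff_map_fun_eq_infinitePi_map measurable_waiting, map_waiting]
  simp only [map_waiting_apply]

lemma waitingMeasure_stepBit_finset {lam : ℝ} (hlam : 0 ≤ lam) (S : Finset ℕ) (t : ℕ → Set Bool) :
    waitingMeasure {ξ | ∀ n ∈ S, stepBit lam ξ (n + 1) ∈ t n} =
      ∏ n ∈ S, bernoulliMass (1 - Real.exp (-lam)) (t n) := by
  classical
  obtain ⟨N, hN⟩ : ∃ N, S ⊆ Finset.range N := ⟨_, Finset.subset_range_sup_succ S⟩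
  have h := waitingMeasure_stepBit hlam N (fun n => if n ∈ S then t n else Set.univ)
  have hset : {ξ | ∀ n < N, stepBit lam ξ (n + 1) ∈ if n ∈ S then t n else Set.univ} =
      {ξ | ∀ n ∈ S, stepBit lam ξ (n + 1) ∈ t n} := by
    ext ξ
    simp only [Set.mem_ofPred_eq]
    constructor
    · intro h n hn
      have := h n (Finset.mem_range.1 (hN hn))
      rwa [if_pos hn] at this
    · intro h n _
      split_ifs with hn
      · exact h n hn
      · trivial
  rw [hset] at h
  rw [h, ← Finset.prod_subset hN]
  · exact Finset.prod_congr rfl fun n hn => by rw [if_pos hn]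
  · intro n _ hn
    rw [if_neg hn]
    simp only [bernoulliMass, Set.mem_univ, if_true]
    rw [← ENNReal.ofReal_add (by simpa using hlam) (by rw [sub_sub_cancel]; positivity)]
    simp

lemma clockMeasure_stepBit_mem {lam : ℝ} (hlam : 0 ≤ lam) (κ : ℤ × Bool) (n : ℕ) (t : Set Bool) :
    clockMeasure {ξ | stepBit lam (waiting ξ κ) (n + 1) ∈ t} =
      bernoulliMass (1 - Real.exp (-lam)) t := by
  have h := waitingMeasure_stepBit_finset hlam {n} (fun _ => t)
  simp only [Finset.mem_singleton, forall_eq, Finset.prod_singleton] at h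
  rw [← map_waiting_apply κ, Measure.map_apply (measurable_waiting κ)] at h
  · exact h
  · exact measurable_stepBit lam (n + 1) (Set.toFinite t).measurableSet

/-- The bits of all the clocks are independent. -/
lemma iIndepFun_stepBit {lam : ℤ × Bool → ℝ} (hlam : ∀ κ, 0 ≤ lam κ) :
    iIndepFun (fun (p : (ℤ × Bool) × ℕ) ξ => stepBit (lam p.1) (waiting ξ p.1) (p.2 + 1))
      clockMeasure := by
  refine iIndepFun_uncurry' (X := fun κ n ξ => stepBit (lam κ) (waiting ξ κ) (n + 1))
    (fun κ n => (measurable_stepBit _ _).comp (measurable_waiting κ)) ?_ ?_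
  · exact iIndepFun_waiting.comp (fun κ ξ n => stepBit (lam κ) ξ (n + 1))
      fun κ => measurable_pi_lambda _ fun n => measurable_stepBit _ _
  · intro κ
    rw [iIndepFun_iff_measure_inter_preimage_eq_mul]
    intro S sets _
    have h := waitingMeasure_stepBit_finset (hlam κ) S sets
    rw [← map_waiting_apply κ, Measure.map_apply (measurable_waiting κ)] at h
    · have h1 : (⋂ n ∈ S, (fun ξ => stepBit (lam κ) (waiting ξ κ) (n + 1)) ⁻¹' sets n) =
          (fun ξ => waiting ξ κ) ⁻¹' {ξ | ∀ n ∈ S, stepBit (lam κ) ξ (n + 1) ∈ sets n} := by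
        ext ξ; simp
      rw [h1, h]
      exact Finset.prod_congr rfl fun n _ => (clockMeasure_stepBit_mem (hlam κ) κ n (sets n)).symm
    · have h1 : {ξ | ∀ n ∈ S, stepBit (lam κ) ξ (n + 1) ∈ sets n} =
          ⋂ n ∈ S, (fun ξ => stepBit (lam κ) ξ (n + 1)) ⁻¹' sets n := by
        ext ξ; simp
      rw [h1]
      exact Finset.measurableSet_biInter _ fun n _ =>
        measurable_stepBit _ _ (Set.toFinite (sets n)).measurableSet

/-- The rate of the clock `κ` of the exclusion process. -/
def rate (L R : ℝ) (κ : ℤ × Bool) : ℝ := if κ.2 then R else L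

/-- The step length that makes a clock of a given rate ring in each step with probability `δ`. -/
noncomputable def stepRate (δ : ℝ) : ℝ := -Real.log (1 - δ)

lemma stepRate_nonneg {δ : ℝ} (h0 : 0 ≤ δ) (h1 : δ < 1) : 0 ≤ stepRate δ := by
  unfold stepRate
  rw [neg_nonneg]
  exact Real.log_nonpos (by linarith) (by linarith)

lemma one_sub_exp_neg_stepRate {δ : ℝ} (h1 : δ < 1) : 1 - Real.exp (-stepRate δ) = δ := by
  unfold stepRate
  rw [neg_neg, Real.exp_log (by linarith)]; ring

/-- The bit that decides whether a path entering the vertex `(x, y)` alone from below goes straight: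
the left clock of the site `x - y + 1` rings at step `y`. -/
noncomputable def leftBits (δ₁ : ℝ) (ξ : ℤ × Bool × ℕ → ℝ) (v : ℕ × ℕ) : Bool :=
  stepBit (stepRate δ₁) (waiting ξ ((v.1 : ℤ) - v.2 + 1, false)) v.2

/-- The bit that decides whether a path entering the vertex `(x, y)` alone from the left goes
straight: the right clock of the site `x - y` rings at step `y`. -/
noncomputable def rightBits (δ₂ : ℝ) (ξ : ℤ × Bool × ℕ → ℝ) (v : ℕ × ℕ) : Bool :=
  stepBit (stepRate δ₂) (waiting ξ ((v.1 : ℤ) - v.2, true)) v.2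

lemma measurable_leftBits (δ₁ : ℝ) (v : ℕ × ℕ) : Measurable fun ξ => leftBits δ₁ ξ v :=
  (measurable_stepBit _ _).comp (measurable_waiting _)

lemma measurable_rightBits (δ₂ : ℝ) (v : ℕ × ℕ) : Measurable fun ξ => rightBits δ₂ ξ v :=
  (measurable_stepBit _ _).comp (measurable_waiting _)

/-- The discretized clocks drive the six-vertex model: different vertices inspect different pairs of a
clock and a step, because the vertex `(x, y)` inspects clocks at the diagonal `x - y` at step `y`. -/
lemma bernoulliQueries_clock {δ₁ δ₂ : ℝ} (h₁ : 0 ≤ δ₁) (h₁' : δ₁ < 1) (h₂ : 0 ≤ δ₂) (h₂' : δ₂ < 1) :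
    BernoulliQueries clockMeasure (leftBits δ₁) (rightBits δ₂) δ₁ δ₂ := by
  classical
  intro sel val V hV
  set lam : ℤ × Bool → ℝ := fun κ => if κ.2 then stepRate δ₂ else stepRate δ₁ with hlam
  have hlam0 : ∀ κ, 0 ≤ lam κ := by
    intro κ; simp only [hlam]; split_ifs
    · exact stepRate_nonneg h₂ h₂'
    · exact stepRate_nonneg h₁ h₁'
  -- The clock and the step that are inspected at the vertex `v`.
  let q : V → (ℤ × Bool) × ℕ := fun v =>
    (if sel v then ((v.1.1 : ℤ) - v.1.2 + 1, false) else ((v.1.1 : ℤ) - v.1.2, true), v.1.2 - 1)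
  have hq : Function.Injective q := by
    rintro ⟨⟨x, y⟩, hv⟩ ⟨⟨x', y'⟩, hv'⟩ h
    have h1 := hV _ hv
    have h2 := hV _ hv'
    simp only [q, Prod.mk.injEq] at h h1 h2
    obtain ⟨h3, h4⟩ := h
    have h5 : y = y' := by omega
    subst h5
    have h6 : x = x' := by
      split_ifs at h3 <;> simp only [Prod.mk.injEq, reduceCtorEq, and_false] at h3 <;> omega
    subst h6
    rfl
  have hind := (iIndepFun_stepBit hlam0).precomp hq
  have hmul := hind.measure_inter_preimage_eq_mul Finset.univ (sets := fun v : V => val v)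
    fun v _ => (Set.toFinite _).measurableSet
  have hbit : ∀ (v : V) ξ, stepBit (lam (q v).1) (waiting ξ (q v).1) ((q v).2 + 1) =
      if sel v then leftBits δ₁ ξ v else rightBits δ₂ ξ v := by
    intro v ξ
    have h1 := (hV _ v.2).2
    have h2 : v.1.2 - 1 + 1 = v.1.2 := by omega
    simp only [q, hlam, leftBits, rightBits]
    split_ifs <;> simp_all
  have hset : {ξ | ∀ v ∈ V, (if sel v then leftBits δ₁ ξ v else rightBits δ₂ ξ v) ∈ val v} =
      ⋂ v ∈ (Finset.univ : Finset V), (fun ξ =>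
        stepBit (lam (q v).1) (waiting ξ (q v).1) ((q v).2 + 1)) ⁻¹' val v := by
    ext ξ
    simp only [Set.mem_ofPred_eq, Finset.mem_univ, Set.iInter_true, Set.mem_iInter,
      Set.mem_preimage, hbit, Subtype.forall]
  rw [hset, hmul, ← Finset.prod_coe_sort V]
  refine Finset.prod_congr rfl fun v _ => ?_
  have := clockMeasure_stepBit_mem (hlam0 (q v).1) (q v).1 (q v).2 (val v)
  refine this.trans ?_
  congr 1
  simp only [q, hlam]
  split_ifs <;> simp_all [one_sub_exp_neg_stepRate]

end ASEP

namespace SixVertex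

lemma volume_decide_lt_mem {δ : ℝ} (h0 : 0 ≤ δ) (h1 : δ ≤ 1) (t : Set Bool) :
    volume {u : unitInterval | decide ((u : ℝ) < δ) ∈ t} = bernoulliMass δ t := by
  classical
  set d : unitInterval := ⟨δ, h0, h1⟩
  have hd : ∀ u : unitInterval, (u : ℝ) < δ ↔ u < d := fun u => Iff.rfl
  unfold bernoulliMass
  by_cases ht : true ∈ t <;> by_cases hf : false ∈ t
  · have : {u : unitInterval | decide ((u : ℝ) < δ) ∈ t} = Set.univ := by
      ext u; by_cases h : (u : ℝ) < δ <;> simp [h, ht, hf]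
    rw [this, if_pos ht, if_pos hf, ← ENNReal.ofReal_add h0 (by linarith)]
    simp
  · have : {u : unitInterval | decide ((u : ℝ) < δ) ∈ t} = Set.Iio d := by
      ext u; by_cases h : (u : ℝ) < δ <;> simp [h, ht, hf, ← hd]
    rw [this, if_pos ht, if_neg hf, unitInterval.volume_Iio, add_zero]
  · have : {u : unitInterval | decide ((u : ℝ) < δ) ∈ t} = Set.Ici d := by
      ext u; by_cases h : (u : ℝ) < δ <;> simp [h, ht, hf, ← not_lt, ← hd]
    rw [this, if_neg ht, if_pos hf, unitInterval.volume_Ici, zero_add]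
  · have : {u : unitInterval | decide ((u : ℝ) < δ) ∈ t} = ∅ := by
      ext u; by_cases h : (u : ℝ) < δ <;> simp [h, ht, hf]
    rw [this, if_neg ht, if_neg hf, measure_empty, add_zero]

lemma measurable_decide_lt (δ : ℝ) : Measurable fun u : unitInterval => decide ((u : ℝ) < δ) := by
  refine measurable_to_bool ?_
  have : (fun u : unitInterval => decide ((u : ℝ) < δ)) ⁻¹' {true} =
      {u : unitInterval | (u : ℝ) < δ} := by
    ext u; simp
  rw [this]
  exact measurableSet_lt measurable_subtype_coe measurable_const

/-- The bits of the usual sampling, with one uniform variable at each vertex. -/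
lemma bernoulliQueries_vertex {δ₁ δ₂ : ℝ} (h₁ : 0 ≤ δ₁) (h₁' : δ₁ < 1) (h₂ : 0 ≤ δ₂)
    (h₂' : δ₂ < 1) :
    BernoulliQueries vertexMeasure (fun u v => decide ((u v : ℝ) < δ₁))
      (fun u v => decide ((u v : ℝ) < δ₂)) δ₁ δ₂ := by
  intro sel val V _
  have hset : {u : ℕ × ℕ → unitInterval | ∀ v ∈ V,
      (if sel v then decide ((u v : ℝ) < δ₁) else decide ((u v : ℝ) < δ₂)) ∈ val v} =
      Set.pi V fun v => {u : unitInterval | decide ((u : ℝ) < if sel v then δ₁ else δ₂) ∈ val v} := by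
    ext u
    simp only [Set.mem_ofPred_eq, Set.mem_pi, Finset.mem_coe]
    refine forall₂_congr fun v _ => ?_
    split_ifs <;> rfl
  rw [hset, vertexMeasure, Measure.infinitePi_pi]
  · refine Finset.prod_congr rfl fun v _ => ?_
    rw [volume_decide_lt_mem] <;> split_ifs <;> linarith
  · intro v _
    exact measurable_decide_lt _ (Set.toFinite _).measurableSet

end SixVertex


namespace ASEP

/-! ### Almost sure properties of the clocks -/

lemma ae_infinitely_often_mem {E : Type*} [MeasurableSpace E] {ν : Measure E}
    [IsProbabilityMeasure ν] {A : Set E} (hA : MeasurableSet A) (hνA : ν A ≠ 0) :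
    ∀ᵐ ω ∂(Measure.infinitePi fun _ : ℕ => ν), ∀ M : ℕ, ∃ n ≥ M, ω n ∈ A := by
  rw [ae_all_iff]
  intro M
  rw [ae_iff]
  have hlt : ν Aᶜ < 1 := by
    rw [prob_compl_eq_one_sub hA]
    exact ENNReal.sub_lt_self ENNReal.one_ne_top one_ne_zero hνA
  have hle : ∀ N : ℕ, (Measure.infinitePi fun _ : ℕ => ν) {ω | ¬ ∃ n ≥ M, ω n ∈ A} ≤ ν Aᶜ ^ N := by
    intro N
    calc _ ≤ (Measure.infinitePi fun _ : ℕ => ν) (Set.pi (Finset.Ico M (M + N)) fun _ => Aᶜ) := by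
          refine measure_mono fun ω hω n hn h => hω ⟨n, ?_, h⟩
          exact (Finset.mem_Ico.1 hn).1
      _ = ν Aᶜ ^ N := by
          rw [Measure.infinitePi_pi _ fun _ _ => hA.compl]
          simp
  exact le_antisymm (ge_of_tendsto' (ENNReal.tendsto_pow_atTop_nhds_zero_of_lt_one hlt) hle) zero_le

lemma expMeasure_singleton (a : ℝ) : expMeasure 1 {a} = 0 := by
  have h : expMeasure 1 ≪ volume := by
    unfold expMeasure gammaMeasure
    exact withDensity_absolutelyContinuous _ _
  exact h (by simp)

lemma measurable_update_snd_fst (i : ℤ × Bool × ℕ) :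
    Measurable fun p : ℝ × (ℤ × Bool × ℕ → ℝ) => Function.update p.2 i p.1 := by
  refine measurable_pi_lambda _ fun j => ?_
  by_cases h : j = i
  · subst h; simpa using measurable_fst
  · simp only [Function.update_of_ne h]
    fun_prop

/-- Replacing one waiting time by an independent copy does not change the law. -/
lemma map_update_clockMeasure (i : ℤ × Bool × ℕ) :
    ((expMeasure 1).prod clockMeasure).map (fun p => Function.update p.2 i p.1) = clockMeasure := by
  classical
  have hm := measurable_update_snd_fst i
  unfold clockMeasure
  refine Measure.eq_infinitePi _ fun s t ht => ?_
  have hpre : (fun p : ℝ × (ℤ × Bool × ℕ → ℝ) => Function.update p.2 i p.1) ⁻¹' (Set.pi s t) =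
      (if i ∈ s then t i else Set.univ) ×ˢ Set.pi (s.erase i) t := by
    ext ⟨x, r⟩
    simp only [Set.mem_preimage, Set.mem_pi, Finset.mem_coe, Set.mem_prod, Finset.mem_erase]
    constructor
    · intro h
      refine ⟨?_, fun j hj => ?_⟩
      · split_ifs with h0
        · simpa using h i h0
        · trivial
      · simpa [Function.update_of_ne hj.1] using h j hj.2
    · rintro ⟨h1, h2⟩ j hj
      by_cases hji : j = i
      · subst hji; rw [if_pos hj] at h1; simpa using h1
      · simpa [Function.update_of_ne hji] using h2 j ⟨hji, hj⟩
  rw [Measure.map_apply hm (.pi s.countable_toSet fun _ _ => ht _), hpre,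
    Measure.prod_prod, Measure.infinitePi_pi _ fun i _ => ht _]
  split_ifs with h
  · rw [Finset.mul_prod_erase s (fun j => expMeasure 1 (t j)) h]
  · rw [measure_univ, one_mul, Finset.erase_eq_of_notMem h]

/-- A waiting time almost surely differs from any quantity that does not depend on it. -/
lemma ae_apply_ne (i : ℤ × Bool × ℕ) {h : (ℤ × Bool × ℕ → ℝ) → ℝ} (hm : Measurable h)
    (hi : ∀ ξ x, h (Function.update ξ i x) = h ξ) : ∀ᵐ ξ ∂clockMeasure, ξ i ≠ h ξ := by
  rw [ae_iff]
  have hS : MeasurableSet {ξ | ¬ ξ i ≠ h ξ} := by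
    simp only [not_not]
    exact measurableSet_eq_fun (measurable_pi_apply i) hm
  have hmu := measurable_update_snd_fst i
  rw [← map_update_clockMeasure i, Measure.map_apply hmu hS, Measure.prod_apply_symm (hmu hS)]
  have : ∀ ξ : ℤ × Bool × ℕ → ℝ, (fun x : ℝ => (x, ξ)) ⁻¹'
      ((fun p : ℝ × (ℤ × Bool × ℕ → ℝ) => Function.update p.2 i p.1) ⁻¹' {ξ | ¬ ξ i ≠ h ξ}) =
      {h ξ} := by
    intro ξ; ext x; simp [hi]
  simp only [this, expMeasure_singleton, lintegral_zero]

/-- The time of the `m`-th ring of the clock `κ`, if its rate is positive. -/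
noncomputable def ringTime (L R : ℝ) (ξ : ℤ × Bool × ℕ → ℝ) (κ : ℤ × Bool) (m : ℕ) : ℝ :=
  (∑ j ∈ Finset.range (m + 1), waiting ξ κ j) / rate L R κ

/-- The properties of the clocks, almost surely true, on which the comparison rests: the rings are
locally finite, at distinct times and not at the times `t r`, and far to the left and to the right
there are bonds at which nothing rings for a long time. -/
structure GoodClocks (L R : ℝ) {k : ℕ} (t : Fin k → ℝ) (ξ : ℤ × Bool × ℕ → ℝ) : Prop where
  pos : ∀ i, 0 < ξ i
  large : ∀ κ, ∀ M : ℕ, ∃ n ≥ M, 1 ≤ waiting ξ κ n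
  silent_right : ∀ C M : ℕ, ∃ d : ℕ, d ≥ M ∧ ∀ β : Bool,
    (C : ℝ) < ξ (if β then (d, true, 0) else (d + 1, false, 0))
  silent_left : ∀ C M : ℕ, ∃ d : ℕ, d ≥ M ∧ ∀ β : Bool,
    (C : ℝ) < ξ (if β then (-d, true, 0) else (-d + 1, false, 0))
  ringTime_ne : ∀ κ κ', κ ≠ κ' → 0 < rate L R κ → 0 < rate L R κ' → ∀ m m',
    ringTime L R ξ κ m ≠ ringTime L R ξ κ' m'
  ringTime_ne_time : ∀ κ, 0 < rate L R κ → ∀ m r, ringTime L R ξ κ m ≠ t r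

lemma ae_goodClocks (L R : ℝ) {k : ℕ} (t : Fin k → ℝ) :
    ∀ᵐ ξ ∂clockMeasure, GoodClocks L R t ξ := by
  have hpos : ∀ᵐ ξ ∂clockMeasure, ∀ i, 0 < ξ i := by
    rw [ae_all_iff]
    intro i
    have h1 : ∀ᵐ x ∂(expMeasure 1), 0 < x := by
      rw [ae_iff]; simpa [Set.Iic] using expMeasure_Iic_zero
    have h2 : clockMeasure.map (fun ξ => ξ i) = expMeasure 1 := Measure.infinitePi_map_eval _ i
    rw [← h2] at h1
    exact ae_of_ae_map (measurable_pi_apply i).aemeasurable h1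
  have hlarge : ∀ᵐ ξ ∂clockMeasure, ∀ κ, ∀ M : ℕ, ∃ n ≥ M, 1 ≤ waiting ξ κ n := by
    rw [ae_all_iff]
    intro κ
    have h1 : ∀ᵐ x ∂waitingMeasure, ∀ M : ℕ, ∃ n ≥ M, x n ∈ Set.Ioi 1 := by
      refine ae_infinitely_often_mem measurableSet_Ioi ?_
      rw [expMeasure_Ioi zero_le_one]
      simp [Real.exp_pos]
    rw [← map_waiting_apply κ] at h1
    filter_upwards [ae_of_ae_map (measurable_waiting κ).aemeasurable h1] with ξ hξ M
    obtain ⟨n, hn, h⟩ := hξ M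
    exact ⟨n, hn, le_of_lt h⟩
  have hsilent : ∀ f : ℕ × Bool → ℤ × Bool × ℕ, Function.Injective f →
      ∀ᵐ ξ ∂clockMeasure, ∀ C M : ℕ, ∃ d : ℕ, d ≥ M ∧ ∀ β : Bool, (C : ℝ) < ξ (f (d, β)) := by
    intro f hf
    rw [ae_all_iff]
    intro C
    have h1 : ∀ᵐ w ∂(Measure.infinitePi fun _ : ℕ => Measure.infinitePi fun _ : Bool =>
        expMeasure 1), ∀ M : ℕ, ∃ n ≥ M, w n ∈ Set.pi (Finset.univ : Finset Bool)
          fun _ => Set.Ioi (C : ℝ) := by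
      refine ae_infinitely_often_mem
        (.pi (Finset.countable_toSet _) fun _ _ => measurableSet_Ioi) ?_
      rw [Measure.infinitePi_pi _ fun _ _ => measurableSet_Ioi, expMeasure_Ioi (Nat.cast_nonneg C)]
      simp [Real.exp_pos]
    rw [← map_clockMeasure_curry hf] at h1
    have hm : Measurable fun (ξ : ℤ × Bool × ℕ → ℝ) (a : ℕ) (b : Bool) => ξ (f (a, b)) :=
      measurable_pi_lambda _ fun _ => measurable_pi_lambda _ fun _ => measurable_pi_apply _
    filter_upwards [ae_of_ae_map hm.aemeasurable h1] with ξ hξ M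
    obtain ⟨n, hn, h⟩ := hξ M
    exact ⟨n, hn, fun β => h β (by simp)⟩
  have hright := hsilent (fun p => if p.2 then (p.1, true, 0) else (p.1 + 1, false, 0)) (by
    rintro ⟨a, β⟩ ⟨a', β'⟩ h
    cases β <;> cases β' <;> simp at h ⊢ <;> omega)
  have hleft := hsilent (fun p => if p.2 then (-p.1, true, 0) else (-p.1 + 1, false, 0)) (by
    rintro ⟨a, β⟩ ⟨a', β'⟩ h
    cases β <;> cases β' <;> simp at h ⊢ <;> omega)
  have hmw : ∀ κ n, Measurable fun ξ => waiting ξ κ n := fun κ n => measurable_pi_apply _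
  have hsplit : ∀ ξ κ m, ∑ j ∈ Finset.range (m + 1), waiting ξ κ j =
      ξ (κ.1, κ.2, 0) + ∑ j ∈ Finset.range m, waiting ξ κ (j + 1) := by
    intro ξ κ m
    rw [Finset.sum_range_succ', add_comm]; rfl
  have hupd : ∀ ξ (κ : ℤ × Bool) x j,
      waiting (Function.update ξ (κ.1, κ.2, 0) x) κ (j + 1) = waiting ξ κ (j + 1) := by
    intro ξ κ x j
    simp [waiting]
  have hupd' : ∀ ξ (κ κ' : ℤ × Bool) x j, κ ≠ κ' →
      waiting (Function.update ξ (κ.1, κ.2, 0) x) κ' j = waiting ξ κ' j := by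
    rintro ξ ⟨a, b⟩ ⟨a', b'⟩ x j hne
    unfold waiting
    rw [Function.update_of_ne]
    intro h
    simp only [Prod.mk.injEq] at h
    exact hne (by rw [h.1, h.2.1])
  have hne : ∀ᵐ ξ ∂clockMeasure, ∀ κ κ', κ ≠ κ' → 0 < rate L R κ → 0 < rate L R κ' → ∀ m m',
      ringTime L R ξ κ m ≠ ringTime L R ξ κ' m' := by
    simp only [ae_all_iff]
    intro κ κ' hκ hr _ m m'
    have := ae_apply_ne (κ.1, κ.2, 0) (h := fun ξ => ringTime L R ξ κ' m' * rate L R κ -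
      ∑ j ∈ Finset.range m, waiting ξ κ (j + 1)) (by
        unfold ringTime
        exact (((Finset.measurable_sum _ fun j _ => hmw κ' j).div_const _).mul_const _).sub
          (Finset.measurable_sum _ fun j _ => hmw κ (j + 1))) (by
        intro ξ x
        simp only [ringTime, hupd, hupd' _ _ _ _ _ hκ])
    filter_upwards [this] with ξ hξ h
    apply hξ
    rw [← h, ringTime, div_mul_cancel₀ _ hr.ne', hsplit]
    ring
  have hnt : ∀ᵐ ξ ∂clockMeasure, ∀ κ, 0 < rate L R κ → ∀ m r, ringTime L R ξ κ m ≠ t r := by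
    simp only [ae_all_iff]
    intro κ hr m r
    have := ae_apply_ne (κ.1, κ.2, 0) (h := fun ξ => t r * rate L R κ -
      ∑ j ∈ Finset.range m, waiting ξ κ (j + 1)) (by
        exact measurable_const.sub (Finset.measurable_sum _ fun j _ => hmw κ (j + 1))) (by
        intro ξ x
        simp only [hupd])
    filter_upwards [this] with ξ hξ h
    apply hξ
    rw [← h, ringTime, div_mul_cancel₀ _ hr.ne', hsplit]
    ring
  filter_upwards [hpos, hlarge, hright, hleft, hne, hnt] with ξ h1 h2 h3 h4 h5 h6
  exact ⟨h1, h2, h3, h4, h5, h6⟩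

end ASEP


namespace ASEP

/-! ### The time graph of good clocks -/

variable {L R : ℝ} {k : ℕ} {t : Fin k → ℝ} {ξ : ℤ × Bool × ℕ → ℝ}

lemma rate_nonneg (hL : 0 ≤ L) (hR : 0 ≤ R) (κ : ℤ × Bool) : 0 ≤ rate L R κ := by
  unfold rate; split_ifs <;> assumption

lemma GoodClocks.waiting_pos (h : GoodClocks L R t ξ) (κ : ℤ × Bool) (n : ℕ) :
    0 < waiting ξ κ n := h.pos _

lemma GoodClocks.sum_waiting_pos (h : GoodClocks L R t ξ) (κ : ℤ × Bool) (m : ℕ) :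
    0 < ∑ j ∈ Finset.range (m + 1), waiting ξ κ j :=
  Finset.sum_pos (fun j _ => h.waiting_pos κ j) ⟨0, by simp⟩

lemma GoodClocks.ringTime_pos (h : GoodClocks L R t ξ) {κ : ℤ × Bool} (hκ : 0 < rate L R κ)
    (m : ℕ) : 0 < ringTime L R ξ κ m :=
  div_pos (h.sum_waiting_pos κ m) hκ

lemma GoodClocks.ringTime_strictMono (h : GoodClocks L R t ξ) {κ : ℤ × Bool}
    (hκ : 0 < rate L R κ) : StrictMono (ringTime L R ξ κ) := by
  refine strictMono_nat_of_lt_succ fun m => ?_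
  unfold ringTime
  rw [Finset.sum_range_succ _ (m + 1)]
  exact div_lt_div_of_pos_right (lt_add_of_pos_right _ (h.waiting_pos κ _)) hκ

lemma GoodClocks.exists_lt_ringTime (h : GoodClocks L R t ξ) {κ : ℤ × Bool}
    (hκ : 0 < rate L R κ) (T : ℝ) : ∃ m, T < ringTime L R ξ κ m := by
  have hsum : ∀ C : ℕ, ∃ m, (C : ℝ) ≤ ∑ j ∈ Finset.range (m + 1), waiting ξ κ j := by
    intro C
    induction C with
    | zero => exact ⟨0, by exact_mod_cast (h.sum_waiting_pos κ 0).le⟩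
    | succ C ih =>
      obtain ⟨m, hm⟩ := ih
      obtain ⟨n, hn, hn1⟩ := h.large κ (m + 1)
      refine ⟨n, ?_⟩
      rw [Finset.sum_range_succ]
      have : ∑ j ∈ Finset.range (m + 1), waiting ξ κ j ≤ ∑ j ∈ Finset.range n, waiting ξ κ j :=
        Finset.sum_le_sum_of_subset_of_nonneg (Finset.range_mono hn)
          fun j _ _ => (h.waiting_pos κ j).le
      push_cast
      linarith
  obtain ⟨C, hC⟩ := exists_nat_gt (T * rate L R κ)
  obtain ⟨m, hm⟩ := hsum C
  exact ⟨m, (lt_div_iff₀ hκ).2 (hC.trans_le hm)⟩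

lemma GoodClocks.finite_ringTime_le (h : GoodClocks L R t ξ) {κ : ℤ × Bool}
    (hκ : 0 < rate L R κ) (T : ℝ) : {m | ringTime L R ξ κ m ≤ T}.Finite := by
  obtain ⟨m₀, hm₀⟩ := h.exists_lt_ringTime hκ T
  refine (Set.finite_lt_nat m₀).subset fun m hm => ?_
  exact (h.ringTime_strictMono hκ).lt_iff_lt.1 (lt_of_le_of_lt hm hm₀)

/-- The instructions are the rings of the clocks with positive rate. -/
lemma GoodClocks.mem_timeGraph_iff (h : GoodClocks L R t ξ) (hL : 0 ≤ L) (hR : 0 ≤ R) {s : ℝ}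
    {x j : ℤ} : (s, x, j) ∈ timeGraph L R ξ ↔
      ∃ κ m, 0 < rate L R κ ∧ κ.1 = x ∧ target κ = j ∧ ringTime L R ξ κ m = s := by
  have key : ∀ κ : ℤ × Bool, s ∈ ringTimes (rate L R κ) (waiting ξ κ) ↔
      ∃ m, 0 < rate L R κ ∧ ringTime L R ξ κ m = s := by
    intro κ
    constructor
    · rintro ⟨hs, m, hm⟩
      have hr : 0 < rate L R κ := by
        rcases (rate_nonneg hL hR κ).eq_or_lt with h0 | h0
        · rw [← h0, zero_mul] at hm
          exact absurd hm (h.sum_waiting_pos κ m).ne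
        · exact h0
      refine ⟨m, hr, ?_⟩
      rw [ringTime, ← hm, mul_div_cancel_left₀ _ hr.ne']
    · rintro ⟨m, hr, rfl⟩
      refine ⟨h.ringTime_pos hr m, m, ?_⟩
      rw [ringTime, mul_div_cancel₀ _ hr.ne']
  constructor
  · rintro (⟨h1, h2⟩ | ⟨h1, h2⟩)
    · obtain ⟨m, hr, hm⟩ := (key (x, true)).1 h1
      exact ⟨(x, true), m, hr, rfl, by simpa [target] using h2.symm, hm⟩
    · obtain ⟨m, hr, hm⟩ := (key (x, false)).1 h1
      exact ⟨(x, false), m, hr, rfl, by simpa [target] using h2.symm, hm⟩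
  · rintro ⟨⟨x', β⟩, m, hr, hx, hj, hm⟩
    obtain rfl : x' = x := hx
    have h1 := (key (x', β)).2 ⟨m, hr, hm⟩
    cases β with
    | true => exact Or.inl ⟨h1, by simpa [target] using hj.symm⟩
    | false => exact Or.inr ⟨h1, by simpa [target] using hj.symm⟩

lemma nearestNeighbour_timeGraph (L R : ℝ) (ξ : ℤ × Bool × ℕ → ℝ) :
    NearestNeighbour (timeGraph L R ξ) := by
  rintro s x j (⟨-, h⟩ | ⟨-, h⟩)
  · exact Or.inl h
  · exact Or.inr h

lemma GoodClocks.noSimultaneous (h : GoodClocks L R t ξ) (hL : 0 ≤ L) (hR : 0 ≤ R) :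
    NoSimultaneous (timeGraph L R ξ) := by
  rintro s ⟨x, j⟩ ⟨x', j'⟩ _ hg hg'
  obtain ⟨κ, m, hr, rfl, rfl, hm⟩ := (h.mem_timeGraph_iff hL hR).1 hg
  obtain ⟨κ', m', hr', rfl, rfl, hm'⟩ := (h.mem_timeGraph_iff hL hR).1 hg'
  by_cases hκ : κ = κ'
  · rw [hκ]
  · exact absurd (hm.trans hm'.symm) (h.ringTime_ne κ κ' hκ hr hr' m m')

lemma finite_bond_mem_Icc (lo hi : ℤ) : {κ : ℤ × Bool | bond κ ∈ Set.Icc lo hi}.Finite := by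
  refine ((Set.finite_Icc lo (hi + 1)).prod (Set.finite_univ (α := Bool))).subset ?_
  rintro ⟨x, β⟩ hκ
  refine ⟨?_, trivial⟩
  cases β <;> simp [bond] at hκ ⊢ <;> omega

lemma GoodClocks.finite_times (h : GoodClocks L R t ξ) (hL : 0 ≤ L) (hR : 0 ≤ R) (N : ℕ) :
    {s : ℝ | 0 < s ∧ s ≤ N ∧
      ∃ x j : ℤ, |x| ≤ N ∧ |j| ≤ N ∧ (s, x, j) ∈ timeGraph L R ξ}.Finite := by
  have hfin : (⋃ κ ∈ {κ : ℤ × Bool | bond κ ∈ Set.Icc (-N - 1 : ℤ) N ∧ 0 < rate L R κ},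
      ringTime L R ξ κ '' {m | ringTime L R ξ κ m ≤ N}).Finite :=
    ((finite_bond_mem_Icc _ _).subset fun κ hκ => hκ.1).biUnion fun κ hκ =>
      (h.finite_ringTime_le hκ.2 N).image _
  refine hfin.subset ?_
  rintro s ⟨_, hsN, x, j, hx, _, hg⟩
  obtain ⟨κ, m, hr, rfl, rfl, hm⟩ := (h.mem_timeGraph_iff hL hR).1 hg
  rw [abs_le] at hx
  simp only [Set.mem_iUnion]
  refine ⟨κ, ⟨?_, hr⟩, m, ?_, hm⟩
  · unfold bond
    rw [Set.mem_Icc]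
    split_ifs <;> omega
  · simpa [hm] using hsN

/-- Boxes bounded by two bonds across which nothing is told to jump up to time `T`. -/
lemma GoodClocks.exists_sealed (h : GoodClocks L R t ξ) (hL : 0 ≤ L) (hR : 0 ≤ R) (T : ℝ) (M : ℤ) :
    ∃ lo hi, lo < -M ∧ M < hi ∧ Sealed (timeGraph L R ξ) T lo hi := by
  obtain ⟨C, hC⟩ := exists_nat_ge (max (R * T) (L * T))
  obtain ⟨d₁, hd₁, hs₁⟩ := h.silent_right C (M.natAbs + 1)
  obtain ⟨d₂, hd₂, hs₂⟩ := h.silent_left C (M.natAbs + 1)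
  refine ⟨-d₂, d₁, by omega, by omega, ?_⟩
  intro s x j _ hsT hg
  obtain ⟨⟨x, β⟩, m, hr, rfl, rfl, hm⟩ := (h.mem_timeGraph_iff hL hR).1 hg
  -- A clock whose first waiting time exceeds `C` does not ring up to time `T`.
  have hlong : ¬ (C : ℝ) < ξ (x, β, 0) := by
    intro hc
    have h1 : ringTime L R ξ (x, β) 0 ≤ T :=
      ((h.ringTime_strictMono hr).monotone (Nat.zero_le m)).trans (hm ▸ hsT)
    rw [ringTime, div_le_iff₀ hr, Finset.sum_range_one] at h1
    have h2 : T * rate L R (x, β) ≤ C := by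
      refine le_trans ?_ hC
      rw [mul_comm]
      cases β
      · exact le_max_right _ _
      · exact le_max_left _ _
    have h3 : waiting ξ (x, β) 0 = ξ (x, β, 0) := rfl
    linarith
  cases β with
  | true =>
    have h1 : x ≠ d₁ := by rintro rfl; exact hlong (hs₁ true)
    have h2 : x ≠ -d₂ := by rintro rfl; exact hlong (hs₂ true)
    simp only [target, if_true, Set.mem_Ioc]
    omega
  | false =>
    have h1 : x ≠ d₁ + 1 := by rintro rfl; exact hlong (hs₁ false)
    have h2 : x ≠ -d₂ + 1 := by rintro rfl; exact hlong (hs₂ false)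
    simp only [target, Bool.false_eq_true, if_false, Set.mem_Ioc]
    omega

lemma GoodClocks.exists_isTrajectory (h : GoodClocks L R t ξ) (hL : 0 ≤ L) (hR : 0 ≤ R)
    (η : ℤ → Bool) : ∃ X, IsTrajectory (timeGraph L R ξ) η X :=
  ASEP.exists_isTrajectory η (h.noSimultaneous hL hR) (h.finite_times hL hR)
    (h.exists_sealed hL hR)

/-! ### Convergence of the discretized ring times -/

lemma tendsto_stepRate_div (r : ℝ) :
    Tendsto (fun ε : ℝ => stepRate (ε * r) / ε) (𝓝[>] 0) (𝓝 r) := by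
  have h1 : HasDerivAt (fun ε : ℝ => stepRate (ε * r)) r 0 := by
    unfold stepRate
    have h2 : HasDerivAt (fun ε : ℝ => 1 - ε * r) (-(1 * r)) 0 :=
      ((hasDerivAt_id (0 : ℝ)).mul_const r).const_sub 1
    have h3 : HasDerivAt (fun ε : ℝ => -Real.log (1 - ε * r)) (-(-(1 * r) / (1 - 0 * r))) 0 :=
      (h2.log (by simp)).neg
    simpa using h3
  refine h1.tendsto_slope_zero_right.congr' ?_
  filter_upwards [self_mem_nhdsWithin] with ε _
  simp [stepRate, div_eq_inv_mul]

lemma eventually_stepRate_pos {r : ℝ} (hr : 0 < r) : ∀ᶠ ε : ℝ in 𝓝[>] 0, 0 < stepRate (ε * r) := by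
  filter_upwards [(tendsto_stepRate_div r).eventually (lt_mem_nhds hr), self_mem_nhdsWithin]
    with ε h1 h2
  exact (div_pos_iff_of_pos_right h2).1 h1

lemma tendsto_mul_ceil {r w : ℝ} (hr : 0 < r) (hw : 0 < w) :
    Tendsto (fun ε : ℝ => ε * ⌈w / stepRate (ε * r)⌉₊) (𝓝[>] 0) (𝓝 (w / r)) := by
  have hid : Tendsto (fun ε : ℝ => ε) (𝓝[>] 0) (𝓝 0) := nhdsWithin_le_nhds
  have hlow : Tendsto (fun ε : ℝ => w / (stepRate (ε * r) / ε)) (𝓝[>] 0) (𝓝 (w / r)) :=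
    tendsto_const_nhds.div (tendsto_stepRate_div r) hr.ne'
  have hup : Tendsto (fun ε : ℝ => w / (stepRate (ε * r) / ε) + ε) (𝓝[>] 0) (𝓝 (w / r)) := by
    simpa using hlow.add hid
  have heq : ∀ ε : ℝ, w / (stepRate (ε * r) / ε) = ε * (w / stepRate (ε * r)) := by
    intro ε
    rw [div_div_eq_mul_div, mul_comm w, mul_div_assoc]
  refine tendsto_of_tendsto_of_tendsto_of_le_of_le' hlow hup ?_ ?_
  · filter_upwards [self_mem_nhdsWithin] with ε hε
    rw [heq]
    exact mul_le_mul_of_nonneg_left (Nat.le_ceil _) (le_of_lt hε)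
  · filter_upwards [self_mem_nhdsWithin, eventually_stepRate_pos hr] with ε hε hs
    have := (Nat.ceil_lt_add_one (div_pos hw hs).le).le
    have h2 := mul_le_mul_of_nonneg_left this (le_of_lt hε)
    rw [heq]
    linarith

/-- The step at which the clock `κ` rings for the `m`-th time in the discretization. -/
noncomputable def ringStep (L R : ℝ) (ξ : ℤ × Bool × ℕ → ℝ) (ε : ℝ) (κ : ℤ × Bool) (m : ℕ) : ℕ :=
  ∑ j ∈ Finset.range (m + 1), ⌈waiting ξ κ j / stepRate (ε * rate L R κ)⌉₊

lemma ringStep_mono (L R : ℝ) (ξ : ℤ × Bool × ℕ → ℝ) (ε : ℝ) (κ : ℤ × Bool) :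
    Monotone (ringStep L R ξ ε κ) := fun _ _ h =>
  Finset.sum_le_sum_of_subset (Finset.range_mono (Nat.succ_le_succ h))

lemma GoodClocks.tendsto_mul_ringStep (h : GoodClocks L R t ξ) {κ : ℤ × Bool}
    (hκ : 0 < rate L R κ) (m : ℕ) :
    Tendsto (fun ε : ℝ => ε * ringStep L R ξ ε κ m) (𝓝[>] 0) (𝓝 (ringTime L R ξ κ m)) := by
  unfold ringStep ringTime
  simp only [Nat.cast_sum, Finset.mul_sum, Finset.sum_div]
  exact tendsto_finsetSum _ fun j _ => tendsto_mul_ceil hκ (h.waiting_pos κ j)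

/-- For small `ε`, the clock `κ` has rung the same number of times up to the time `t r` as up to the
corresponding step. -/
lemma GoodClocks.eventually_ringTime_le_iff (h : GoodClocks L R t ξ) (ht : ∀ r, 0 < t r)
    {κ : ℤ × Bool} (hκ : 0 < rate L R κ) (r : Fin k) :
    ∀ᶠ ε : ℝ in 𝓝[>] 0, ∀ m, ringTime L R ξ κ m ≤ t r ↔ ringStep L R ξ ε κ m ≤ ⌊ε⁻¹ * t r⌋₊ := by
  obtain ⟨m₀, hm₀⟩ := h.exists_lt_ringTime hκ (t r)
  have hone : ∀ m, ∀ᶠ ε : ℝ in 𝓝[>] 0,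
      ringTime L R ξ κ m ≤ t r ↔ ringStep L R ξ ε κ m ≤ ⌊ε⁻¹ * t r⌋₊ := by
    intro m
    rcases lt_or_gt_of_ne (h.ringTime_ne_time κ hκ m r) with hlt | hgt
    · filter_upwards [(h.tendsto_mul_ringStep hκ m).eventually (gt_mem_nhds hlt),
        self_mem_nhdsWithin] with ε h1 (h2 : 0 < ε)
      refine iff_of_true hlt.le (Nat.le_floor ?_)
      rw [← div_eq_inv_mul, le_div_iff₀ h2, mul_comm]
      exact h1.le
    · filter_upwards [(h.tendsto_mul_ringStep hκ m).eventually (lt_mem_nhds hgt),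
        self_mem_nhdsWithin] with ε h1 (h2 : 0 < ε)
      refine iff_of_false (not_le.2 hgt) (not_le.2 ?_)
      rw [Nat.floor_lt (mul_pos (inv_pos.2 h2) (ht r)).le, ← div_eq_inv_mul, div_lt_iff₀ h2,
        mul_comm]
      exact h1
  filter_upwards [(Filter.eventually_all_finite (Set.finite_le_nat m₀)).2 fun m _ => hone m]
    with ε hε m
  rcases le_or_gt m m₀ with hm | hm
  · exact hε m hm
  · have h1 := (hε m₀ (le_refl m₀)).not.1 (not_le.2 hm₀)
    refine iff_of_false (not_le.2 (hm₀.trans (h.ringTime_strictMono hκ hm))) ?_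
    exact fun h2 => h1 ((ringStep_mono L R ξ ε κ hm.le).trans h2)

/-- For small `ε` no clock rings during the first `M` steps. In particular the step at which a clock on
a diagonal `d < 0` first rings is late enough for that diagonal to have been reached by the
quadrant. -/
lemma GoodClocks.eventually_le_ringStep (h : GoodClocks L R t ξ) {κ : ℤ × Bool}
    (hκ : 0 < rate L R κ) (M : ℕ) : ∀ᶠ ε : ℝ in 𝓝[>] 0, ∀ m, M < ringStep L R ξ ε κ m := by
  have hid : Tendsto (fun ε : ℝ => ε * M) (𝓝[>] 0) (𝓝 0) := by
    have : Tendsto (fun ε : ℝ => ε * M) (𝓝 0) (𝓝 (0 * M)) := tendsto_id.mul_const _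
    rw [zero_mul] at this
    exact this.mono_left nhdsWithin_le_nhds
  filter_upwards [hid.eventually_lt (h.tendsto_mul_ringStep hκ 0) (h.ringTime_pos hκ 0),
    self_mem_nhdsWithin] with ε h1 (h2 : 0 < ε) m
  have h3 : (M : ℝ) < ringStep L R ξ ε κ 0 := lt_of_mul_lt_mul_left h1 h2.le
  exact lt_of_lt_of_le (by exact_mod_cast h3) (ringStep_mono L R ξ ε κ (Nat.zero_le m))

/-- The rings, of clocks with positive rate, across the bonds from `lo` to `hi`. -/
def BoxRing (L R : ℝ) (lo hi : ℤ) : Type :=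
  {e : (ℤ × Bool) × ℕ // 0 < rate L R e.1 ∧ bond e.1 ∈ Set.Icc lo hi}

/-- A clock of rate zero has step length zero; since `x / 0 = 0`, its discretization never rings at a
positive step. -/
lemma stepRate_zero : stepRate 0 = 0 := by simp [stepRate]

lemma exists_boxRing_iff_stepBit (hL : 0 ≤ L) (hR : 0 ≤ R) {lo hi : ℤ} {ε : ℝ} {κ : ℤ × Bool}
    (hb : bond κ ∈ Set.Icc lo hi) (n : ℕ) :
    stepBit (stepRate (ε * rate L R κ)) (waiting ξ κ) (n + 1) = true ↔
      ∃ e : BoxRing L R lo hi, e.1.1 = κ ∧ ringStep L R ξ ε e.1.1 e.1.2 = n + 1 := by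
  rw [stepBit_eq_true_iff]
  constructor
  · rintro ⟨m, hm⟩
    have hr : 0 < rate L R κ := by
      rcases (rate_nonneg hL hR κ).eq_or_lt with h0 | h0
      · rw [← h0, mul_zero, stepRate_zero] at hm
        simp at hm
      · exact h0
    exact ⟨⟨(κ, m), hr, hb⟩, rfl, hm.symm⟩
  · rintro ⟨e, rfl, he⟩
    exact ⟨e.1.2, he.symm⟩

/-- For small `ε` the discretized clocks are coupled to the clocks of the exclusion process. -/
lemma GoodClocks.eventually_coupled (h : GoodClocks L R t ξ) (hL : 0 ≤ L) (hR : 0 ≤ R)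
    (ht : ∀ r, 0 < t r) (r : Fin k) {lo hi : ℤ} :
    ∀ᶠ ε : ℝ in 𝓝[>] 0,
      Coupled (timeGraph L R ξ) (SixVertex.movingBit (leftBits (ε * L) ξ))
        (SixVertex.movingBit (rightBits (ε * R) ξ)) (t r) lo hi
        (fun e : BoxRing L R lo hi => e.1.1) (fun e => ringTime L R ξ e.1.1 e.1.2)
        (fun e => ringStep L R ξ ε e.1.1 e.1.2) ∧
      ∀ e : BoxRing L R lo hi,
        ringTime L R ξ e.1.1 e.1.2 ≤ t r ↔ ringStep L R ξ ε e.1.1 e.1.2 ≤ ⌊ε⁻¹ * t r⌋₊ := by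
  have hK : {κ : ℤ × Bool | bond κ ∈ Set.Icc lo hi ∧ 0 < rate L R κ}.Finite :=
    (finite_bond_mem_Icc lo hi).subset fun κ hκ => hκ.1
  have hfin : {e : BoxRing L R lo hi | ringTime L R ξ e.1.1 e.1.2 ≤ t r}.Finite := by
    have h1 : (⋃ κ ∈ {κ : ℤ × Bool | bond κ ∈ Set.Icc lo hi ∧ 0 < rate L R κ},
        Prod.mk κ '' {m | ringTime L R ξ κ m ≤ t r}).Finite :=
      hK.biUnion fun κ hκ => (h.finite_ringTime_le hκ.2 _).image _
    refine Set.Finite.of_finite_image (f := Subtype.val) (h1.subset ?_)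
      Subtype.val_injective.injOn
    rintro _ ⟨e, he, rfl⟩
    simp only [Set.mem_iUnion]
    exact ⟨e.1.1, ⟨e.2.2, e.2.1⟩, e.1.2, he, rfl⟩
  have horder : ∀ᶠ ε : ℝ in 𝓝[>] 0, ∀ e ∈ {e : BoxRing L R lo hi |
      ringTime L R ξ e.1.1 e.1.2 ≤ t r}, ∀ e' ∈ {e : BoxRing L R lo hi |
      ringTime L R ξ e.1.1 e.1.2 ≤ t r}, ringTime L R ξ e.1.1 e.1.2 < ringTime L R ξ e'.1.1 e'.1.2 →
      ringStep L R ξ ε e.1.1 e.1.2 < ringStep L R ξ ε e'.1.1 e'.1.2 := by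
    refine (Filter.eventually_all_finite hfin).2 fun e _ =>
      (Filter.eventually_all_finite hfin).2 fun e' _ => ?_
    by_cases hlt : ringTime L R ξ e.1.1 e.1.2 < ringTime L R ξ e'.1.1 e'.1.2
    · filter_upwards [(h.tendsto_mul_ringStep e.2.1 e.1.2).eventually_lt
        (h.tendsto_mul_ringStep e'.2.1 e'.1.2) hlt, self_mem_nhdsWithin] with ε h1 (h2 : 0 < ε) _
      exact_mod_cast lt_of_mul_lt_mul_left h1 h2.le
    · exact Eventually.of_forall fun _ h' => absurd h' hlt
  filter_upwards [horder, (Filter.eventually_all_finite hK).2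
      fun κ hκ => h.eventually_ringTime_le_iff ht hκ.2 r, (Filter.eventually_all_finite hK).2
      fun κ hκ => h.eventually_le_ringStep hκ.2 lo.natAbs] with ε h1 h2 h3
  have hlate : ∀ e : BoxRing L R lo hi, lo.natAbs < ringStep L R ξ ε e.1.1 e.1.2 :=
    fun e => h3 e.1.1 ⟨e.2.2, e.2.1⟩ e.1.2
  refine ⟨?_, fun e => h2 e.1.1 ⟨e.2.2, e.2.1⟩ e.1.2⟩
  refine ⟨fun e => e.2.2, fun e => h.ringTime_pos e.2.1 _, fun e => by have := hlate e; omega,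
    fun e => (h.mem_timeGraph_iff hL hR).2 ⟨e.1.1, e.1.2, e.2.1, rfl, rfl, rfl⟩, ?_, ?_, ?_, ?_,
    hfin, fun e e' hlt he' => h1 e (hlt.le.trans he') e' he' hlt⟩
  · intro s κ hs hb hg
    obtain ⟨κ', m, hr, hx, hj, hm⟩ := (h.mem_timeGraph_iff hL hR).1 hg
    obtain rfl : κ' = κ := by
      obtain ⟨x, β⟩ := κ
      obtain ⟨x', β'⟩ := κ'
      obtain rfl : x' = x := hx
      cases β <;> cases β' <;> simp [target] at hj ⊢ <;> omega
    exact ⟨⟨(κ', m), hr, hb⟩, rfl, hm⟩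
  · intro n d hd
    have hb : bond (d + 1, false) ∈ Set.Icc lo hi := by simpa [bond] using hd
    rw [← exists_boxRing_iff_stepBit hL hR hb n (ξ := ξ) (ε := ε)]
    unfold SixVertex.movingBit leftBits
    rw [Bool.and_eq_true, decide_eq_true_eq]
    constructor
    · rintro ⟨h4, h5⟩
      have h6 : (((d + n + 1).toNat : ℕ) : ℤ) - ((n + 1 : ℕ) : ℤ) + 1 = d + 1 := by omega
      dsimp only at h5
      rwa [h6] at h5
    · intro h5
      obtain ⟨e, -, he⟩ := (exists_boxRing_iff_stepBit hL hR hb n).1 h5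
      have h4 : 0 ≤ d + n := by
        have h7 := hlate e
        have h8 := hd.1
        omega
      refine ⟨h4, ?_⟩
      have h6 : (((d + n + 1).toNat : ℕ) : ℤ) - ((n + 1 : ℕ) : ℤ) + 1 = d + 1 := by omega
      dsimp only
      rwa [h6]
  · intro n d hd
    have hb : bond (d, true) ∈ Set.Icc lo hi := by simpa [bond] using hd
    rw [← exists_boxRing_iff_stepBit hL hR hb n (ξ := ξ) (ε := ε)]
    unfold SixVertex.movingBit rightBits
    rw [Bool.and_eq_true, decide_eq_true_eq]
    constructor
    · rintro ⟨h4, h5⟩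
      have h6 : (((d + n + 1).toNat : ℕ) : ℤ) - ((n + 1 : ℕ) : ℤ) = d := by omega
      dsimp only at h5
      rwa [h6] at h5
    · intro h5
      obtain ⟨e, -, he⟩ := (exists_boxRing_iff_stepBit hL hR hb n).1 h5
      have h4 : 0 ≤ d + n := by
        have h7 := hlate e
        have h8 := hd.1
        omega
      refine ⟨h4, ?_⟩
      have h6 : (((d + n + 1).toNat : ℕ) : ℤ) - ((n + 1 : ℕ) : ℤ) = d := by omega
      dsimp only
      rwa [h6]
  · rintro ⟨⟨κ, m⟩, hr, hb⟩ ⟨⟨κ', m'⟩, hr', hb'⟩ he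
    dsimp only at he hr hr'
    by_cases hκ : κ = κ'
    · subst hκ
      have := (h.ringTime_strictMono hr).injective he
      subst this
      rfl
    · exact absurd he (h.ringTime_ne κ κ' hκ hr hr' m m')

/-- For good clocks, and for small `ε`, the six-vertex model driven by the discretized clocks has the
particle `i` at the site `s` exactly if the exclusion process does. -/
theorem GoodClocks.eventually_hasParticle_iff (h : GoodClocks L R t ξ) (hL : 0 ≤ L) (hR : 0 ≤ R)
    (ht : ∀ r, 0 < t r) (φ : ℕ → Bool × Bool) (r : Fin k) (i s : ℤ) :
    ∀ᶠ ε : ℝ in 𝓝[>] 0,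
      SixVertex.HasParticle (SixVertex.drivenEnsemble (leftBits (ε * L) ξ) (rightBits (ε * R) ξ) φ)
        φ ⌊ε⁻¹ * t r⌋₊ i s ↔
      position (timeGraph L R ξ) (initialConfig φ) (t r) i = some s := by
  have hex := h.exists_isTrajectory hL hR (initialConfig φ)
  have hX := hex.choose_spec
  have hpos : position (timeGraph L R ξ) (initialConfig φ) (t r) i = hex.choose (t r) i := by
    rw [position, dif_pos hex]
  rw [hpos]
  set X := hex.choose
  obtain ⟨lo, hi, hlo, hhi, hseal⟩ := h.exists_sealed hL hR (t r) |s|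
  have habs := abs_nonneg s
  have hsb : s ∈ Set.Ioc lo hi := ⟨hlo.trans_le (neg_abs_le s), (le_abs_self s).trans hhi.le⟩
  obtain ⟨m, rfl⟩ : ∃ m : ℕ, lo = -m := ⟨lo.natAbs, by omega⟩
  have hlarge : ∀ᶠ ε : ℝ in 𝓝[>] 0, m ≤ ⌊ε⁻¹ * t r⌋₊ := by
    have h1 : Tendsto (fun ε : ℝ => ε⁻¹ * t r) (𝓝[>] 0) atTop :=
      tendsto_inv_nhdsGT_zero.atTop_mul_const (ht r)
    filter_upwards [h1.eventually_ge_atTop (m : ℝ)] with ε hε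
    exact Nat.le_floor hε
  filter_upwards [h.eventually_coupled hL hR ht r (lo := -m) (hi := hi), hlarge]
    with ε ⟨hC, hcomp⟩ hm
  set N := ⌊ε⁻¹ * t r⌋₊
  have hlohi : (-m : ℤ) < hi := by omega
  have hmem : (-m : ℤ) ∈ Set.Icc (-m : ℤ) hi := ⟨le_rfl, hlohi.le⟩
  -- Nothing happens at the sealed bond `-m` before step `N`.
  have hnot : ∀ n < N, ∀ κ : ℤ × Bool, bond κ = -m →
      ¬ ∃ e : BoxRing L R (-m) hi, e.1.1 = κ ∧ ringStep L R ξ ε e.1.1 e.1.2 = n + 1 := by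
    rintro n hn ⟨x, β⟩ hb ⟨e, he, hstep⟩
    have h1 : ringTime L R ξ e.1.1 e.1.2 ≤ t r := (hcomp e).2 (by omega)
    have h2 := hC.mem_graph e
    have h3 := hseal _ _ _ (hC.time_pos e) h1 h2
    rw [he] at h3
    cases β <;> simp only [bond, target, Bool.false_eq_true, if_true, if_false, Set.mem_Ioc]
      at hb h3 <;> omega
  have hA : ∀ n < N, SixVertex.movingBit (leftBits (ε * L) ξ) n (-m) = false := by
    intro n hn
    rw [← Bool.not_eq_true, hC.left_bit n _ hmem]
    exact hnot n hn _ (by simp [bond])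
  have hB : ∀ n < N, SixVertex.movingBit (rightBits (ε * R) ξ) n (-m) = false := by
    intro n hn
    rw [← Bool.not_eq_true, hC.right_bit n _ hmem]
    exact hnot n hn _ (by simp [bond])
  have hconf := hC.config_eq (SixVertex.moving_rule (leftBits (ε * L) ξ) (rightBits (ε * R) ξ) φ)
    (SixVertex.movingConfig_zero _ _ φ) hX (nearestNeighbour_timeGraph L R ξ)
    (h.noSimultaneous hL hR) hseal hlohi le_rfl N (t r) (ht r).le le_rfl hcomp
  rw [SixVertex.hasParticle_iff_of_silent_bond _ _ φ m N hA hB hm i s hsb.1,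
    hX.eq_some_iff (nearestNeighbour_timeGraph L R ξ) (h.noSimultaneous hL hR) hseal (by omega)
      (ht r).le le_rfl hsb, hconf s hsb]
  have hfilter : (Finset.Ioo (-m : ℤ) s).filter (fun q => SixVertex.movingConfig
      (SixVertex.drivenEnsemble (leftBits (ε * L) ξ) (rightBits (ε * R) ξ) φ)
      (initialConfig φ) N q = true) =
      (Finset.Ioo (-m : ℤ) s).filter (fun q => config (X (t r)) q = true) := by
    refine Finset.filter_congr fun q hq => ?_
    rw [Finset.mem_Ioo] at hq
    rw [hconf q ⟨hq.1, hq.2.le.trans hsb.2⟩]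
  rw [hfilter]

end ASEP


/-! ### The limit -/

/-- Almost everywhere convergence of indicators of measurable sets implies convergence of the
measures, without assuming that the limit set is measurable. -/
lemma tendsto_measure_of_ae_eventually_mem_iff {α ι : Type*} [MeasurableSpace α] {μ : Measure α}
    [IsFiniteMeasure μ] {l : Filter ι} [l.IsCountablyGenerated] [l.NeBot] {A : ι → Set α}
    {B : Set α} (hA : ∀ i, MeasurableSet (A i))
    (h : ∀ᵐ x ∂μ, ∀ᶠ i in l, (x ∈ A i ↔ x ∈ B)) :
    Tendsto (fun i => μ (A i)) l (𝓝 (μ B)) := by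
  have hB : NullMeasurableSet B μ := by
    obtain ⟨u, hu⟩ := l.exists_seq_tendsto
    refine NullMeasurableSet.congr (s := ⋃ n, ⋂ m ≥ n, A (u m))
      (MeasurableSet.iUnion fun n => MeasurableSet.iInter fun m => MeasurableSet.iInter fun _ =>
        hA (u m)).nullMeasurableSet ?_
    filter_upwards [h] with x hx
    obtain ⟨N, hN⟩ := eventually_atTop.1 (hu.eventually hx)
    apply propext
    change x ∈ (⋃ n, ⋂ m ≥ n, A (u m)) ↔ x ∈ B
    simp only [Set.mem_iUnion, Set.mem_iInter]
    constructor
    · rintro ⟨n, hn⟩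
      exact (hN _ (le_max_right n N)).1 (hn _ (le_max_left n N))
    · intro hxB
      exact ⟨N, fun m hm => (hN m hm).2 hxB⟩
  rw [← measure_toMeasurable B]
  refine tendsto_measure_of_ae_tendsto_indicator_of_isFiniteMeasure l
    (measurableSet_toMeasurable μ B) hA ?_
  filter_upwards [h, hB.toMeasurable_ae_eq.mem_iff] with x hx hxB
  filter_upwards [hx] with i hi
  rw [hi, hxB]

namespace SixVertex

instance : IsProbabilityMeasure vertexMeasure := by unfold vertexMeasure; infer_instance

lemma measurableSet_exists_hasParticle {Ω Ω' : Type*} [MeasurableSpace Ω] [MeasurableSpace Ω']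
    {φ : ℕ → Ω → Bool × Bool} (hφ : ∀ i, Measurable (φ i)) {a b : Ω' → ℕ × ℕ → Bool}
    (ha : ∀ v, Measurable fun ω => a ω v) (hb : ∀ v, Measurable fun ω => b ω v)
    {k : ℕ} (i : Fin k → ℤ) (n : Fin k → ℕ) (S : Finset (Fin k → ℤ)) :
    MeasurableSet {ω : Ω × Ω' | ∃ s ∈ S, ∀ r : Fin k, HasParticle (drivenEnsemble
      (a ω.2) (b ω.2) (fun n => φ n ω.1)) (fun n => φ n ω.1) (n r) (i r) (s r)} := by
  have hφ' : ∀ m, Measurable fun ω : Ω × Ω' => φ m ω.1 := fun m => (hφ m).comp measurable_fst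
  have : {ω : Ω × Ω' | ∃ s ∈ S, ∀ r : Fin k, HasParticle (drivenEnsemble
      (a ω.2) (b ω.2) (fun n => φ n ω.1)) (fun n => φ n ω.1) (n r) (i r) (s r)} =
      ⋃ s ∈ S, ⋂ r : Fin k, {ω : Ω × Ω' | HasParticle (drivenEnsemble
      (a ω.2) (b ω.2) (fun n => φ n ω.1)) (fun n => φ n ω.1) (n r) (i r) (s r)} := by
    ext ω; simp
  rw [this]
  exact Finset.measurableSet_biUnion _ fun s _ => MeasurableSet.iInter fun r =>
    measurableSet_hasParticle (measurable_drivenEnsemble (fun v => (ha v).comp measurable_snd)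
      (fun v => (hb v).comp measurable_snd) hφ') hφ' _ _ _

/-- The six-vertex model may be driven by the discretized clocks of the exclusion process. -/
lemma measure_offsetPosition_eq {Ω : Type*} [MeasurableSpace Ω] (P : Measure Ω)
    [IsProbabilityMeasure P] (φ : ℕ → Ω → Bool × Bool) (hφ : ∀ i, Measurable (φ i))
    {δ₁ δ₂ : ℝ} (h₁ : 0 ≤ δ₁) (h₁' : δ₁ < 1) (h₂ : 0 ≤ δ₂) (h₂' : δ₂ < 1)
    {k : ℕ} (i : Fin k → ℤ) (n : Fin k → ℕ) (S : Finset (Fin k → ℤ)) :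
    (P.prod vertexMeasure) {ω | ∃ s ∈ S, ∀ r : Fin k,
      offsetPosition δ₁ δ₂ (fun n => φ n ω.1) ω.2 (n r) (i r) = some (s r)} =
    (P.prod ASEP.clockMeasure) {ω | ∃ s ∈ S, ∀ r : Fin k,
      HasParticle (drivenEnsemble (ASEP.leftBits δ₁ ω.2) (ASEP.rightBits δ₂ ω.2)
        (fun n => φ n ω.1)) (fun n => φ n ω.1) (n r) (i r) (s r)} := by
  classical
  have hset : {ω : Ω × (ℕ × ℕ → unitInterval) | ∃ s ∈ S, ∀ r : Fin k,
      offsetPosition δ₁ δ₂ (fun n => φ n ω.1) ω.2 (n r) (i r) = some (s r)} =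
      {ω | ∃ s ∈ S, ∀ r : Fin k, HasParticle (drivenEnsemble
        (fun v => decide ((ω.2 v : ℝ) < δ₁)) (fun v => decide ((ω.2 v : ℝ) < δ₂))
        (fun n => φ n ω.1)) (fun n => φ n ω.1) (n r) (i r) (s r)} := by
    ext ω
    simp only [Set.mem_ofPred_eq, offsetPosition_eq_some_iff]
    have he : ensemble δ₁ δ₂ (fun n => φ n ω.1) ω.2 = drivenEnsemble
        (fun v => decide ((ω.2 v : ℝ) < δ₁)) (fun v => decide ((ω.2 v : ℝ) < δ₂))
        (fun n => φ n ω.1) := by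
      funext x y
      exact ensemble_eq_drivenEnsemble _ _ _ _ _ _
    rw [he]
  have hva : ∀ (δ : ℝ) (v : ℕ × ℕ),
      Measurable fun u : ℕ × ℕ → unitInterval => decide ((u v : ℝ) < δ) :=
    fun δ v => (measurable_decide_lt δ).comp (measurable_pi_apply v)
  rw [hset, Measure.prod_apply (measurableSet_exists_hasParticle hφ (hva δ₁) (hva δ₂) i n S),
    Measure.prod_apply (measurableSet_exists_hasParticle hφ (ASEP.measurable_leftBits δ₁)
      (ASEP.measurable_rightBits δ₂) i n S)]
  refine lintegral_congr fun ω => ?_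
  -- The event depends on the ensemble in a finite box only.
  refine measure_drivenEnsemble_mem_eq (bernoulliQueries_vertex h₁ h₁' h₂ h₂')
    (ASEP.bernoulliQueries_clock h₁ h₁' h₂ h₂') (hva δ₁) (hva δ₂) (ASEP.measurable_leftBits δ₁)
    (ASEP.measurable_rightBits δ₂) (fun n => φ n ω)
    (S.sup fun s => Finset.univ.sup fun r => (s r + n r).toNat) (Finset.univ.sup n)
    {e | ∃ s ∈ S, ∀ r : Fin k, HasParticle e (fun n => φ n ω) (n r) (i r) (s r)} ?_
  intro e e' hee'
  simp only [Set.mem_ofPred_eq]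
  refine exists_congr fun s => and_congr_right fun hs => forall_congr' fun r => ?_
  refine hasParticle_congr _ ?_ fun x hx => hee' x hx (n r) (Finset.le_sup (Finset.mem_univ r))
  exact (Finset.le_sup (f := fun r => (s r + n r).toNat) (Finset.mem_univ r)).trans
    (Finset.le_sup (f := fun s : Fin k → ℤ => Finset.univ.sup fun r => (s r + n r).toNat) hs)

end SixVertex

theorem theorem3 {Ω : Type*} [MeasurableSpace Ω] (P : Measure Ω) [IsProbabilityMeasure P]
    (φ : ℕ → Ω → Bool × Bool) (hφ : ∀ i, Measurable (φ i))
    (L R : ℝ) (hL : 0 ≤ L) (hR : 0 ≤ R)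
    (k : ℕ) (i : Fin k → ℤ) (t : Fin k → ℝ) (ht : ∀ r, 0 < t r)
    (S : Finset (Fin k → ℤ)) :
    Tendsto
      (fun ε : ℝ => (P.prod SixVertex.vertexMeasure)
        {ω | ∃ s ∈ S, ∀ r : Fin k,
          SixVertex.offsetPosition (ε * L) (ε * R) (fun n => φ n ω.1) ω.2 ⌊ε⁻¹ * t r⌋₊ (i r)
            = some (s r)})
      (𝓝[>] 0)
      (𝓝 ((P.prod ASEP.clockMeasure)
        {ω | ∃ s ∈ S, ∀ r : Fin k,
          ASEP.position (ASEP.timeGraph L R ω.2) (ASEP.initialConfig (fun n => φ n ω.1)) (t r) (i r)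
            = some (s r)})) := by
  have hsmall : ∀ r : ℝ, ∀ᶠ ε : ℝ in 𝓝[>] 0, ε * r < 1 := by
    intro r
    have h : Tendsto (fun ε : ℝ => ε * r) (𝓝 0) (𝓝 (0 * r)) := tendsto_id.mul_const _
    rw [zero_mul] at h
    exact (h.mono_left nhdsWithin_le_nhds).eventually (gt_mem_nhds one_pos)
  refine Tendsto.congr' ?_ (tendsto_measure_of_ae_eventually_mem_iff (fun ε =>
    SixVertex.measurableSet_exists_hasParticle hφ (ASEP.measurable_leftBits (ε * L))
      (ASEP.measurable_rightBits (ε * R)) i (fun r => ⌊ε⁻¹ * t r⌋₊) S) ?_)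
  · filter_upwards [hsmall L, hsmall R, self_mem_nhdsWithin] with ε h₁ h₂ (h₃ : 0 < ε)
    exact (SixVertex.measure_offsetPosition_eq P φ hφ (mul_nonneg h₃.le hL) h₁
      (mul_nonneg h₃.le hR) h₂ i (fun r => ⌊ε⁻¹ * t r⌋₊) S).symm
  · have hgood : ∀ᵐ ω ∂P.prod ASEP.clockMeasure, ASEP.GoodClocks L R t ω.2 :=
      Measure.quasiMeasurePreserving_snd.ae (ASEP.ae_goodClocks L R t)
    filter_upwards [hgood] with ω hω
    filter_upwards [(Filter.eventually_all_finset S).2 fun s _ => Filter.eventually_all.2 fun r =>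
      hω.eventually_hasParticle_iff hL hR ht (fun n => φ n ω.1) r (i r) (s r)] with ε hε
    exact exists_congr fun s => and_congr_right fun hs => forall_congr' fun r => hε s hs r
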